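/- **Conventions.** Let $(X,\mathrm{dist})$ be a metric space. For $S\subseteq X$, $\delta\ge 0$ put $\mathcal N_\delta(S)=\{x\in X:\mathrm{dist}(x,S)<\delta\}$, where $\mathrm{dist}(x,\emptyset)=\infty$. A *geodesic of length $\ell\ge 0$* is an isometric embedding $\mathfrak q:[0,\ell]\to X$; a subset is *geodesic* if any two of its points are joined by a geodesic contained in it, and $X$ is a geodesic space if it is a geodesic subset of itself. For $k\ge2$, a *geodesic $k$-gon* $P$ consists of geodesics (edges) $\mathfrak q_1,\dots,\mathfrak q_k$, possibly of length $0$, such that the end of $\mathfrak q_i$ is the beginning of $\mathfrak q_{i+1}$ (indices modulo $k$); these common points are the vertices. For $\vartheta>0$, $\sigma\ge1$, $\nu\ge4\sigma$ it is *$(\vartheta,\sigma,\nu)$-fat* if * $(F_1)$ for every edge $\mathfrak q$ with endpoints $x,y$, the set $\mathfrak q\setminus\mathcal N_{\sigma\vartheta}(\{x,y\})$ is at distance at least $\vartheta$ from the union of the other edges; * $(F_2)$ every vertex $x$ is at distance at least $\nu\vartheta$ from the union of the edges not adjacent to $x$ (a distance from or to the empty set is $\infty$, so $(F_2)$ is void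 for $k=2$). A complete geodesic metric space $F$ is *tree-graded* with respect to a family $(P_a)_{a\in K}$ of closed geodesic subsets (pieces) if $(T_1)$ $P_a\cap P_b$ has at most one point whenever $a\ne b$, and $(T_2)$ every simple geodesic triangle (a simple loop composed of three geodesics, or a single point) is contained in one piece. Let $\omega$ be a non-principal ultrafilter over a countable set $J$, $e=(e_n)_{n\in J}$ a sequence in $X$ and $d=(d_n)_{n\in J}$ a sequence of real numbers with $\lim_\omega d_n=\infty$. The *asymptotic cone* $\mathrm{Con}^\omega(X;e,d)$ is the set of sequences $(x_n)_{n\in J}$ in $X$ with $\lim_\omega \mathrm{dist}(x_n,e_n)/d_n<\infty$, with the pseudo-metric $\lim_\omega\mathrm{dist}(x_n,y_n)/d_n$, modulo points at distance $0$; $\lim^\omega(x_n)$ is the class of $(x_n)$, and $\lim^\omega(S_n)$ is the set of all $\lim^\omega(x_n)$ with $x_n\in S_n$ $\omega$-almost surely. Given a family $\mathcal A=(A_i)_{i\in I}$ of subsets of $X$, let $\mathcal A_\omega$ be the family of sets $\lim^\omega(A_{i_n})$, indexed by those elements $(i_n)^\omega$ of the ultrapower $I^\omega$ for which $\mathrm{dist}(e_n,A_{i_n})/d_n$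 is bounded $\omega$-almost surely. $X$ is *asymptotically tree-graded* with respect to $\mathcal A$ if every asymptotic cone $\mathrm{Con}^\omega(X;e,d)$ (for all $J,\omega,e,d$) is tree-graded with respect to $\mathcal A_\omega$. **Theorem.** Let $(X,\mathrm{dist})$ be a geodesic metric space and let $\mathcal A=(A_i)_{i\in I}$ be a family of subsets of $X$. Then $X$ is asymptotically tree-graded with respect to $\mathcal A$ if and only if the following three properties hold. * $(\alpha_1)$ For every $\delta>0$ the diameters of the intersections $\mathcal N_\delta(A_i)\cap\mathcal N_\delta(A_j)$ are uniformly bounded for all $i\ne j$. * $(\alpha_2)$ For every $\theta\in[0,\tfrac12)$ there exists $M>0$ such that for every geodesic $\mathfrak q$ of length $\ell$ and every $i\in I$ with $\mathfrak q(0),\mathfrak q(\ell)\in\mathcal N_{\theta\ell}(A_i)$ we have $\mathfrak q([0,\ell])\cap\mathcal N_M(A_i)\ne\emptyset$. * $(\alpha_3)$ For every integer $k\ge2$ there exist $\vartheta>0$, $\nu\ge8$ and $\chi>0$ such that every geodesic $k$-gon $P$ in $X$ that is $(\vartheta,2,\nu)$-fat satisfies $P\subseteq\mathcal N_\chi(A_i)$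 for some $i\in I$. -/

import Mathlib

open Filter Topology Metric

universe u v

noncomputable section

namespace TreeGraded

/-! ### Geodesics and polygons -/

section Geodesics

variable {X : Type u} [MetricSpace X]

/-- `q` restricted to `[0, ℓ]` is a geodesic of length `ℓ`, i.e. an isometric embedding. -/
def IsGeodesic (q : ℝ → X) (ℓ : ℝ) : Prop :=
  0 ≤ ℓ ∧ ∀ s ∈ Set.Icc (0 : ℝ) ℓ, ∀ t ∈ Set.Icc (0 : ℝ) ℓ, dist (q s) (q t) = |s - t|

/-- Every two points of `S` are joined by a geodesic contained in `S`. -/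
def IsGeodesicSubset (S : Set X) : Prop :=
  ∀ x ∈ S, ∀ y ∈ S, ∃ (q : ℝ → X) (ℓ : ℝ),
    IsGeodesic q ℓ ∧ q 0 = x ∧ q ℓ = y ∧ q '' Set.Icc 0 ℓ ⊆ S

variable (X) in
/-- A geodesic metric space. -/
def IsGeodesicSpace : Prop :=
  IsGeodesicSubset (Set.univ : Set X)

variable (X) in
/-- A geodesic `k`-gon: `k` geodesics, cyclically indexed, the `i`-th of which ends where the
`(i+1)`-st begins. Edges may be degenerate. (Only used for `k ≥ 2`.) -/
structure GeodesicPolygon (k : ℕ) where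
  /-- the edges -/
  edge : ZMod k → ℝ → X
  /-- the lengths of the edges -/
  len : ZMod k → ℝ
  isGeodesic : ∀ i, IsGeodesic (edge i) (len i)
  closes : ∀ i, edge i (len i) = edge (i + 1) 0

namespace GeodesicPolygon

variable {k : ℕ} (P : GeodesicPolygon X k)

/-- The `i`-th edge as a set. -/
def side (i : ZMod k) : Set X :=
  P.edge i '' Set.Icc 0 (P.len i)

/-- The `i`-th vertex: the start of the `i`-th edge and the end of the `(i-1)`-st one. -/
def vertex (i : ZMod k) : X :=
  P.edge i 0

/-- The polygon as a set. -/
def carrier : Set X :=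
  ⋃ i, P.side i

/-- The union of the edges other than the `i`-th one. -/
def others (i : ZMod k) : Set X :=
  ⋃ j ∈ {j : ZMod k | j ≠ i}, P.side j

/-- The union of the edges that are not adjacent to the `i`-th vertex. -/
def opposite (i : ZMod k) : Set X :=
  ⋃ j ∈ {j : ZMod k | j ≠ i ∧ j ≠ i - 1}, P.side j

/-- `(θ, σ, ν)`-fatness. A lower bound on a distance between sets is stated pointwise, so it holds
if one of the sets is empty (distance to the empty set is `∞`). -/
structure IsFat (θ σ ν : ℝ) : Prop where
  /-- The part of an edge outside the `σθ`-neighbourhood of its endpoints is at distance at least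
  `θ` from the other edges. -/
  fat_edge : ∀ i, ∀ z ∈ P.side i \ thickening (σ * θ) {P.vertex i, P.vertex (i + 1)},
    ∀ w ∈ P.others i, θ ≤ dist z w
  /-- Every vertex is at distance at least `νθ` from the edges not adjacent to it. -/
  fat_vertex : ∀ i, ∀ w ∈ P.opposite i, ν * θ ≤ dist (P.vertex i) w

/-- A geodesic triangle is simple if two edges meet only in their common vertex. As geodesics are
injective, this says that the triangle is a simple loop or that it is a single point. -/
def IsSimpleTriangle (T : GeodesicPolygon X 3) : Prop :=
  ∀ i, T.side i ∩ T.side (i + 1) ⊆ {T.vertex (i + 1)}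

end GeodesicPolygon

/-- `X` is tree-graded with respect to the family of pieces `P`. The family is indexed:
two pieces are different if their indices are. -/
structure IsTreeGraded {κ : Type*} (P : κ → Set X) : Prop where
  complete : CompleteSpace X
  geodesic : IsGeodesicSpace X
  closed_piece : ∀ a, IsClosed (P a)
  geodesic_piece : ∀ a, IsGeodesicSubset (P a)
  /-- Two different pieces have at most one common point. -/
  inter_subsingleton : ∀ a b, a ≠ b → (P a ∩ P b).Subsingleton
  /-- Every simple geodesic triangle is contained in one piece. -/
  triangle_subset : ∀ T : GeodesicPolygon X 3, T.IsSimpleTriangle → ∃ a, T.carrier ⊆ P a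

end Geodesics

/-! ### Asymptotic cones -/

section Cone

variable {X : Type u} [MetricSpace X] {I : Type}

/-- Sequences at finite distance from the observation point `e`, for the rescaled metrics
`dist / d n`. -/
def FiniteSeq (ω : Ultrafilter I) (e : I → X) (d : I → ℝ)
    (_hd : Tendsto d ω atTop) : Type u :=
  {x : I → X // ∃ C : ℝ, ∀ᶠ n in (ω : Filter I), dist (x n) (e n) / d n ≤ C}

variable {ω : Ultrafilter I} {e : I → X} {d : I → ℝ} {hd : Tendsto d ω atTop}

/-- The pseudo-distance `lim_ω dist (x n) (y n) / d n`. -/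
def FiniteSeq.limDist (x y : FiniteSeq ω e d hd) : ℝ :=
  limUnder (ω : Filter I) fun n => dist (x.1 n) (y.1 n) / d n

theorem FiniteSeq.tendsto_limDist (x y : FiniteSeq ω e d hd) :
    Tendsto (fun n => dist (x.1 n) (y.1 n) / d n) ω (𝓝 (x.limDist y)) := by
  obtain ⟨C, hC⟩ := x.2
  obtain ⟨C', hC'⟩ := y.2
  have hmem : ∀ᶠ n in (ω : Filter I),
      dist (x.1 n) (y.1 n) / d n ∈ Set.Icc (0 : ℝ) (C + C') := by
    filter_upwards [hC, hC', hd.eventually_gt_atTop 0] with n h h' hn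
    refine ⟨by positivity, ?_⟩
    calc dist (x.1 n) (y.1 n) / d n
        ≤ (dist (x.1 n) (e n) + dist (y.1 n) (e n)) / d n := by
          gcongr; exact dist_triangle_right _ _ _
      _ = dist (x.1 n) (e n) / d n + dist (y.1 n) (e n) / d n := add_div _ _ _
      _ ≤ C + C' := add_le_add h h'
  obtain ⟨a, -, ha⟩ := (isCompact_Icc (a := (0 : ℝ)) (b := C + C')).ultrafilter_le_nhds
    (ω.map fun n => dist (x.1 n) (y.1 n) / d n) (le_principal_iff.2 hmem)
  exact tendsto_nhds_limUnder ⟨a, ha⟩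

instance : PseudoMetricSpace (FiniteSeq ω e d hd) where
  dist := FiniteSeq.limDist
  dist_self x := by
    refine tendsto_nhds_unique (x.tendsto_limDist x) ?_
    simp
  dist_comm x y := by
    refine tendsto_nhds_unique (x.tendsto_limDist y) ?_
    simpa only [dist_comm] using y.tendsto_limDist x
  dist_triangle x y z := by
    refine le_of_tendsto_of_tendsto (x.tendsto_limDist z)
      ((x.tendsto_limDist y).add (y.tendsto_limDist z)) ?_
    filter_upwards [hd.eventually_gt_atTop 0] with n hn
    rw [← add_div]
    gcongr
    exact dist_triangle _ _ _

/-- The asymptotic cone `Con^ω(X; e, d)`: the metric space obtained by identifying sequences at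
pseudo-distance `0`. -/
abbrev Cone (ω : Ultrafilter I) (e : I → X) (d : I → ℝ) (hd : Tendsto d ω atTop) : Type u :=
  SeparationQuotient (FiniteSeq ω e d hd)

/-- The limit set `lim^ω S n`: all points `lim^ω x n` with `x n ∈ S n` `ω`-almost surely. -/
def limSet (hd : Tendsto d ω atTop) (e : I → X) (S : I → Set X) : Set (Cone ω e d hd) :=
  {p | ∃ x : FiniteSeq ω e d hd,
    SeparationQuotient.mk x = p ∧ ∀ᶠ n in (ω : Filter I), x.1 n ∈ S n}

variable {ι : Type v}

/-- The piece `lim^ω A (i n)` attached to the element `(i n)^ω` of the ultrapower of the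
index set. -/
def limPiece (hd : Tendsto d ω atTop) (e : I → X) (A : ι → Set X)
    (g : (ω : Filter I).Germ ι) : Set (Cone ω e d hd) :=
  g.liftOn (fun i => limSet hd e fun n => A (i n)) <| by
    intro i j (hij : i =ᶠ[(ω : Filter I)] j)
    ext p
    refine exists_congr fun x => and_congr_right fun _ => eventually_congr ?_
    filter_upwards [hij] with n hn
    rw [hn]

/-- The sequence `dist (e n, A (i n)) / d n` is bounded (`ω`-almost surely, so that it only depends
on `(i n)^ω`). The distance to the empty set is `∞`. -/
def IsBoundedIndex (e : I → X) (d : I → ℝ) (A : ι → Set X) (g : (ω : Filter I).Germ ι) : Prop :=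
  g.liftOn (fun i => ∃ C : ℝ, ∀ᶠ n in (ω : Filter I),
      infEDist (e n) (A (i n)) ≤ ENNReal.ofReal (C * d n)) <| by
    intro i j (hij : i =ᶠ[(ω : Filter I)] j)
    refine propext (exists_congr fun C => eventually_congr ?_)
    filter_upwards [hij] with n hn
    rw [hn]

end Cone

/-! ### Asymptotically tree-graded spaces -/

section Asymptotic

variable {X : Type u} [MetricSpace X] {ι : Type v}

/-- Every asymptotic cone, for every non-principal ultrafilter `ω` over a countable set, every
observation point `e` and all scaling constants `d` with `lim_ω d = ∞`, is tree-graded with respect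
to the limit sets `lim^ω A (i n)`, indexed by the `(i n)^ω` for which `dist (e n, A (i n)) / d n` is
bounded. -/
def IsAsymptoticallyTreeGraded (A : ι → Set X) : Prop :=
  ∀ (I : Type) [Countable I] (ω : Ultrafilter I), (ω : Filter I) ≤ cofinite →
    ∀ (e : I → X) (d : I → ℝ) (hd : Tendsto d ω atTop),
      IsTreeGraded fun g : {g : (ω : Filter I).Germ ι // IsBoundedIndex e d A g} =>
        limPiece hd e A g.1

/-- Condition `(α₁)`. -/
def Alpha1 (A : ι → Set X) : Prop :=
  ∀ δ > (0 : ℝ), ∃ D : ℝ, ∀ i j, i ≠ j →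
    ∀ x ∈ thickening δ (A i) ∩ thickening δ (A j),
    ∀ y ∈ thickening δ (A i) ∩ thickening δ (A j), dist x y ≤ D

/-- Condition `(α₂)`. -/
def Alpha2 (A : ι → Set X) : Prop :=
  ∀ θ : ℝ, 0 ≤ θ → θ < 1 / 2 → ∃ M > (0 : ℝ), ∀ (q : ℝ → X) (ℓ : ℝ), IsGeodesic q ℓ →
    ∀ i, q 0 ∈ thickening (θ * ℓ) (A i) → q ℓ ∈ thickening (θ * ℓ) (A i) →
      (q '' Set.Icc 0 ℓ ∩ thickening M (A i)).Nonempty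

/-- Condition `(α₃)`. -/
def Alpha3 (A : ι → Set X) : Prop :=
  ∀ k : ℕ, 2 ≤ k → ∃ θ > (0 : ℝ), ∃ ν ≥ (8 : ℝ), ∃ χ > (0 : ℝ),
    ∀ P : GeodesicPolygon X k, P.IsFat θ 2 ν → ∃ i, P.carrier ⊆ thickening χ (A i)

end Asymptotic

end TreeGraded

end

namespace TreeGraded

/-! ### Geodesics -/

section Geodesics

variable {F : Type*} [MetricSpace F]

/-! Rescaling turns coarse statements about `X` into exact ones about its cones. Both directions
rest on one fact about tree-graded spaces: if the ends of a geodesic are joined by a chain of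
geodesics that avoids an interior point, then near that point the geodesic runs inside a piece
(`PieceSystem.mem_piece_of_joined`). `PieceSystem` isolates what this needs and asks for convexity
and triangles only within a family `𝒢` of geodesics, because in a cone only limits of geodesics of
`X` are under control at first.

Sufficiency. By (α₂) with `θ = 1/3`, a geodesic with ends near `A i` stays near `A i`
(`HitConst.quasiconvex`), and limit pieces are convex for limit geodesics. Two limit pieces with two
common points would give long segments close to two different `A i`, against (α₁). A simple triangle
of limit geodesics is approximated, after cutting its corners along shortest connections, by fat
hexagons, so (α₃) with `k = 6` puts it into a limit set; `k = 2` shows that every point lies in a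
piece. The limit geodesics thus form a piece system. In a simple triangle with arbitrary geodesic
edges any two points can be joined avoiding any third point; by the fact above, limit geodesics
between points of the triangle lie in pieces, and so does the triangle
(`PieceSystem.exists_piece_of_isSimpleTri`).

Necessity of (α₁) and (α₂). Counterexamples of growing size, rescaled by their size, converge to a
configuration in a cone. For (α₁) this is two pieces with two common points. For (α₂), a unit
geodesic with ends at distance at most `θ < 1/2` from a piece has a short subsegment with both ends
in the piece; hence a long geodesic in `X` contains one at most half as long with the same
hypothesis, and iteration brings the length down to a constant.

Necessity of (α₃). The core is bounded projection: a geodesic that stays outside a fixed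
neighbourhood of `A i` has almost projections to `A i` at bounded distance, uniformly in `i`
(`exists_projClose`). It comes from large-scale comparison of geodesics leaving `A i`: if they come
together late, they either come together early or visit a common other `A j` early
(`exists_meeting`). Let now a fat polygon with long edges be close to no `A i`. For each `i` some
vertex is far from `A i`; following the polygon from there in both directions, bounded projection
and fatness show that all corners, once trimmed, project close together on `A i`
(`FatPath.dist_proj_le`). Geodesics between trimmed corners therefore spend bounded time near each
`A i`. Triangles of such geodesics are uniformly thin: a point of maximal thickness could be
bypassed at its own scale, so in the limit a segment around it would lie in a piece, contrary to
brief visits (`exists_thin`). Hence the trimmed polygon is thin, and the middle of an edge is close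
to another edge, which contradicts fatness. The thinness constant does not depend on the fatness
scale, so that scale can be chosen afterwards. -/

theorem continuousOn_dist {f g : ℝ → F} {S : Set ℝ} (hf : ContinuousOn f S)
    (hg : ContinuousOn g S) : ContinuousOn (fun x => dist (f x) (g x)) S :=
  continuous_dist.comp_continuousOn (hf.prodMk hg)

namespace IsGeodesic

variable {q : ℝ → F} {ℓ : ℝ}

theorem dist_eq (h : IsGeodesic q ℓ) {s t : ℝ} (hs : 0 ≤ s) (hst : s ≤ t) (ht : t ≤ ℓ) :
    dist (q s) (q t) = t - s := by
  rw [h.2 s ⟨hs, hst.trans ht⟩ t ⟨hs.trans hst, ht⟩, abs_sub_comm, abs_of_nonneg (by linarith)]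

theorem dist_zero (h : IsGeodesic q ℓ) {t : ℝ} (ht : 0 ≤ t) (htl : t ≤ ℓ) :
    dist (q 0) (q t) = t := by
  rw [h.dist_eq le_rfl ht htl, sub_zero]

theorem dist_ends (h : IsGeodesic q ℓ) : dist (q 0) (q ℓ) = ℓ :=
  h.dist_zero h.1 le_rfl

theorem injOn (h : IsGeodesic q ℓ) {s t : ℝ} (hs : s ∈ Set.Icc 0 ℓ) (ht : t ∈ Set.Icc 0 ℓ)
    (hst : q s = q t) : s = t := by
  have := h.2 s hs t ht
  rw [hst, dist_self] at this
  exact sub_eq_zero.1 (abs_eq_zero.1 this.symm)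

theorem initial (h : IsGeodesic q ℓ) {s : ℝ} (hs : 0 ≤ s) (hsl : s ≤ ℓ) : IsGeodesic q s :=
  ⟨hs, fun a ha b hb => h.2 a ⟨ha.1, ha.2.trans hsl⟩ b ⟨hb.1, hb.2.trans hsl⟩⟩

theorem shift (h : IsGeodesic q ℓ) {s : ℝ} (hs : 0 ≤ s) (hsl : s ≤ ℓ) :
    IsGeodesic (fun r => q (s + r)) (ℓ - s) := by
  refine ⟨by linarith, fun a ha b hb => ?_⟩
  have := h.2 (s + a) ⟨by linarith [ha.1], by linarith [ha.2]⟩ (s + b)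
    ⟨by linarith [hb.1], by linarith [hb.2]⟩
  simpa using this

theorem reverse (h : IsGeodesic q ℓ) : IsGeodesic (fun r => q (ℓ - r)) ℓ := by
  refine ⟨h.1, fun a ha b hb => ?_⟩
  have := h.2 (ℓ - a) ⟨by linarith [ha.2], by linarith [ha.1]⟩ (ℓ - b)
    ⟨by linarith [hb.2], by linarith [hb.1]⟩
  rw [this, abs_sub_comm]
  congr 1
  ring

theorem lipschitz (h : IsGeodesic q ℓ) : LipschitzOnWith 1 q (Set.Icc 0 ℓ) :=
  LipschitzOnWith.of_dist_le_mul fun a ha b hb => by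
    rw [h.2 a ha b hb, NNReal.coe_one, one_mul, Real.dist_eq]

theorem continuousOn (h : IsGeodesic q ℓ) : ContinuousOn q (Set.Icc 0 ℓ) :=
  h.lipschitz.continuousOn

theorem isCompact_image (h : IsGeodesic q ℓ) : IsCompact (q '' Set.Icc 0 ℓ) :=
  isCompact_Icc.image_of_continuousOn h.continuousOn

/-- The times in a compact interval at which a geodesic lies in a closed set form a compact set. -/
theorem isCompact_times (h : IsGeodesic q ℓ) {S : Set F} (hS : IsClosed S) {s t : ℝ}
    (hs : 0 ≤ s) (ht : t ≤ ℓ) : IsCompact {r | r ∈ Set.Icc s t ∧ q r ∈ S} := by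
  have hsub : Set.Icc s t ⊆ Set.Icc 0 ℓ := Set.Icc_subset_Icc hs ht
  exact isCompact_Icc.of_isClosed_subset
    ((h.continuousOn.mono hsub).preimage_isClosed_of_isClosed isClosed_Icc hS) fun r hr => hr.1

theorem exists_first (h : IsGeodesic q ℓ) {S : Set F} (hS : IsClosed S) {s t r : ℝ}
    (hs : 0 ≤ s) (ht : t ≤ ℓ) (hr : r ∈ Set.Icc s t) (hrS : q r ∈ S) :
    ∃ r₀ ∈ Set.Icc s t, q r₀ ∈ S ∧ ∀ r' ∈ Set.Icc s t, q r' ∈ S → r₀ ≤ r' := by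
  obtain ⟨r₀, h₀, h₁⟩ := (h.isCompact_times hS hs ht).exists_isLeast ⟨r, hr, hrS⟩
  exact ⟨r₀, h₀.1, h₀.2, fun r' h' h'' => h₁ ⟨h', h''⟩⟩

theorem exists_last (h : IsGeodesic q ℓ) {S : Set F} (hS : IsClosed S) {s t r : ℝ}
    (hs : 0 ≤ s) (ht : t ≤ ℓ) (hr : r ∈ Set.Icc s t) (hrS : q r ∈ S) :
    ∃ r₀ ∈ Set.Icc s t, q r₀ ∈ S ∧ ∀ r' ∈ Set.Icc s t, q r' ∈ S → r' ≤ r₀ := by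
  obtain ⟨r₀, h₀, h₁⟩ := (h.isCompact_times hS hs ht).exists_isGreatest ⟨r, hr, hrS⟩
  exact ⟨r₀, h₀.1, h₀.2, fun r hr hrS => h₁ ⟨hr, hrS⟩⟩

/-- Two geodesics from the same point meet only at equal times. -/
theorem time_eq {q' : ℝ → F} {ℓ' : ℝ} (h : IsGeodesic q ℓ) (h' : IsGeodesic q' ℓ')
    (h0 : q 0 = q' 0) {s t : ℝ} (hs : s ∈ Set.Icc 0 ℓ) (ht : t ∈ Set.Icc 0 ℓ') (hst : q s = q' t) :
    s = t := by
  rw [← h.dist_zero hs.1 hs.2, ← h'.dist_zero ht.1 ht.2, h0, hst]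

end IsGeodesic

end Geodesics

/-! ### Piece systems -/

/-- A family `𝒢` of geodesics joining all pairs of points and a family `P` of closed `𝒢`-convex
pieces with at most one common point, such that simple triangles with edges in `𝒢` lie in a
piece. -/
structure PieceSystem {F : Type*} [MetricSpace F] {κ : Type*} (𝒢 : (ℝ → F) → ℝ → Prop)
    (P : κ → Set F) : Prop where
  isGeodesic : ∀ {q ℓ}, 𝒢 q ℓ → IsGeodesic q ℓ
  exists_join : ∀ x y, ∃ q ℓ, 𝒢 q ℓ ∧ q 0 = x ∧ q ℓ = y
  initial : ∀ {q ℓ s}, 𝒢 q ℓ → 0 ≤ s → s ≤ ℓ → 𝒢 q s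
  shift : ∀ {q ℓ s}, 𝒢 q ℓ → 0 ≤ s → s ≤ ℓ → 𝒢 (fun r => q (s + r)) (ℓ - s)
  reverse : ∀ {q ℓ}, 𝒢 q ℓ → 𝒢 (fun r => q (ℓ - r)) ℓ
  closed : ∀ a, IsClosed (P a)
  convex : ∀ {q ℓ a}, 𝒢 q ℓ → q 0 ∈ P a → q ℓ ∈ P a → ∀ t ∈ Set.Icc 0 ℓ, q t ∈ P a
  inter : ∀ a b, a ≠ b → (P a ∩ P b).Subsingleton
  triangle : ∀ {q₁ ℓ₁ q₂ ℓ₂ q₃ ℓ₃}, 𝒢 q₁ ℓ₁ → 𝒢 q₂ ℓ₂ → 𝒢 q₃ ℓ₃ → 0 < ℓ₁ → 0 < ℓ₂ → 0 < ℓ₃ →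
    q₁ ℓ₁ = q₂ 0 → q₂ ℓ₂ = q₃ 0 → q₃ ℓ₃ = q₁ 0 →
    (∀ s ∈ Set.Icc 0 ℓ₁, ∀ t ∈ Set.Icc 0 ℓ₂, q₁ s = q₂ t → t = 0) →
    (∀ s ∈ Set.Icc 0 ℓ₂, ∀ t ∈ Set.Icc 0 ℓ₃, q₂ s = q₃ t → t = 0) →
    (∀ s ∈ Set.Icc 0 ℓ₃, ∀ t ∈ Set.Icc 0 ℓ₁, q₃ s = q₁ t → t = 0) →
    ∃ a, (∀ t ∈ Set.Icc 0 ℓ₁, q₁ t ∈ P a) ∧ (∀ t ∈ Set.Icc 0 ℓ₂, q₂ t ∈ P a) ∧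
      ∀ t ∈ Set.Icc 0 ℓ₃, q₃ t ∈ P a

/-- A nontrivial initial part of the geodesic `σ` of length `ℓ` lies in `S`. -/
def StartsIn {F : Type*} (S : Set F) (σ : ℝ → F) (ℓ : ℝ) : Prop :=
  ∃ r, 0 < r ∧ r ≤ ℓ ∧ ∀ t ∈ Set.Icc 0 r, σ t ∈ S

/-- `x` and `y` are joined by a chain of geodesics in `𝒢` that avoid `z`. -/
def Joined {F : Type*} (𝒢 : (ℝ → F) → ℝ → Prop) (z : F) : F → F → Prop :=
  Relation.ReflTransGen fun x y =>
    ∃ q ℓ, 𝒢 q ℓ ∧ q 0 = x ∧ q ℓ = y ∧ ∀ t ∈ Set.Icc 0 ℓ, q t ≠ z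

namespace PieceSystem

variable {F : Type*} [MetricSpace F] {κ : Type*} {𝒢 : (ℝ → F) → ℝ → Prop} {P : κ → Set F}

theorem piece_eq (H : PieceSystem 𝒢 P) {a b : κ} {x y : F} (hxy : x ≠ y) (hxa : x ∈ P a)
    (hxb : x ∈ P b) (hya : y ∈ P a) (hyb : y ∈ P b) : a = b := by
  by_contra hab
  exact hxy (H.inter a b hab ⟨hxa, hxb⟩ ⟨hya, hyb⟩)

theorem startsIn_unique (H : PieceSystem 𝒢 P) {a b : κ} {σ : ℝ → F} {ℓ : ℝ} (hσ : 𝒢 σ ℓ)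
    (ha : StartsIn (P a) σ ℓ) (hb : StartsIn (P b) σ ℓ) : a = b := by
  obtain ⟨r, hr, hrl, h⟩ := ha
  obtain ⟨r', hr', hrl', h'⟩ := hb
  have hm : 0 < min r r' := lt_min hr hr'
  refine H.piece_eq (x := σ 0) (y := σ (min r r')) (fun heq => hm.ne ?_) (h 0 ⟨le_rfl, hr.le⟩)
    (h' 0 ⟨le_rfl, hr'.le⟩) (h _ ⟨hm.le, min_le_left _ _⟩) (h' _ ⟨hm.le, min_le_right _ _⟩)
  exact (H.isGeodesic hσ).injOn ⟨le_rfl, hr.le.trans hrl⟩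
    ⟨hm.le, (min_le_left _ _).trans hrl⟩ heq

/-- Two geodesics from `z` whose endpoints are joined by a geodesic avoiding `z` either meet
arbitrarily close to `z` or start in a common piece. -/
theorem meet_or_startsIn (H : PieceSystem 𝒢 P) {σ τ e : ℝ → F} {ℓ ℓ' m : ℝ} (hσ : 𝒢 σ ℓ)
    (hτ : 𝒢 τ ℓ') (he : 𝒢 e m) (hℓ : 0 < ℓ) (hℓ' : 0 < ℓ') (h0 : σ 0 = τ 0) (he0 : e 0 = σ ℓ)
    (hem : e m = τ ℓ') (hz : ∀ t ∈ Set.Icc 0 m, e t ≠ σ 0) :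
    (∀ ε > 0, ∃ r, 0 < r ∧ r ≤ ε ∧ r ≤ ℓ ∧ r ≤ ℓ' ∧ σ r = τ r) ∨
      ∃ a, StartsIn (P a) σ ℓ ∧ StartsIn (P a) τ ℓ' := by
  have gσ := H.isGeodesic hσ
  have gτ := H.isGeodesic hτ
  have ge := H.isGeodesic he
  by_contra! hcon
  obtain ⟨⟨ε, hε, hmeet⟩, hno⟩ := hcon
  -- The last point of `e` on `σ`, and the first later one on `τ`: between them `e` meets `σ` and
  -- `τ` only at its ends.
  obtain ⟨l₁, hl₁, ⟨r₁, hr₁, hlr₁⟩, hmax⟩ := ge.exists_last (S := σ '' Set.Icc 0 ℓ)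
    gσ.isCompact_image.isClosed le_rfl le_rfl (r := 0) ⟨le_rfl, ge.1⟩ ⟨ℓ, ⟨hℓ.le, le_rfl⟩, he0.symm⟩
  obtain ⟨l₂, hl₂, ⟨r₂, hr₂, hlr₂⟩, hmin⟩ := ge.exists_first (S := τ '' Set.Icc 0 ℓ')
    gτ.isCompact_image.isClosed hl₁.1 le_rfl (r := m) ⟨hl₁.2, le_rfl⟩
    ⟨ℓ', ⟨hℓ'.le, le_rfl⟩, hem.symm⟩
  have hr₁0 : 0 < r₁ := lt_of_le_of_ne hr₁.1 fun h => hz l₁ hl₁ (by rw [← hlr₁, ← h])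
  have hr₂0 : 0 < r₂ := lt_of_le_of_ne hr₂.1 fun h =>
    hz l₂ ⟨hl₁.1.trans hl₂.1, hl₂.2⟩ (by rw [← hlr₂, ← h, h0])
  by_cases hM : ∃ r, 0 < r ∧ r ≤ r₁ ∧ r ≤ r₂ ∧ σ r = τ r
  · obtain ⟨r, hr, hrr₁, hrr₂, hrm⟩ := hM
    have hεr : ε < r := by
      by_contra! h
      exact hmeet r hr h (hrr₁.trans hr₁.2) (hrr₂.trans hr₂.2) hrm
    have hcomp : IsCompact {x | x ∈ Set.Icc ε r ∧ dist (σ x) (τ x) ∈ ({0} : Set ℝ)} := by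
      have hc : ContinuousOn (fun x => dist (σ x) (τ x)) (Set.Icc ε r) :=
        continuousOn_dist (gσ.continuousOn.mono (Set.Icc_subset_Icc hε.le (hrr₁.trans hr₁.2)))
          (gτ.continuousOn.mono (Set.Icc_subset_Icc hε.le (hrr₂.trans hr₂.2)))
      exact isCompact_Icc.of_isClosed_subset
        (hc.preimage_isClosed_of_isClosed isClosed_Icc isClosed_singleton) fun x hx => hx.1
    -- There is no meeting in `(0, ε]`, so `r₃` is the first positive meeting time and `σ`, `τ`
    -- bound a simple bigon up to it. Cutting the `τ` side at its midpoint makes it a simple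
    -- triangle.
    obtain ⟨r₃, h₃, h₃min⟩ := hcomp.exists_isLeast
      ⟨r, ⟨hεr.le, le_rfl⟩, by simp [hrm]⟩
    have heq₃ : σ r₃ = τ r₃ := dist_eq_zero.1 h₃.2
    have h₃0 : 0 < r₃ := hε.trans_le h₃.1.1
    have h₃ℓ : r₃ ≤ ℓ := h₃.1.2.trans (hrr₁.trans hr₁.2)
    have h₃ℓ' : r₃ ≤ ℓ' := h₃.1.2.trans (hrr₂.trans hr₂.2)
    have hrev := H.reverse (H.initial hτ h₃0.le h₃ℓ')
    have hkey : ∀ s, 0 ≤ s → s ≤ r₃ → ∀ t, 0 ≤ t → t ≤ r₃ → σ s = τ t → t = 0 ∨ t = r₃ := by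
      intro s hs0 hs t ht0 ht hst
      have hts := gσ.time_eq gτ h0 ⟨hs0, hs.trans h₃ℓ⟩ ⟨ht0, ht.trans h₃ℓ'⟩ hst
      subst hts
      rcases ht0.eq_or_lt with h | h
      · exact Or.inl h.symm
      · right
        have hεs : ε ≤ s := by
          by_contra! h'
          exact hmeet s h h'.le (hs.trans h₃ℓ) (hs.trans h₃ℓ') hst
        exact le_antisymm ht (h₃min ⟨⟨hεs, hs.trans h₃.1.2⟩, by simp [hst]⟩)
    obtain ⟨a, ha₁, ha₂, ha₃⟩ := H.triangle (H.initial hσ h₃0.le h₃ℓ)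
      (H.initial hrev (s := r₃ / 2) (by linarith) (by linarith))
      (H.shift hrev (s := r₃ / 2) (by linarith) (by linarith)) h₃0 (by linarith) (by linarith)
      (by simp [heq₃]) (by simp) (by simp [h0])
      (by
        intro s hs t ht hst
        rcases hkey s hs.1 hs.2 (r₃ - t) (by linarith [ht.2]) (by linarith [ht.1]) hst with h | h
        · linarith [ht.2]
        · linarith)
      (by
        intro s hs t ht hst
        have := gτ.injOn ⟨by linarith [hs.2], by linarith [hs.1]⟩
          ⟨by linarith [ht.2], by linarith [ht.1]⟩ hst
        linarith [hs.2, ht.1])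
      (by
        intro s hs t ht hst
        have h1 := gσ.time_eq gτ h0 ⟨ht.1, ht.2.trans h₃ℓ⟩ ⟨by linarith [hs.2], by linarith [hs.1]⟩
          hst.symm
        rcases hkey t ht.1 ht.2 _ (by linarith [hs.2]) (by linarith [hs.1]) hst.symm with h | h
        · linarith
        · linarith [hs.1])
    refine hno a ⟨r₃, h₃0, h₃ℓ, ha₁⟩ ⟨r₃ / 2, by linarith, by linarith, fun t ht => ?_⟩
    have := ha₃ (r₃ / 2 - t) ⟨by linarith [ht.2], by linarith [ht.1]⟩
    simpa [show r₃ - (r₃ / 2 + (r₃ / 2 - t)) = t by ring] using this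
  · push Not at hM
    have hlt : l₁ < l₂ := by
      refine lt_of_le_of_ne hl₂.1 fun h => ?_
      have hst : σ r₁ = τ r₂ := by rw [hlr₁, hlr₂, h]
      have h12 := gσ.time_eq gτ h0 hr₁ hr₂ hst
      exact hM r₁ hr₁0 le_rfl h12.le (by rw [hst, h12])
    obtain ⟨a, ha₁, ha₂, ha₃⟩ := H.triangle (H.initial hσ hr₁0.le hr₁.2)
      (H.initial (H.shift he hl₁.1 hl₁.2) (s := l₂ - l₁) (by linarith) (by linarith [hl₂.2]))
      (H.reverse (H.initial hτ hr₂0.le hr₂.2)) hr₁0 (by linarith) hr₂0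
      (by simp [hlr₁]) (by simp [hlr₂]) (by simp [h0])
      (by
        intro s hs t ht hst
        have := hmax (l₁ + t) ⟨by linarith [hl₁.1, ht.1], by linarith [hl₂.2, ht.2]⟩
          ⟨s, ⟨hs.1, hs.2.trans hr₁.2⟩, hst⟩
        linarith [ht.1])
      (by
        intro s hs t ht hst
        have h1 := hmin (l₁ + s) ⟨by linarith [hs.1], by linarith [hl₂.2, hs.2]⟩
          ⟨r₂ - t, ⟨by linarith [ht.2], by linarith [ht.1, hr₂.2]⟩, hst.symm⟩
        have h2 : l₁ + s = l₂ := by linarith [hs.2]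
        have h3 : τ r₂ = τ (r₂ - t) := by rw [hlr₂, ← h2]; exact hst
        have := gτ.injOn hr₂ ⟨by linarith [ht.2], by linarith [ht.1, hr₂.2]⟩ h3
        linarith)
      (by
        intro s hs t ht hst
        have h1 := gσ.time_eq gτ h0 ⟨ht.1, ht.2.trans hr₁.2⟩
          ⟨by linarith [hs.2], by linarith [hs.1, hr₂.2]⟩ hst.symm
        by_contra hne
        refine hM t (lt_of_le_of_ne ht.1 (Ne.symm hne)) ht.2 (by linarith [hs.1]) ?_
        have h2 : τ (r₂ - s) = σ t := hst
        rw [← h2, ← h1])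
    refine hno a ⟨r₁, hr₁0, hr₁.2, ha₁⟩ ⟨r₂, hr₂0, hr₂.2, fun t ht => ?_⟩
    simpa using ha₃ (r₂ - t) ⟨by linarith [ht.2], by linarith [ht.1]⟩

/-- If `σ` and `τ` meet arbitrarily close to their origin, convexity of `P a` captures the beginning
of `τ`. Otherwise both start in one piece, which is `P a` because a nontrivial beginning determines
the piece. -/
theorem startsIn_transfer (H : PieceSystem 𝒢 P) {σ τ e : ℝ → F} {ℓ ℓ' m : ℝ} {a : κ} (hσ : 𝒢 σ ℓ)
    (hτ : 𝒢 τ ℓ') (he : 𝒢 e m) (hℓ' : 0 < ℓ') (h0 : σ 0 = τ 0) (he0 : e 0 = σ ℓ)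
    (hem : e m = τ ℓ') (hz : ∀ t ∈ Set.Icc 0 m, e t ≠ σ 0) (ha : StartsIn (P a) σ ℓ) :
    StartsIn (P a) τ ℓ' := by
  have ha' := ha
  obtain ⟨ρ, hρ, hρℓ, hin⟩ := ha'
  rcases H.meet_or_startsIn hσ hτ he (hρ.trans_le hρℓ) hℓ' h0 he0 hem hz with h | ⟨b, hb, hb'⟩
  · obtain ⟨r, hr, hrρ, hrℓ, hrℓ', heq⟩ := h ρ hρ
    refine ⟨r, hr, hrℓ', H.convex (H.initial hτ hr.le hrℓ') ?_ ?_⟩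
    · rw [← h0]; exact hin 0 ⟨le_rfl, hρ.le⟩
    · rw [← heq]; exact hin r ⟨hr.le, hrρ⟩
  · rwa [H.startsIn_unique hσ ha hb]

theorem exists_const (H : PieceSystem 𝒢 P) (x : F) : ∃ q, 𝒢 q 0 ∧ q 0 = x := by
  obtain ⟨q, ℓ, hq, h0, hℓ⟩ := H.exists_join x x
  have : ℓ = 0 := by rw [← (H.isGeodesic hq).dist_ends, h0, hℓ, dist_self]
  subst this
  exact ⟨q, hq, h0⟩

theorem joined_symm (H : PieceSystem 𝒢 P) {z x y : F} (h : Joined 𝒢 z x y) : Joined 𝒢 z y x := by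
  unfold Joined at h ⊢
  induction h with
  | refl => exact .refl
  | tail _ hstep ih =>
    obtain ⟨q, ℓ, hq, h0, hℓ, hz⟩ := hstep
    refine .head ⟨fun r => q (ℓ - r), ℓ, H.reverse hq, by simpa using hℓ, by simpa using h0,
      fun t ht => hz _ ⟨by linarith [ht.2], by linarith [ht.1]⟩⟩ ih

/-- The germ at `σ 0` is transferred link by link, using an auxiliary geodesic from `σ 0` to each
point of the chain. -/
theorem startsIn_of_joined (H : PieceSystem 𝒢 P) {σ : ℝ → F} {ℓ : ℝ} {a : κ} (hσ : 𝒢 σ ℓ)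
    (ha : StartsIn (P a) σ ℓ) {y : F} (hy : Joined 𝒢 (σ 0) (σ ℓ) y) :
    ∀ {τ : ℝ → F} {ℓ' : ℝ}, 𝒢 τ ℓ' → 0 < ℓ' → τ 0 = σ 0 → τ ℓ' = y → StartsIn (P a) τ ℓ' := by
  unfold Joined at hy
  induction hy with
  | refl =>
    intro τ ℓ' hτ hℓ' h0 hy
    obtain ⟨r, hr, hrℓ, -⟩ := id ha
    obtain ⟨q, hq, hq0⟩ := H.exists_const (σ ℓ)
    refine H.startsIn_transfer hσ hτ hq hℓ' h0.symm hq0 (hq0.trans hy.symm) (fun t ht h => ?_) ha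
    rw [le_antisymm ht.2 ht.1, hq0] at h
    have := (H.isGeodesic hσ).injOn ⟨hr.le.trans hrℓ, le_rfl⟩ ⟨le_rfl, hr.le.trans hrℓ⟩ h
    linarith
  | tail _ hstep ih =>
    intro τ ℓ' hτ hℓ' h0 hy
    obtain ⟨q, m, hq, hq0, hqm, hz⟩ := hstep
    obtain ⟨υ, n, hυ, hυ0, hυn⟩ := H.exists_join (σ 0) (q 0)
    have hn : 0 < n := by
      refine lt_of_le_of_ne (H.isGeodesic hυ).1 fun h => hz 0 ⟨le_rfl, (H.isGeodesic hq).1⟩ ?_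
      rw [← hυn, ← h, hυ0]
    exact H.startsIn_transfer hυ hτ hq hℓ' (hυ0.trans h0.symm) hυn.symm (hqm.trans hy.symm)
      (fun t ht => by rw [hυ0]; exact hz t ht) (ih hυ hn hυ0 (hυn.trans hq0))

/-- If the endpoints of a geodesic `g` are joined by a chain that avoids an interior point `g r`,
then a neighbourhood of `g r` in `g` lies in a piece. -/
theorem mem_piece_of_joined (H : PieceSystem 𝒢 P) {g : ℝ → F} {ℓ r : ℝ} (hg : 𝒢 g ℓ) (hr : 0 < r)
    (hrℓ : r < ℓ) (hj : Joined 𝒢 (g r) (g 0) (g ℓ)) :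
    ∃ a, ∃ ε > 0, ε ≤ r ∧ r + ε ≤ ℓ ∧ ∀ t ∈ Set.Icc (r - ε) (r + ε), g t ∈ P a := by
  have gg := H.isGeodesic hg
  have hσ := H.reverse (H.initial hg hr.le hrℓ.le)
  have hτ := H.shift hg hr.le hrℓ.le
  -- Following the chain from `g 0`, a geodesic from `g r` to the current point either starts in
  -- some piece or still begins by heading straight back to `g 0`.
  have key : ∀ y, Joined 𝒢 (g r) (g 0) y → ∀ {τ : ℝ → F} {ℓ' : ℝ}, 𝒢 τ ℓ' → 0 < ℓ' →
      τ 0 = g r → τ ℓ' = y → (∃ a, StartsIn (P a) τ ℓ') ∨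
        ∃ ρ, 0 < ρ ∧ ρ ≤ ℓ' ∧ dist (g 0) (τ ρ) ≤ r - ρ := by
    intro y hy
    unfold Joined at hy
    induction hy with
    | refl =>
      intro τ ℓ' hτ hℓ' h0 hy
      refine Or.inr ⟨ℓ', hℓ', le_rfl, ?_⟩
      have h1 := (H.isGeodesic hτ).dist_ends
      rw [h0, hy, dist_comm, gg.dist_zero hr.le hrℓ.le] at h1
      rw [hy, dist_self, h1, sub_self]
    | tail _ hstep ih =>
      intro τ ℓ' hτ hℓ' h0 hy
      obtain ⟨q, m, hq, hq0, hqm, hz⟩ := hstep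
      obtain ⟨υ, n, hυ, hυ0, hυn⟩ := H.exists_join (g r) (q 0)
      have hn : 0 < n := by
        refine lt_of_le_of_ne (H.isGeodesic hυ).1 fun h => hz 0 ⟨le_rfl, (H.isGeodesic hq).1⟩ ?_
        rw [← hυn, ← h, hυ0]
      have hz' : ∀ t ∈ Set.Icc 0 m, q t ≠ υ 0 := fun t ht => by rw [hυ0]; exact hz t ht
      rcases ih hυ hn hυ0 (hυn.trans hq0) with ⟨a, ha⟩ | ⟨ρ, hρ, hρn, hd⟩
      · exact Or.inl ⟨a, H.startsIn_transfer hυ hτ hq hℓ' (hυ0.trans h0.symm) hυn.symm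
          (hqm.trans hy.symm) hz' ha⟩
      · rcases H.meet_or_startsIn hυ hτ hq hn hℓ' (hυ0.trans h0.symm) hυn.symm
          (hqm.trans hy.symm) hz' with h | ⟨b, -, hb⟩
        · obtain ⟨s, hs, hsρ, hsn, hsℓ', heq⟩ := h ρ hρ
          refine Or.inr ⟨s, hs, hsℓ', ?_⟩
          rw [← heq]
          have h1 := (H.isGeodesic hυ).dist_eq hs.le hsρ hρn
          have h2 := dist_triangle_right (g 0) (υ s) (υ ρ)
          linarith
        · exact Or.inl ⟨b, hb⟩
  have hjj := H.joined_symm hj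
  rcases key _ hj hτ (by linarith) (by simp) (by simp) with ⟨a, ha⟩ | ⟨ρ, hρ, hρℓ, hd⟩
  -- The second half of `g` starts in `P a`; running the chain backwards transfers this to the first
  -- half.
  · have hb : StartsIn (P a) (fun s => g (r - s)) r :=
      H.startsIn_of_joined hτ ha (by simpa using hjj) hσ hr (by simp) (by simp)
    obtain ⟨r₁, h₁, h₁ℓ, hin₁⟩ := ha
    obtain ⟨r₂, h₂, h₂ℓ, hin₂⟩ := hb
    refine ⟨a, min r₁ r₂, lt_min h₁ h₂, (min_le_right _ _).trans h₂ℓ, ?_, fun t ht => ?_⟩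
    · linarith [min_le_left r₁ r₂]
    · rcases le_total r t with h | h
      · have := hin₁ (t - r) ⟨by linarith, by linarith [ht.2, min_le_left r₁ r₂]⟩
        simpa using this
      · have := hin₂ (r - t) ⟨by linarith, by linarith [ht.1, min_le_right r₁ r₂]⟩
        simpa using this
  -- The second half of `g` moves away from `g 0`, so it cannot head back to it.
  · rw [gg.dist_zero (by linarith) (by linarith)] at hd
    linarith

/-- A geodesic that leaves a piece at `x` is a detour-free approach to it: geodesics from its
endpoint to the piece pass through `x`. -/
theorem gate_mem (H : PieceSystem 𝒢 P) {a : κ} {σ e : ℝ → F} {ℓ m : ℝ} (hσ : 𝒢 σ ℓ)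
    (h0 : σ 0 ∈ P a) (hout : ∀ t ∈ Set.Ioc 0 ℓ, σ t ∉ P a) (he : 𝒢 e m) (he0 : e 0 = σ ℓ)
    (hem : e m ∈ P a) : ∃ t ∈ Set.Icc 0 m, e t = σ 0 := by
  have ge := H.isGeodesic he
  by_contra! hcon
  rcases (H.isGeodesic hσ).1.eq_or_lt with hℓ | hℓ
  · exact hcon 0 ⟨le_rfl, ge.1⟩ (by rw [he0, ← hℓ])
  -- A geodesic inside the piece. If `e` avoided `σ 0`, the property of starting in `P a` would pass
  -- from `k` to `σ`.
  obtain ⟨k, n, hk, hk0, hkn⟩ := H.exists_join (σ 0) (e m)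
  have hn : 0 < n := by
    refine lt_of_le_of_ne (H.isGeodesic hk).1 fun h => hcon m ⟨ge.1, le_rfl⟩ ?_
    rw [← hkn, ← h, hk0]
  have hs : StartsIn (P a) k n :=
    ⟨n, hn, le_rfl, H.convex hk (by rwa [hk0]) (by rwa [hkn])⟩
  obtain ⟨r, hr, hrℓ, hin⟩ := H.startsIn_transfer hk hσ (H.reverse he) hℓ hk0 (by simp [hkn])
    (by simp [he0]) (fun t ht => by
      rw [hk0]; exact hcon _ ⟨by linarith [ht.2], by linarith [ht.1]⟩) hs
  exact hout r ⟨hr, hrℓ⟩ (hin r ⟨hr.le, le_rfl⟩)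

/-- The exit points of two geodesics from a piece agree if their endpoints are joined by a geodesic
that avoids the piece. -/
theorem gate_eq (H : PieceSystem 𝒢 P) {a : κ} {σ σ' e : ℝ → F} {ℓ ℓ' m : ℝ} (hσ : 𝒢 σ ℓ)
    (h0 : σ 0 ∈ P a) (hout : ∀ t ∈ Set.Ioc 0 ℓ, σ t ∉ P a) (hσ' : 𝒢 σ' ℓ') (h0' : σ' 0 ∈ P a)
    (hout' : ∀ t ∈ Set.Ioc 0 ℓ', σ' t ∉ P a) (he : 𝒢 e m) (he0 : e 0 = σ ℓ) (hem : e m = σ' ℓ')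
    (hav : ∀ t ∈ Set.Icc 0 m, e t ∉ P a) : σ 0 = σ' 0 := by
  have ge := H.isGeodesic he
  by_contra hne
  have hℓ : 0 < ℓ := lt_of_le_of_ne (H.isGeodesic hσ).1 fun h =>
    hav 0 ⟨le_rfl, ge.1⟩ (by rw [he0, ← h]; exact h0)
  obtain ⟨k, n, hk, hk0, hkn⟩ := H.exists_join (σ 0) (σ' 0)
  have hn : 0 < n := by
    refine lt_of_le_of_ne (H.isGeodesic hk).1 fun h => hne ?_
    rw [← hkn, ← h, hk0]
  have hs : StartsIn (P a) k n :=
    ⟨n, hn, le_rfl, H.convex hk (by rwa [hk0]) (by rwa [hkn])⟩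
  -- From the other exit point along `σ'`, then back along `e`: this chain avoids `σ 0`, and would
  -- force `σ` to start inside the piece.
  have hj : Joined 𝒢 (k 0) (k n) (σ ℓ) := by
    rw [hk0, hkn]
    refine .tail (.single ⟨σ', ℓ', hσ', rfl, rfl, fun t ht h => ?_⟩)
      ⟨_, m, H.reverse he, by simp [hem], by simp [he0], fun t ht h => ?_⟩
    · rcases ht.1.eq_or_lt with h' | h'
      · exact hne (by rw [← h, ← h'])
      · exact hout' t ⟨h', ht.2⟩ (by rwa [h])
    · exact hav (m - t) ⟨by linarith [ht.2], by linarith [ht.1]⟩ (by rw [h]; exact h0)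
  obtain ⟨r, hr, hrℓ, hin⟩ := H.startsIn_of_joined hk hs hj hσ hℓ hk0.symm rfl
  exact hout r ⟨hr, hrℓ⟩ (hin r ⟨hr.le, le_rfl⟩)

theorem exists_gate (H : PieceSystem 𝒢 P) {a : κ} (x : F) {c : F} (hc : c ∈ P a) :
    ∃ σ ℓ, 𝒢 σ ℓ ∧ σ 0 ∈ P a ∧ σ ℓ = x ∧ (∀ t ∈ Set.Ioc 0 ℓ, σ t ∉ P a) ∧ ℓ ≤ dist x c := by
  obtain ⟨e, m, he, he0, hem⟩ := H.exists_join x c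
  have ge := H.isGeodesic he
  obtain ⟨r, hr, hrP, hmin⟩ := ge.exists_first (H.closed a) le_rfl le_rfl (r := m) ⟨ge.1, le_rfl⟩
    (by rwa [hem])
  refine ⟨_, r, H.reverse (H.initial he hr.1 hr.2), by simpa using hrP, by simp [he0],
    fun t ht h => ?_, ?_⟩
  · have := hmin (r - t) ⟨by linarith [ht.2], by linarith [ht.1, hr.2]⟩ h
    linarith [ht.1]
  · rw [← he0, ← hem, ge.dist_ends]; exact hr.2

/-- The exit point is the nearest point of the piece. -/
theorem gate_dist_le (H : PieceSystem 𝒢 P) {a : κ} {σ : ℝ → F} {ℓ : ℝ} (hσ : 𝒢 σ ℓ)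
    (h0 : σ 0 ∈ P a) (hout : ∀ t ∈ Set.Ioc 0 ℓ, σ t ∉ P a) {c : F} (hc : c ∈ P a) :
    ℓ ≤ dist (σ ℓ) c := by
  obtain ⟨e, m, he, he0, hem⟩ := H.exists_join (σ ℓ) c
  obtain ⟨t, ht, het⟩ := H.gate_mem hσ h0 hout he he0 (by rwa [hem])
  have h1 := (H.isGeodesic he).dist_zero ht.1 ht.2
  rw [he0, het, dist_comm, (H.isGeodesic hσ).dist_ends] at h1
  rw [← he0, ← hem, (H.isGeodesic he).dist_ends, h1]
  exact ht.2

end PieceSystem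

end TreeGraded

/-! ### Simple triangles with arbitrary geodesic edges. -/

namespace TreeGraded

/-- Three geodesics form a nondegenerate simple triangle. -/
structure IsSimpleTri {F : Type*} [MetricSpace F] (q₁ : ℝ → F) (ℓ₁ : ℝ) (q₂ : ℝ → F) (ℓ₂ : ℝ)
    (q₃ : ℝ → F) (ℓ₃ : ℝ) : Prop where
  geo₁ : IsGeodesic q₁ ℓ₁
  geo₂ : IsGeodesic q₂ ℓ₂
  geo₃ : IsGeodesic q₃ ℓ₃
  pos₁ : 0 < ℓ₁
  pos₂ : 0 < ℓ₂
  pos₃ : 0 < ℓ₃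
  end₁ : q₁ ℓ₁ = q₂ 0
  end₂ : q₂ ℓ₂ = q₃ 0
  end₃ : q₃ ℓ₃ = q₁ 0
  meet₁ : ∀ s ∈ Set.Icc 0 ℓ₁, ∀ t ∈ Set.Icc 0 ℓ₂, q₁ s = q₂ t → t = 0
  meet₂ : ∀ s ∈ Set.Icc 0 ℓ₂, ∀ t ∈ Set.Icc 0 ℓ₃, q₂ s = q₃ t → t = 0
  meet₃ : ∀ s ∈ Set.Icc 0 ℓ₃, ∀ t ∈ Set.Icc 0 ℓ₁, q₃ s = q₁ t → t = 0

theorem IsSimpleTri.rotate {F : Type*} [MetricSpace F] {q₁ q₂ q₃ : ℝ → F} {ℓ₁ ℓ₂ ℓ₃ : ℝ}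
    (h : IsSimpleTri q₁ ℓ₁ q₂ ℓ₂ q₃ ℓ₃) : IsSimpleTri q₂ ℓ₂ q₃ ℓ₃ q₁ ℓ₁ :=
  ⟨h.geo₂, h.geo₃, h.geo₁, h.pos₂, h.pos₃, h.pos₁, h.end₂, h.end₃, h.end₁, h.meet₂, h.meet₃,
    h.meet₁⟩

namespace PieceSystem

variable {F : Type*} [MetricSpace F] {κ : Type*} {𝒢 : (ℝ → F) → ℝ → Prop} {P : κ → Set F}

/-- This is the passage from arbitrary geodesics to those in `𝒢`: subdivide so finely that every
part is shorter than the distance from `q` to `z`. The geodesics in `𝒢` replacing the parts are too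
short to reach `z`. -/
theorem joined_of_isGeodesic (H : PieceSystem 𝒢 P) {q : ℝ → F} {ℓ s t : ℝ} {z : F}
    (hq : IsGeodesic q ℓ) (hs : 0 ≤ s) (hst : s ≤ t) (ht : t ≤ ℓ)
    (hz : ∀ r ∈ Set.Icc s t, q r ≠ z) : Joined 𝒢 z (q s) (q t) := by
  have hcont : ContinuousOn (fun r => dist (q r) z) (Set.Icc s t) :=
    continuousOn_dist (hq.continuousOn.mono (Set.Icc_subset_Icc hs ht)) continuousOn_const
  obtain ⟨r₀, hr₀, hmin⟩ := isCompact_Icc.exists_isMinOn ⟨s, le_rfl, hst⟩ hcont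
  have hη : 0 < dist (q r₀) z := dist_pos.2 (hz r₀ hr₀)
  obtain ⟨N, hN⟩ := exists_nat_gt ((t - s) / dist (q r₀) z)
  have hN0 : (0 : ℝ) < N := lt_of_le_of_lt (div_nonneg (by linarith) hη.le) hN
  have hh : (t - s) / N < dist (q r₀) z := by
    rw [div_lt_iff₀ hN0]; rw [div_lt_iff₀ hη] at hN; linarith
  have hh0 : 0 ≤ (t - s) / N := div_nonneg (by linarith) hN0.le
  have key : ∀ n : ℕ, n ≤ N → Joined 𝒢 z (q s) (q (s + n * ((t - s) / N))) := by
    intro n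
    induction n with
    | zero => intro _; simp only [Nat.cast_zero, zero_mul, add_zero]; exact .refl
    | succ n ih =>
      intro hn
      have hnN : ((n : ℝ) + 1) * ((t - s) / N) ≤ t - s := by
        have : ((n : ℝ) + 1) ≤ N := by exact_mod_cast hn
        calc ((n : ℝ) + 1) * ((t - s) / N) ≤ N * ((t - s) / N) := by gcongr
          _ = t - s := by field_simp
      have hn0 : 0 ≤ (n : ℝ) * ((t - s) / N) := by positivity
      set x := s + n * ((t - s) / N) with hx
      have hy : s + ((n + 1 : ℕ) : ℝ) * ((t - s) / N) = x + (t - s) / N := by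
        rw [hx]; push_cast; ring
      rw [hy]
      refine .tail (ih (by omega)) ?_
      obtain ⟨g, m, hg, hg0, hgm⟩ := H.exists_join (q x) (q (x + (t - s) / N))
      refine ⟨g, m, hg, hg0, hgm, fun r hr h => ?_⟩
      have hm : m = (t - s) / N := by
        rw [← (H.isGeodesic hg).dist_ends, hg0, hgm, hq.dist_eq (by linarith) (by linarith)
          (by linarith)]
        ring
      have h1 := (H.isGeodesic hg).dist_zero hr.1 hr.2
      rw [hg0, h] at h1
      have h2 : dist (q r₀) z ≤ dist (q x) z := hmin ⟨by linarith, by linarith⟩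
      linarith [hr.2]
  have := key N le_rfl
  rwa [show s + N * ((t - s) / N) = t by field_simp; ring] at this

/-- At the last time spent in `P a`, the local piece shares a nontrivial segment with `P a`, hence
equals it, and `g` stays in `P a` a little longer. -/
theorem end_mem_of_forall_local (H : PieceSystem 𝒢 P) {g : ℝ → F} {ℓ r₀ ε₀ : ℝ} {a : κ}
    (hg : 𝒢 g ℓ) (hr₀ : 0 < r₀) (hε₀ : 0 < ε₀) (hℓ : r₀ + ε₀ ≤ ℓ)
    (ha : ∀ t ∈ Set.Icc r₀ (r₀ + ε₀), g t ∈ P a)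
    (hloc : ∀ r, 0 < r → r < ℓ → ∃ a, ∃ ε > 0, ε ≤ r ∧ r + ε ≤ ℓ ∧
      ∀ t ∈ Set.Icc (r - ε) (r + ε), g t ∈ P a) : g ℓ ∈ P a := by
  have gg := H.isGeodesic hg
  obtain ⟨t₁, ht₁, ht₁P, hmax⟩ := gg.exists_last (H.closed a) hr₀.le le_rfl (r := r₀ + ε₀)
    ⟨by linarith, hℓ⟩ (ha _ ⟨by linarith, le_rfl⟩)
  have hlt : r₀ < t₁ := lt_of_lt_of_le (by linarith)
    (hmax (r₀ + ε₀) ⟨by linarith, hℓ⟩ (ha _ ⟨by linarith, le_rfl⟩))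
  rcases ht₁.2.eq_or_lt with h | h
  · rwa [← h]
  exfalso
  obtain ⟨b, ε, hε, hε1, hε2, hb⟩ := hloc t₁ (by linarith) h
  set w := max r₀ (t₁ - ε) with hw
  have hwt : w < t₁ := max_lt hlt (by linarith)
  have hwr : r₀ ≤ w := le_max_left _ _
  have hwa : g w ∈ P a := by
    have := H.convex (a := a) (H.initial (H.shift hg hr₀.le (by linarith)) (s := t₁ - r₀)
      (by linarith) (by linarith)) (by simpa using ha r₀ ⟨le_rfl, by linarith⟩)
      (by simpa using ht₁P) (w - r₀) ⟨by linarith, by linarith⟩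
    simpa using this
  have hab : a = b := H.piece_eq (x := g w) (y := g t₁)
    (fun h' => hwt.ne (gg.injOn ⟨by linarith, by linarith⟩ ⟨by linarith, h.le⟩ h'))
    hwa (hb w ⟨le_max_right _ _, by linarith⟩) ht₁P (hb t₁ ⟨by linarith, by linarith⟩)
  have := hmax (t₁ + ε) ⟨by linarith, hε2⟩ (by rw [hab]; exact hb _ ⟨by linarith, le_rfl⟩)
  linarith

theorem exists_piece_of_forall_local (H : PieceSystem 𝒢 P) {g : ℝ → F} {ℓ : ℝ} (hg : 𝒢 g ℓ)
    (hℓ : 0 < ℓ)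
    (hloc : ∀ r, 0 < r → r < ℓ → ∃ a, ∃ ε > 0, ε ≤ r ∧ r + ε ≤ ℓ ∧
      ∀ t ∈ Set.Icc (r - ε) (r + ε), g t ∈ P a) : ∃ a, g 0 ∈ P a ∧ g ℓ ∈ P a := by
  obtain ⟨a, ε, hε, hε1, hε2, ha⟩ := hloc (ℓ / 2) (by linarith) (by linarith)
  refine ⟨a, ?_, H.end_mem_of_forall_local hg (r₀ := ℓ / 2) (by linarith) hε hε2
    (fun t ht => ha t ⟨by linarith [ht.1], ht.2⟩) hloc⟩
  have := H.end_mem_of_forall_local (a := a) (H.reverse hg) (r₀ := ℓ / 2) (by linarith) hε hε2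
    (fun t ht => ha (ℓ - t) ⟨by linarith [ht.2], by linarith [ht.1]⟩) (fun r hr hr' => by
      obtain ⟨b, δ, hδ, hδ1, hδ2, hb⟩ := hloc (ℓ - r) (by linarith) (by linarith)
      exact ⟨b, δ, hδ, by linarith, by linarith, fun t ht => hb (ℓ - t)
        ⟨by linarith [ht.2], by linarith [ht.1]⟩⟩)
  simpa using this

section Triangle

variable {q₁ q₂ q₃ : ℝ → F} {ℓ₁ ℓ₂ ℓ₃ : ℝ}

/-- If the first edge runs through `z`, simplicity keeps the two other edges off `z`, and they give
the way round. -/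
theorem joined_vertices (H : PieceSystem 𝒢 P) (h : IsSimpleTri q₁ ℓ₁ q₂ ℓ₂ q₃ ℓ₃) {z : F}
    (h₁ : q₁ 0 ≠ z) (h₂ : q₂ 0 ≠ z) : Joined 𝒢 z (q₁ 0) (q₂ 0) := by
  by_cases hz : ∀ r ∈ Set.Icc 0 ℓ₁, q₁ r ≠ z
  · rw [← h.end₁]
    exact H.joined_of_isGeodesic h.geo₁ le_rfl h.pos₁.le le_rfl hz
  · push Not at hz
    obtain ⟨r, hr, hrz⟩ := hz
    have a := H.joined_of_isGeodesic (z := z) h.geo₂ le_rfl h.pos₂.le le_rfl fun t ht htz => by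
      have := h.meet₁ r hr t ht (hrz.trans htz.symm)
      exact h₂ (by rw [← htz, this])
    have b := H.joined_of_isGeodesic (z := z) h.geo₃ le_rfl h.pos₃.le le_rfl fun t ht htz => by
      have := h.meet₃ t ht r hr (htz.trans hrz.symm)
      exact h₁ (by rw [← hrz, this])
    rw [h.end₂] at a
    rw [h.end₃] at b
    exact H.joined_symm (Relation.ReflTransGen.trans a b)

theorem joined_vertex (H : PieceSystem 𝒢 P) (h : IsSimpleTri q₁ ℓ₁ q₂ ℓ₂ q₃ ℓ₃) {z : F} {s : ℝ}
    (hs : s ∈ Set.Icc 0 ℓ₁) (hsz : q₁ s ≠ z) :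
    (q₁ 0 ≠ z ∧ Joined 𝒢 z (q₁ s) (q₁ 0)) ∨ (q₂ 0 ≠ z ∧ Joined 𝒢 z (q₁ s) (q₂ 0)) := by
  by_cases hz : ∀ r ∈ Set.Icc 0 s, q₁ r ≠ z
  · exact Or.inl ⟨hz 0 ⟨le_rfl, hs.1⟩,
      H.joined_symm (H.joined_of_isGeodesic h.geo₁ le_rfl hs.1 hs.2 hz)⟩
  · push Not at hz
    obtain ⟨r, hr, hrz⟩ := hz
    have hrs : r < s := lt_of_le_of_ne hr.2 fun h => hsz (by rw [← h, hrz])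
    have hav : ∀ t ∈ Set.Icc s ℓ₁, q₁ t ≠ z := fun t ht htz => by
      have := h.geo₁.injOn ⟨hr.1, hr.2.trans hs.2⟩ ⟨hs.1.trans ht.1, ht.2⟩ (hrz.trans htz.symm)
      linarith [ht.1]
    rw [← h.end₁]
    exact Or.inr ⟨hav _ ⟨hs.2, le_rfl⟩, H.joined_of_isGeodesic h.geo₁ hs.1 hs.2 le_rfl hav⟩

theorem joined_first_vertex (H : PieceSystem 𝒢 P) (h : IsSimpleTri q₁ ℓ₁ q₂ ℓ₂ q₃ ℓ₃) {z x : F}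
    (hx : x ∈ q₁ '' Set.Icc 0 ℓ₁ ∪ q₂ '' Set.Icc 0 ℓ₂ ∪ q₃ '' Set.Icc 0 ℓ₃) (hxz : x ≠ z)
    (h₁ : q₁ 0 ≠ z) : Joined 𝒢 z x (q₁ 0) := by
  have h2 : q₂ 0 ≠ z → Joined 𝒢 z (q₂ 0) (q₁ 0) := fun h' =>
    H.joined_symm (H.joined_vertices h h₁ h')
  have h3 : q₃ 0 ≠ z → Joined 𝒢 z (q₃ 0) (q₁ 0) := fun h' =>
    H.joined_vertices h.rotate.rotate h' h₁
  rcases hx with (⟨s, hs, rfl⟩ | ⟨s, hs, rfl⟩) | ⟨s, hs, rfl⟩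
  · rcases H.joined_vertex h hs hxz with ⟨-, hj⟩ | ⟨hne, hj⟩
    · exact hj
    · exact hj.trans (h2 hne)
  · rcases H.joined_vertex h.rotate hs hxz with ⟨hne, hj⟩ | ⟨hne, hj⟩
    · exact hj.trans (h2 hne)
    · exact hj.trans (h3 hne)
  · rcases H.joined_vertex h.rotate.rotate hs hxz with ⟨hne, hj⟩ | ⟨-, hj⟩
    · exact hj.trans (h3 hne)
    · exact hj

theorem joined_of_mem (H : PieceSystem 𝒢 P) (h : IsSimpleTri q₁ ℓ₁ q₂ ℓ₂ q₃ ℓ₃) {z x y : F}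
    (hx : x ∈ q₁ '' Set.Icc 0 ℓ₁ ∪ q₂ '' Set.Icc 0 ℓ₂ ∪ q₃ '' Set.Icc 0 ℓ₃) (hxz : x ≠ z)
    (hy : y ∈ q₁ '' Set.Icc 0 ℓ₁ ∪ q₂ '' Set.Icc 0 ℓ₂ ∪ q₃ '' Set.Icc 0 ℓ₃) (hyz : y ≠ z) :
    Joined 𝒢 z x y := by
  by_cases h₁ : q₁ 0 = z
  · have h₂ : q₂ 0 ≠ z := fun h' => by
      have := h.meet₁ 0 ⟨le_rfl, h.pos₁.le⟩ 0 ⟨le_rfl, h.pos₂.le⟩ (h₁.trans h'.symm)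
      have := h.geo₁.injOn ⟨le_rfl, h.pos₁.le⟩ ⟨h.pos₁.le, le_rfl⟩ (h₁.trans (h.end₁.trans h').symm)
      exact h.pos₁.ne this
    have hr : ∀ {w}, w ∈ q₁ '' Set.Icc 0 ℓ₁ ∪ q₂ '' Set.Icc 0 ℓ₂ ∪ q₃ '' Set.Icc 0 ℓ₃ →
        w ∈ q₂ '' Set.Icc 0 ℓ₂ ∪ q₃ '' Set.Icc 0 ℓ₃ ∪ q₁ '' Set.Icc 0 ℓ₁ := by
      intro w hw
      rcases hw with (hw | hw) | hw
      · exact Or.inr hw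
      · exact Or.inl (Or.inl hw)
      · exact Or.inl (Or.inr hw)
    exact Relation.ReflTransGen.trans (H.joined_first_vertex h.rotate (hr hx) hxz h₂)
      (H.joined_symm (H.joined_first_vertex h.rotate (hr hy) hyz h₂))
  · exact Relation.ReflTransGen.trans (H.joined_first_vertex h hx hxz h₁)
      (H.joined_symm (H.joined_first_vertex h hy hyz h₁))

/-- Simple triangles with arbitrary geodesic edges lie in a piece. -/
theorem exists_piece_of_isSimpleTri (H : PieceSystem 𝒢 P)
    (h : IsSimpleTri q₁ ℓ₁ q₂ ℓ₂ q₃ ℓ₃) :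
    ∃ a, q₁ '' Set.Icc 0 ℓ₁ ∪ q₂ '' Set.Icc 0 ℓ₂ ∪ q₃ '' Set.Icc 0 ℓ₃ ⊆ P a := by
  set S := q₁ '' Set.Icc 0 ℓ₁ ∪ q₂ '' Set.Icc 0 ℓ₂ ∪ q₃ '' Set.Icc 0 ℓ₃ with hS
  -- Every interior point of a geodesic in `𝒢` from `x` to `y` can be bypassed along the triangle,
  -- so the geodesic is locally, hence globally, in a piece.
  have pair : ∀ x ∈ S, ∀ y ∈ S, x ≠ y → ∃ a, x ∈ P a ∧ y ∈ P a := by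
    intro x hx y hy hxy
    obtain ⟨g, ℓ, hg, rfl, rfl⟩ := H.exists_join x y
    have gg := H.isGeodesic hg
    have hℓ : 0 < ℓ := lt_of_le_of_ne gg.1 fun h => hxy (by rw [← h])
    refine H.exists_piece_of_forall_local hg hℓ fun r hr hrℓ =>
      H.mem_piece_of_joined hg hr hrℓ (H.joined_of_mem h hx (fun h' => ?_) hy fun h' => ?_)
    · exact hr.ne (gg.injOn ⟨le_rfl, hℓ.le⟩ ⟨hr.le, hrℓ.le⟩ h')
    · exact hrℓ.ne' (gg.injOn ⟨hℓ.le, le_rfl⟩ ⟨hr.le, hrℓ.le⟩ h')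
  have hx : q₁ 0 ∈ S := Or.inl (Or.inl ⟨0, ⟨le_rfl, h.pos₁.le⟩, rfl⟩)
  have hy : q₁ ℓ₁ ∈ S := Or.inl (Or.inl ⟨ℓ₁, ⟨h.pos₁.le, le_rfl⟩, rfl⟩)
  have hxy : q₁ 0 ≠ q₁ ℓ₁ := fun h' =>
    h.pos₁.ne (h.geo₁.injOn ⟨le_rfl, h.pos₁.le⟩ ⟨h.pos₁.le, le_rfl⟩ h')
  obtain ⟨a, hxa, hya⟩ := pair _ hx _ hy hxy
  refine ⟨a, fun w hw => ?_⟩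
  by_contra hwa
  have hwx : w ≠ q₁ 0 := fun h' => hwa (by rwa [h'])
  have hwy : w ≠ q₁ ℓ₁ := fun h' => hwa (by rwa [h'])
  obtain ⟨b, hwb, hxb⟩ := pair _ hw _ hx hwx
  obtain ⟨c, hwc, hyc⟩ := pair _ hw _ hy hwy
  have hab : a ≠ b := fun h' => hwa (by rwa [h'])
  have hac : a ≠ c := fun h' => hwa (by rwa [h'])
  have hbc : b ≠ c := fun h' => hab (H.piece_eq hxy hxa hxb hya (by rwa [h']))
  obtain ⟨g₁, m₁, hg₁, h₁0, h₁1⟩ := H.exists_join (q₁ 0) (q₁ ℓ₁)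
  obtain ⟨g₂, m₂, hg₂, h₂0, h₂1⟩ := H.exists_join (q₁ ℓ₁) w
  obtain ⟨g₃, m₃, hg₃, h₃0, h₃1⟩ := H.exists_join w (q₁ 0)
  have c₁ := H.convex (a := a) hg₁ (by rwa [h₁0]) (by rwa [h₁1])
  have c₂ := H.convex (a := c) hg₂ (by rwa [h₂0]) (by rwa [h₂1])
  have c₃ := H.convex (a := b) hg₃ (by rwa [h₃0]) (by rwa [h₃1])
  have posi : ∀ {g : ℝ → F} {m : ℝ}, 𝒢 g m → g 0 ≠ g m → 0 < m := fun hg hne =>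
    lt_of_le_of_ne (H.isGeodesic hg).1 fun h' => hne (by rw [← h'])
  have p₁ : 0 < m₁ := posi hg₁ (by rwa [h₁0, h₁1])
  have p₂ : 0 < m₂ := posi hg₂ (by rw [h₂0, h₂1]; exact hwy.symm)
  have p₃ : 0 < m₃ := posi hg₃ (by rwa [h₃0, h₃1])
  -- The three geodesics lie in three different pieces, so they meet only at common vertices and
  -- form a simple triangle. The piece containing it shares two points with `P a` and contains `w`.
  obtain ⟨f, hf₁, hf₂, hf₃⟩ := H.triangle hg₁ hg₂ hg₃ p₁ p₂ p₃ (h₁1.trans h₂0.symm)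
    (h₂1.trans h₃0.symm) (h₃1.trans h₁0.symm)
    (fun s hs t ht hst => (H.isGeodesic hg₂).injOn ht ⟨le_rfl, p₂.le⟩
      (H.inter a c hac ⟨by rw [← hst]; exact c₁ s hs, c₂ t ht⟩ ⟨by rwa [h₂0], by rwa [h₂0]⟩))
    (fun s hs t ht hst => (H.isGeodesic hg₃).injOn ht ⟨le_rfl, p₃.le⟩
      (H.inter b c hbc ⟨c₃ t ht, by rw [← hst]; exact c₂ s hs⟩ ⟨by rwa [h₃0], by rwa [h₃0]⟩))
    (fun s hs t ht hst => (H.isGeodesic hg₁).injOn ht ⟨le_rfl, p₁.le⟩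
      (H.inter a b hab ⟨c₁ t ht, by rw [← hst]; exact c₃ s hs⟩ ⟨by rwa [h₁0], by rwa [h₁0]⟩))
  have hfx : q₁ 0 ∈ P f := by rw [← h₁0]; exact hf₁ 0 ⟨le_rfl, p₁.le⟩
  have hfy : q₁ ℓ₁ ∈ P f := by rw [← h₁1]; exact hf₁ m₁ ⟨p₁.le, le_rfl⟩
  have hfw : w ∈ P f := by rw [← h₃0]; exact hf₃ 0 ⟨le_rfl, p₃.le⟩
  exact hwa (by rwa [H.piece_eq hxy hxa hfx hya hfy])

end Triangle

end PieceSystem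

/-! ### Tree-graded spaces are piece systems for all geodesics. -/

section Polygon

variable {F : Type*} [MetricSpace F] {κ : Type*} {P : κ → Set F}

theorem IsSimpleTri.exists_piece {q₁ q₂ q₃ : ℝ → F} {ℓ₁ ℓ₂ ℓ₃ : ℝ}
    (h : IsSimpleTri q₁ ℓ₁ q₂ ℓ₂ q₃ ℓ₃) (hP : IsTreeGraded P) :
    ∃ a, (∀ t ∈ Set.Icc 0 ℓ₁, q₁ t ∈ P a) ∧ (∀ t ∈ Set.Icc 0 ℓ₂, q₂ t ∈ P a) ∧
      ∀ t ∈ Set.Icc 0 ℓ₃, q₃ t ∈ P a := by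
  let T : GeodesicPolygon F 3 :=
    { edge := (![q₁, q₂, q₃] : Fin 3 → ℝ → F)
      len := (![ℓ₁, ℓ₂, ℓ₃] : Fin 3 → ℝ)
      isGeodesic := fun i => by
        change Fin 3 at i
        fin_cases i
        · exact h.geo₁
        · exact h.geo₂
        · exact h.geo₃
      closes := fun i => by
        change Fin 3 at i
        fin_cases i
        · exact h.end₁
        · exact h.end₂
        · exact h.end₃ }
  have hT : T.IsSimpleTriangle := by
    intro i
    change Fin 3 at i
    fin_cases i
    · rintro x ⟨⟨s, hs, hsx⟩, ⟨t, ht, htx⟩⟩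
      have := h.meet₁ s hs t ht (hsx.trans htx.symm)
      subst this
      exact htx.symm
    · rintro x ⟨⟨s, hs, hsx⟩, ⟨t, ht, htx⟩⟩
      have := h.meet₂ s hs t ht (hsx.trans htx.symm)
      subst this
      exact htx.symm
    · rintro x ⟨⟨s, hs, hsx⟩, ⟨t, ht, htx⟩⟩
      have := h.meet₃ s hs t ht (hsx.trans htx.symm)
      subst this
      exact htx.symm
  obtain ⟨a, ha⟩ := hP.triangle_subset T hT
  refine ⟨a, fun t ht => ha ?_, fun t ht => ha ?_, fun t ht => ha ?_⟩
  · exact Set.mem_iUnion.2 ⟨(0 : Fin 3), t, ht, rfl⟩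
  · exact Set.mem_iUnion.2 ⟨(1 : Fin 3), t, ht, rfl⟩
  · exact Set.mem_iUnion.2 ⟨(2 : Fin 3), t, ht, rfl⟩

/-- The definition only provides some geodesic inside the piece. An excursion of another geodesic
would form a simple bigon with it, contained in a piece that shares a segment with `P a`. -/
theorem IsTreeGraded.mem_of_isGeodesic (hP : IsTreeGraded P) {q : ℝ → F} {ℓ : ℝ} {a : κ}
    (hq : IsGeodesic q ℓ) (h0 : q 0 ∈ P a) (hℓ : q ℓ ∈ P a) : ∀ t ∈ Set.Icc 0 ℓ, q t ∈ P a := by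
  intro t ht
  by_contra hta
  obtain ⟨g, m, hg, hg0, hgm, hsub⟩ := hP.geodesic_piece a _ h0 _ hℓ
  obtain rfl : m = ℓ := by rw [← hg.dist_ends, ← hq.dist_ends, hg0, hgm]
  have hcomp : ∀ s s', 0 ≤ s → s' ≤ m →
      IsCompact {x | x ∈ Set.Icc s s' ∧ dist (q x) (g x) ∈ ({0} : Set ℝ)} := by
    intro s s' hs hs'
    have hc : ContinuousOn (fun x => dist (q x) (g x)) (Set.Icc s s') :=
      continuousOn_dist (hq.continuousOn.mono (Set.Icc_subset_Icc hs hs'))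
        (hg.continuousOn.mono (Set.Icc_subset_Icc hs hs'))
    exact isCompact_Icc.of_isClosed_subset
      (hc.preimage_isClosed_of_isClosed isClosed_Icc isClosed_singleton) fun x hx => hx.1
  obtain ⟨r₁, ⟨hr₁, hr₁'⟩, hmax⟩ := (hcomp 0 t le_rfl ht.2).exists_isGreatest
    ⟨0, ⟨le_rfl, ht.1⟩, by simp [hg0]⟩
  obtain ⟨r₂, ⟨hr₂, hr₂'⟩, hmin⟩ := (hcomp t m ht.1 le_rfl).exists_isLeast
    ⟨m, ⟨ht.2, le_rfl⟩, by simp [hgm]⟩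
  have e₁ : q r₁ = g r₁ := dist_eq_zero.1 hr₁'
  have e₂ : q r₂ = g r₂ := dist_eq_zero.1 hr₂'
  have hgt : ∀ r ∈ Set.Icc 0 m, g r ∈ P a := fun r hr => hsub ⟨r, hr, rfl⟩
  have lt₁ : r₁ < t := lt_of_le_of_ne hr₁.2 fun h => hta (by
    rw [← h, e₁]; exact hgt _ ⟨hr₁.1, hr₁.2.trans ht.2⟩)
  have lt₂ : t < r₂ := lt_of_le_of_ne hr₂.1 fun h => hta (by
    rw [h, e₂]; exact hgt _ ⟨ht.1.trans hr₂.1, hr₂.2⟩)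
  have hkey : ∀ s ∈ Set.Icc r₁ r₂, ∀ s' ∈ Set.Icc r₁ r₂, q s = g s' → s = s' ∧ (s = r₁ ∨ s = r₂) := by
    intro s hs s' hs' hss
    obtain rfl := hq.time_eq hg hg0.symm ⟨hr₁.1.trans hs.1, hs.2.trans hr₂.2⟩
      ⟨hr₁.1.trans hs'.1, hs'.2.trans hr₂.2⟩ hss
    refine ⟨rfl, ?_⟩
    rcases le_total s t with h | h
    · exact Or.inl (le_antisymm (hmax ⟨⟨hr₁.1.trans hs.1, h⟩, by simp [hss]⟩) hs.1)
    · exact Or.inr (le_antisymm hs.2 (hmin ⟨⟨h, hs.2.trans hr₂.2⟩, by simp [hss]⟩))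
  have hg' := ((hg.shift hr₁.1 (by linarith [ht.2])).initial (s := r₂ - r₁) (by linarith)
    (by linarith [hr₂.2])).reverse
  -- The bigon around time `t`, with the side lying in the piece cut at its midpoint.
  have tri : IsSimpleTri (fun r => q (r₁ + r)) (r₂ - r₁)
      (fun r => g (r₁ + (r₂ - r₁ - r))) ((r₂ - r₁) / 2)
      (fun r => g (r₁ + (r₂ - r₁ - ((r₂ - r₁) / 2 + r)))) (r₂ - r₁ - (r₂ - r₁) / 2) :=
    { geo₁ := (hq.shift hr₁.1 (by linarith [ht.2])).initial (by linarith) (by linarith [hr₂.2])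
      geo₂ := hg'.initial (by linarith) (by linarith)
      geo₃ := hg'.shift (by linarith) (by linarith)
      pos₁ := by linarith
      pos₂ := by linarith
      pos₃ := by linarith
      end₁ := by simp [e₂]
      end₂ := by simp
      end₃ := by simp [e₁]
      meet₁ := fun s hs s' hs' hss => by
        obtain ⟨h1, h2 | h2⟩ := hkey _ ⟨by linarith [hs.1], by linarith [hs.2]⟩ _
          ⟨by linarith [hs'.2], by linarith [hs'.1]⟩ hss
        · linarith [hs'.2]
        · linarith
      meet₂ := fun s hs s' hs' hss => by
        have := hg.injOn ⟨by linarith [hr₁.1, hs.2], by linarith [hr₂.2, hs.1]⟩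
          ⟨by linarith [hr₁.1, hs'.2], by linarith [hr₂.2, hs'.1]⟩ hss
        linarith [hs.2, hs'.1]
      meet₃ := fun s hs s' hs' hss => by
        obtain ⟨h1, h2 | h2⟩ := hkey _ ⟨by linarith [hs'.1], by linarith [hs'.2]⟩ _
          ⟨by linarith [hs.2], by linarith [hs.1]⟩ hss.symm
        · linarith
        · linarith [hs.1] }
  obtain ⟨b, hb, hb', -⟩ := tri.exists_piece hP
  by_cases hab : a = b
  · refine hta ?_
    rw [hab]
    simpa using hb (t - r₁) ⟨by linarith, by linarith⟩
  · have m₁ := hb' 0 ⟨le_rfl, by linarith⟩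
    have m₂ := hb' ((r₂ - r₁) / 2) ⟨by linarith, le_rfl⟩
    have := hP.inter_subsingleton a b hab
      ⟨hgt _ ⟨by linarith [hr₁.1], by linarith [hr₂.2]⟩, m₁⟩
      ⟨hgt _ ⟨by linarith [hr₁.1], by linarith [hr₂.2]⟩, m₂⟩
    have := hg.injOn ⟨by linarith [hr₁.1], by linarith [hr₂.2]⟩
      ⟨by linarith [hr₁.1], by linarith [hr₂.2]⟩ this
    linarith

theorem IsTreeGraded.pieceSystem (hP : IsTreeGraded P) : PieceSystem IsGeodesic P where
  isGeodesic h := h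
  exists_join x y := by
    obtain ⟨q, ℓ, hq, h0, h1, -⟩ := hP.geodesic x trivial y trivial
    exact ⟨q, ℓ, hq, h0, h1⟩
  initial h := h.initial
  shift h := h.shift
  reverse h := h.reverse
  closed := hP.closed_piece
  convex h := hP.mem_of_isGeodesic h
  inter := hP.inter_subsingleton
  triangle h₁ h₂ h₃ p₁ p₂ p₃ e₁ e₂ e₃ m₁ m₂ m₃ :=
    (IsSimpleTri.mk h₁ h₂ h₃ p₁ p₂ p₃ e₁ e₂ e₃ m₁ m₂ m₃).exists_piece hP

end Polygon

end TreeGraded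

/-! ### Points, limit sets and limit geodesics of asymptotic cones. -/

namespace TreeGraded

section Cone

variable {X : Type u} [MetricSpace X] {I : Type} {ω : Ultrafilter I} {e : I → X} {d : I → ℝ}
  {hd : Tendsto d ω atTop}

/-- The sequence `x` stays at finite rescaled distance from the observation point. -/
def IsFin (ω : Ultrafilter I) (e : I → X) (d : I → ℝ) (x : I → X) : Prop :=
  ∃ C : ℝ, ∀ᶠ n in (ω : Filter I), dist (x n) (e n) / d n ≤ C

theorem isFin_base (e : I → X) : IsFin ω e d e :=
  ⟨0, by simp⟩

theorem eventually_scale_pos (hd : Tendsto d ω atTop) : ∀ᶠ n in (ω : Filter I), 0 < d n :=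
  hd.eventually_gt_atTop 0

/-- A sequence at finite distance as an element of `FiniteSeq`. -/
def IsFin.toSeq {x : I → X} (h : IsFin ω e d x) (hd : Tendsto d ω atTop) : FiniteSeq ω e d hd :=
  Subtype.mk x h

open Classical in
/-- The point `lim^ω x n` of the cone (the base point if `x` is not at finite distance). -/
noncomputable def conePt (hd : Tendsto d ω atTop) (e : I → X) (x : I → X) : Cone ω e d hd :=
  if h : IsFin ω e d x then SeparationQuotient.mk (h.toSeq hd)
  else SeparationQuotient.mk ((isFin_base e).toSeq hd)

theorem conePt_of_isFin {x : I → X} (h : IsFin ω e d x) :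
    conePt hd e x = SeparationQuotient.mk (h.toSeq hd) :=
  dif_pos h

theorem exists_conePt (p : Cone ω e d hd) : ∃ x, IsFin ω e d x ∧ conePt hd e x = p := by
  obtain ⟨x, rfl⟩ := SeparationQuotient.surjective_mk p
  exact ⟨x.1, x.2, conePt_of_isFin x.2⟩

theorem tendsto_dist_conePt {x y : I → X} (hx : IsFin ω e d x) (hy : IsFin ω e d y) :
    Tendsto (fun n => dist (x n) (y n) / d n) ω (𝓝 (dist (conePt hd e x) (conePt hd e y))) := by
  rw [conePt_of_isFin hx, conePt_of_isFin hy, SeparationQuotient.dist_mk]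
  exact FiniteSeq.tendsto_limDist (hx.toSeq hd) (hy.toSeq hd)

theorem IsFin.of_dist_le {x y : I → X} (hd : Tendsto d ω atTop) (hx : IsFin ω e d x) {C : ℝ}
    (h : ∀ᶠ n in (ω : Filter I), dist (y n) (x n) ≤ C * d n) : IsFin ω e d y := by
  obtain ⟨C', hC'⟩ := hx
  refine ⟨C + C', ?_⟩
  filter_upwards [h, hC', eventually_scale_pos hd] with n h1 h2 h3
  rw [div_le_iff₀ h3] at h2 ⊢
  linarith [dist_triangle (y n) (x n) (e n)]

theorem dist_conePt_le {x y : I → X} (hx : IsFin ω e d x) (hy : IsFin ω e d y) {C : ℝ}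
    (h : ∀ᶠ n in (ω : Filter I), dist (x n) (y n) ≤ C * d n) :
    dist (conePt hd e x) (conePt hd e y) ≤ C := by
  refine le_of_tendsto (tendsto_dist_conePt hx hy) ?_
  filter_upwards [h, eventually_scale_pos hd] with n h1 h2
  rwa [div_le_iff₀ h2]

theorem le_dist_conePt {x y : I → X} (hx : IsFin ω e d x) (hy : IsFin ω e d y) {C : ℝ}
    (h : ∀ᶠ n in (ω : Filter I), C * d n ≤ dist (x n) (y n)) :
    C ≤ dist (conePt hd e x) (conePt hd e y) := by
  refine ge_of_tendsto (tendsto_dist_conePt hx hy) ?_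
  filter_upwards [h, eventually_scale_pos hd] with n h1 h2
  rwa [le_div_iff₀ h2]

theorem eventually_dist_lt {x y : I → X} (hx : IsFin ω e d x) (hy : IsFin ω e d y) {C : ℝ}
    (h : dist (conePt hd e x) (conePt hd e y) < C) :
    ∀ᶠ n in (ω : Filter I), dist (x n) (y n) < C * d n := by
  filter_upwards [(tendsto_dist_conePt (hd := hd) hx hy).eventually_lt_const h,
    eventually_scale_pos hd] with n h1 h2
  rwa [div_lt_iff₀ h2] at h1

theorem conePt_eq {x y : I → X} (hx : IsFin ω e d x) (hy : IsFin ω e d y)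
    (h : ∀ ε > 0, ∀ᶠ n in (ω : Filter I), dist (x n) (y n) ≤ ε * d n) :
    conePt hd e x = conePt hd e y := by
  refine dist_le_zero.1 (le_of_forall_gt_imp_ge_of_dense fun ε hε => ?_)
  exact dist_conePt_le hx hy (h ε hε)

theorem eventually_dist_lt_of_eq {x y : I → X} (hx : IsFin ω e d x) (hy : IsFin ω e d y)
    (h : conePt hd e x = conePt hd e y) {ε : ℝ} (hε : 0 < ε) :
    ∀ᶠ n in (ω : Filter I), dist (x n) (y n) < ε * d n :=
  eventually_dist_lt hx hy (by rwa [h, dist_self])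

/-- Bounded real sequences converge along an ultrafilter. -/
theorem exists_tendsto_of_eventually_mem_Icc {f : I → ℝ} {a b : ℝ}
    (h : ∀ᶠ n in (ω : Filter I), f n ∈ Set.Icc a b) : ∃ L ∈ Set.Icc a b, Tendsto f ω (𝓝 L) := by
  obtain ⟨L, hL, hlim⟩ := (isCompact_Icc (a := a) (b := b)).ultrafilter_le_nhds (ω.map f)
    (le_principal_iff.2 h)
  exact ⟨L, hL, hlim⟩

/-! #### Limit sets -/

/-- A single sequence `y` must serve all `ε`: it is chosen within `1` of the infimum distance, an
error that disappears after rescaling. -/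
theorem conePt_mem_limSet {x : I → X} {S : I → Set X} (hx : IsFin ω e d x)
    (h : ∀ ε > 0, ∀ᶠ n in (ω : Filter I), ∃ y ∈ S n, dist (x n) y ≤ ε * d n) :
    conePt hd e x ∈ limSet hd e S := by
  classical
  have hch : ∀ n, ∃ y, (S n).Nonempty → y ∈ S n ∧ dist (x n) y ≤ infDist (x n) (S n) + 1 := by
    intro n
    by_cases hn : (S n).Nonempty
    · obtain ⟨y, hy, hlt⟩ := (infDist_lt_iff (x := x n) hn).1 (lt_add_one _)
      exact ⟨y, fun _ => ⟨hy, hlt.le⟩⟩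
    · exact ⟨x n, fun h' => absurd h' hn⟩
  choose y hy using hch
  have key : ∀ ε > 0, ∀ᶠ n in (ω : Filter I), y n ∈ S n ∧ dist (x n) (y n) ≤ ε * d n := by
    intro ε hε
    filter_upwards [h (ε / 2) (by linarith), hd.eventually_ge_atTop (2 / ε)] with n ⟨w, hw, hdw⟩ h2
    obtain ⟨h3, h4⟩ := hy n ⟨w, hw⟩
    refine ⟨h3, h4.trans ?_⟩
    have h5 := infDist_le_dist_of_mem (x := x n) hw
    rw [div_le_iff₀ hε] at h2
    linarith
  have hyF : IsFin ω e d y := hx.of_dist_le hd (C := 1) (by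
    filter_upwards [key 1 one_pos] with n hn
    rw [dist_comm]; exact hn.2)
  refine ⟨hyF.toSeq hd, ?_, ?_⟩
  · rw [← conePt_of_isFin hyF]
    exact (conePt_eq hx hyF fun ε hε => (key ε hε).mono fun n hn => hn.2).symm
  · exact (key 1 one_pos).mono fun n hn => hn.1

theorem conePt_mem_limSet_of_mem {x : I → X} {S : I → Set X} (hx : IsFin ω e d x)
    (h : ∀ᶠ n in (ω : Filter I), x n ∈ S n) : conePt hd e x ∈ limSet hd e S :=
  ⟨hx.toSeq hd, (conePt_of_isFin hx).symm, h⟩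

theorem exists_of_mem_limSet {p : Cone ω e d hd} {S : I → Set X} (h : p ∈ limSet hd e S) :
    ∃ x, IsFin ω e d x ∧ conePt hd e x = p ∧ ∀ᶠ n in (ω : Filter I), x n ∈ S n := by
  obtain ⟨x, rfl, hx⟩ := h
  exact ⟨x.1, x.2, conePt_of_isFin x.2, hx⟩

theorem eventually_of_mem_limSet {x : I → X} {S : I → Set X} (hx : IsFin ω e d x)
    (h : conePt hd e x ∈ limSet hd e S) {ε : ℝ} (hε : 0 < ε) :
    ∀ᶠ n in (ω : Filter I), ∃ y ∈ S n, dist (x n) y < ε * d n := by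
  obtain ⟨y, hy, hyx, hyS⟩ := exists_of_mem_limSet h
  filter_upwards [hyS, eventually_dist_lt_of_eq hx hy hyx.symm hε] with n h1 h2
  exact ⟨y n, h1, h2⟩

theorem isClosed_limSet (S : I → Set X) : IsClosed (limSet hd e S) := by
  refine isClosed_of_closure_subset fun p hp => ?_
  obtain ⟨x, hx, rfl⟩ := exists_conePt p
  refine conePt_mem_limSet hx fun ε hε => ?_
  obtain ⟨p', hp', hlt⟩ := Metric.mem_closure_iff.1 hp (ε / 2) (by linarith)
  obtain ⟨y, hy, rfl, hyS⟩ := exists_of_mem_limSet hp'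
  filter_upwards [eventually_dist_lt hx hy hlt, hyS, eventually_scale_pos hd] with n h1 h2 h3
  exact ⟨y n, h2, h1.le.trans (by nlinarith)⟩

/-! #### Completeness -/

/-- A diagonal argument. Countability of the index set and non-principality of `ω` provide an
integer function `f` that exceeds every bound `ω`-almost surely; it limits how far along the Cauchy
sequence one goes at the index `n`. -/
theorem cone_complete [Countable I] (hω : (ω : Filter I) ≤ cofinite) :
    CompleteSpace (Cone ω e d hd) := by
  classical
  obtain ⟨f, hf⟩ := exists_injective_nat I
  refine Metric.complete_of_convergent_controlled_sequences (fun n => (1 / 2 : ℝ) ^ n)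
    (fun n => by positivity) fun u hu => ?_
  choose x hx hxu using fun n => exists_conePt (u n)
  let S : ℕ → Set I := fun N => {n | ∀ m ≤ N, dist (x m n) (x N n) ≤ (1 / 2 : ℝ) ^ m * d n}
  have hS : ∀ N, ∀ᶠ n in (ω : Filter I), n ∈ S N := by
    intro N
    have : ∀ᶠ n in (ω : Filter I), ∀ m ∈ Finset.range (N + 1),
        dist (x m n) (x N n) ≤ (1 / 2 : ℝ) ^ m * d n := by
      rw [eventually_all_finset]
      intro m hm
      have hlt := hu m m N le_rfl (by simpa [Nat.lt_succ_iff] using hm)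
      rw [← hxu, ← hxu] at hlt
      exact (eventually_dist_lt (hx m) (hx N) hlt).mono fun n hn => hn.le
    filter_upwards [this] with n hn m hm
    exact hn m (by simpa [Nat.lt_succ_iff] using hm)
  have hT : ∀ N, ∀ᶠ n in (ω : Filter I), N ≤ f n := by
    intro N
    refine hω ?_
    rw [mem_cofinite]
    refine Set.Finite.subset (Set.Finite.preimage hf.injOn (Set.finite_Iio N)) fun n hn => ?_
    simpa using hn
  -- The largest `N ≤ f n` for which the Cauchy estimates up to `N` are already visible at index
  -- `n`.
  let k : I → ℕ := fun n => Nat.findGreatest (fun N => n ∈ S N) (f n)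
  let y : I → X := fun n => x (k n) n
  have key : ∀ N, ∀ᶠ n in (ω : Filter I), dist (x N n) (y n) ≤ (1 / 2 : ℝ) ^ N * d n := by
    intro N
    filter_upwards [hS N, hT N] with n h1 h2
    have h3 : N ≤ k n := Nat.le_findGreatest h2 h1
    have h4 : n ∈ S (k n) := Nat.findGreatest_spec (P := fun N => n ∈ S N) h2 h1
    exact h4 N h3
  have hy : IsFin ω e d y := (hx 0).of_dist_le hd (C := (1 / 2 : ℝ) ^ 0) (by
    filter_upwards [key 0] with n hn
    rwa [dist_comm])
  refine ⟨conePt hd e y, ?_⟩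
  rw [tendsto_iff_dist_tendsto_zero]
  refine squeeze_zero (fun _ => dist_nonneg) (fun N => ?_)
    (tendsto_pow_atTop_nhds_zero_of_lt_one (by norm_num) (by norm_num : (1 / 2 : ℝ) < 1))
  rw [← hxu]
  exact dist_conePt_le (hx N) hy (key N)

/-! #### Limits of geodesics -/

/-- The limit of the geodesics `q n` of length `ℓ n`. -/
noncomputable def limGeo (hd : Tendsto d ω atTop) (e : I → X) (q : I → ℝ → X) (ℓ : I → ℝ) (t : ℝ) :
    Cone ω e d hd :=
  conePt hd e fun n => q n (max 0 (min (t * d n) (ℓ n)))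

/-- `q n` is almost surely a geodesic of length `ℓ n`, at finite distance from the observation
point, and `ℓ n / d n` tends to `L`. -/
structure GeoSeq (ω : Ultrafilter I) (e : I → X) (d : I → ℝ) (q : I → ℝ → X) (ℓ : I → ℝ)
    (L : ℝ) : Prop where
  geo : ∀ᶠ n in (ω : Filter I), IsGeodesic (q n) (ℓ n)
  start : IsFin ω e d fun n => q n 0
  len : Tendsto (fun n => ℓ n / d n) ω (𝓝 L)

namespace GeoSeq

variable {q : I → ℝ → X} {ℓ : I → ℝ} {L : ℝ}

theorem nonneg (h : GeoSeq ω e d q ℓ L) (hd : Tendsto d ω atTop) : 0 ≤ L := by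
  refine ge_of_tendsto h.len ?_
  filter_upwards [h.geo, eventually_scale_pos hd] with n h1 h2
  exact div_nonneg h1.1 h2.le

theorem isFin (h : GeoSeq ω e d q ℓ L) (hd : Tendsto d ω atTop) {t : I → ℝ}
    (ht : ∀ᶠ n in (ω : Filter I), t n ∈ Set.Icc 0 (ℓ n)) : IsFin ω e d fun n => q n (t n) := by
  refine h.start.of_dist_le hd (C := L + 1) ?_
  filter_upwards [h.geo, ht, h.len.eventually_lt_const (lt_add_one L), eventually_scale_pos hd]
    with n h1 h2 h3 h4
  rw [div_lt_iff₀ h4] at h3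
  rw [dist_comm, h1.dist_zero h2.1 h2.2]
  linarith [h2.2]

theorem clamp_mem (h : GeoSeq ω e d q ℓ L) (t : ℝ) :
    ∀ᶠ n in (ω : Filter I), max 0 (min (t * d n) (ℓ n)) ∈ Set.Icc 0 (ℓ n) := by
  filter_upwards [h.geo] with n h1
  exact ⟨le_max_left _ _, max_le h1.1 (min_le_right _ _)⟩

theorem tendsto_clamp (h : GeoSeq ω e d q ℓ L) (hd : Tendsto d ω atTop) {t : ℝ}
    (ht : t ∈ Set.Icc 0 L) :
    Tendsto (fun n => max 0 (min (t * d n) (ℓ n)) / d n) ω (𝓝 t) := by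
  have : Tendsto (fun n => max 0 (min t (ℓ n / d n))) ω (𝓝 (max 0 (min t L))) :=
    tendsto_const_nhds.max (tendsto_const_nhds.min h.len)
  rw [min_eq_left ht.2, max_eq_right ht.1] at this
  refine this.congr' ?_
  filter_upwards [eventually_scale_pos hd] with n hn
  rw [max_div_div_right_aux hn]
where
  max_div_div_right_aux {t c b : ℝ} (hc : 0 < c) : max 0 (min t (b / c)) =
      max 0 (min (t * c) b) / c := by
    rw [← max_div_div_right hc.le, ← min_div_div_right hc.le, zero_div,
      mul_div_cancel_right₀ _ hc.ne']

theorem dist_conePt (h : GeoSeq ω e d q ℓ L) {s t : I → ℝ} {a b : ℝ}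
    (hs : ∀ᶠ n in (ω : Filter I), s n ∈ Set.Icc 0 (ℓ n))
    (ht : ∀ᶠ n in (ω : Filter I), t n ∈ Set.Icc 0 (ℓ n))
    (hsa : Tendsto (fun n => s n / d n) ω (𝓝 a)) (htb : Tendsto (fun n => t n / d n) ω (𝓝 b)) :
    dist (conePt hd e fun n => q n (s n)) (conePt hd e fun n => q n (t n)) = |a - b| := by
  refine tendsto_nhds_unique (tendsto_dist_conePt (h.isFin hd hs) (h.isFin hd ht)) ?_
  refine ((hsa.sub htb).abs).congr' ?_
  filter_upwards [h.geo, hs, ht, eventually_scale_pos hd] with n h1 h2 h3 h4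
  rw [h1.2 _ h2 _ h3, ← sub_div, abs_div, abs_of_pos h4]

theorem conePt_eq_limGeo (h : GeoSeq ω e d q ℓ L) {t : I → ℝ} {a : ℝ} (ha : a ∈ Set.Icc 0 L)
    (ht : ∀ᶠ n in (ω : Filter I), t n ∈ Set.Icc 0 (ℓ n))
    (hta : Tendsto (fun n => t n / d n) ω (𝓝 a)) :
    (conePt hd e fun n => q n (t n)) = limGeo hd e q ℓ a := by
  rw [← dist_eq_zero]
  exact (h.dist_conePt ht (h.clamp_mem a) hta (h.tendsto_clamp hd ha)).trans (by simp)

theorem isGeodesic (h : GeoSeq ω e d q ℓ L) : IsGeodesic (limGeo hd e q ℓ) L :=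
  ⟨h.nonneg hd, fun _ hs _ ht => h.dist_conePt (h.clamp_mem _) (h.clamp_mem _)
    (h.tendsto_clamp hd hs) (h.tendsto_clamp hd ht)⟩

theorem limGeo_zero (h : GeoSeq ω e d q ℓ L) :
    limGeo hd e q ℓ 0 = conePt hd e fun n => q n 0 :=
  (h.conePt_eq_limGeo ⟨le_rfl, h.nonneg hd⟩
    (h.geo.mono fun _ hn => ⟨le_rfl, hn.1⟩) (by simp)).symm

theorem limGeo_len (h : GeoSeq ω e d q ℓ L) :
    limGeo hd e q ℓ L = conePt hd e fun n => q n (ℓ n) :=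
  (h.conePt_eq_limGeo ⟨h.nonneg hd, le_rfl⟩
    (h.geo.mono fun _ hn => ⟨hn.1, le_rfl⟩) h.len).symm

/-- Points chosen on the geodesics converge to a point of the limit geodesic. -/
theorem exists_limGeo_eq (h : GeoSeq ω e d q ℓ L) {t : I → ℝ}
    (ht : ∀ᶠ n in (ω : Filter I), t n ∈ Set.Icc 0 (ℓ n)) :
    ∃ a ∈ Set.Icc 0 L, Tendsto (fun n => t n / d n) ω (𝓝 a) ∧
      (conePt hd e fun n => q n (t n)) = limGeo hd e q ℓ a := by
  obtain ⟨a, ha, hta⟩ := exists_tendsto_of_eventually_mem_Icc (ω := ω) (f := fun n => t n / d n)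
    (a := 0) (b := L + 1) (by
      filter_upwards [ht, h.len.eventually_lt_const (lt_add_one L), eventually_scale_pos hd]
        with n h1 h2 h3
      refine ⟨div_nonneg h1.1 h3.le, le_trans ?_ h2.le⟩
      gcongr
      exact h1.2)
  have haL : a ≤ L := by
    refine le_of_tendsto_of_tendsto hta h.len ?_
    filter_upwards [ht, eventually_scale_pos hd] with n h1 h3
    gcongr
    exact h1.2
  exact ⟨a, ⟨ha.1, haL⟩, hta, h.conePt_eq_limGeo ⟨ha.1, haL⟩ ht hta⟩

/-- The time at which `limGeo` is evaluated, when it does not exceed the length. -/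
theorem limGeo_eq (h : GeoSeq ω e d q ℓ L) {a : ℝ} (ha : a ∈ Set.Icc 0 L)
    (hal : ∀ᶠ n in (ω : Filter I), a * d n ≤ ℓ n) :
    limGeo hd e q ℓ a = conePt hd e fun n => q n (a * d n) := by
  refine (h.conePt_eq_limGeo ha ?_ ?_).symm
  · filter_upwards [hal, eventually_scale_pos hd] with n h1 h2
    exact ⟨mul_nonneg ha.1 h2.le, h1⟩
  · refine tendsto_const_nhds.congr' ?_
    filter_upwards [eventually_scale_pos hd] with n h2
    rw [mul_div_cancel_right₀ _ h2.ne']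

end GeoSeq

theorem geoSeq_of_isFin (hd : Tendsto d ω atTop) {q : I → ℝ → X} {ℓ : I → ℝ} {x y : I → X}
    (hx : IsFin ω e d x) (hy : IsFin ω e d y)
    (hq : ∀ᶠ n in (ω : Filter I), IsGeodesic (q n) (ℓ n)) (h0 : ∀ n, q n 0 = x n)
    (h1 : ∀ n, q n (ℓ n) = y n) :
    GeoSeq ω e d q ℓ (dist (conePt hd e x) (conePt hd e y)) where
  geo := hq
  start := by simpa only [h0] using hx
  len := by
    refine (tendsto_dist_conePt hx hy).congr' ?_
    filter_upwards [hq] with n hn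
    rw [← h0, ← h1, hn.dist_ends]

/-- The geodesics of the cone that are limits of geodesics. -/
def IsLimGeo (hd : Tendsto d ω atTop) (e : I → X) (g : ℝ → Cone ω e d hd) (L : ℝ) : Prop :=
  ∃ q ℓ, GeoSeq ω e d q ℓ L ∧ ∀ t ∈ Set.Icc 0 L, g t = limGeo hd e q ℓ t

theorem exists_isLimGeo (hX : IsGeodesicSpace X) (p p' : Cone ω e d hd) :
    ∃ g L, IsLimGeo hd e g L ∧ g 0 = p ∧ g L = p' := by
  obtain ⟨x, hx, rfl⟩ := exists_conePt p
  obtain ⟨y, hy, rfl⟩ := exists_conePt p'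
  choose q ℓ hq h0 h1 _ using fun n => hX (x n) trivial (y n) trivial
  have h := geoSeq_of_isFin hd hx hy (Eventually.of_forall hq) h0 h1
  refine ⟨limGeo hd e q ℓ, _, ⟨q, ℓ, h, fun _ _ => rfl⟩, ?_, ?_⟩
  · rw [h.limGeo_zero]; simp only [h0]
  · rw [h.limGeo_len]; simp only [h1]

theorem IsLimGeo.isGeodesic {g : ℝ → Cone ω e d hd} {L : ℝ} (h : IsLimGeo hd e g L) :
    IsGeodesic g L := by
  obtain ⟨q, ℓ, hq, hg⟩ := h
  refine ⟨hq.nonneg hd, fun s hs t ht => ?_⟩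
  rw [hg s hs, hg t ht]
  exact hq.isGeodesic.2 s hs t ht

theorem isGeodesicSpace_cone (hX : IsGeodesicSpace X) : IsGeodesicSpace (Cone ω e d hd) := by
  intro p _ p' _
  obtain ⟨g, L, hg, h0, h1⟩ := exists_isLimGeo hX p p'
  exact ⟨g, L, hg.isGeodesic, h0, h1, Set.subset_univ _⟩

theorem IsLimGeo.initial {g : ℝ → Cone ω e d hd} {L s : ℝ} (h : IsLimGeo hd e g L) (hs : 0 ≤ s)
    (hsL : s ≤ L) : IsLimGeo hd e g s := by
  obtain ⟨q, ℓ, hq, hg⟩ := h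
  have hc := hq.clamp_mem s
  have hq' : GeoSeq ω e d q (fun n => max 0 (min (s * d n) (ℓ n))) s :=
    ⟨by filter_upwards [hq.geo, hc] with n h1 h2 using h1.initial h2.1 h2.2, hq.start,
      hq.tendsto_clamp hd ⟨hs, hsL⟩⟩
  refine ⟨q, _, hq', fun t ht => ?_⟩
  rw [hg t ⟨ht.1, ht.2.trans hsL⟩]
  refine (hq.conePt_eq_limGeo ⟨ht.1, ht.2.trans hsL⟩ ?_ (hq'.tendsto_clamp hd ht)).symm
  filter_upwards [hq'.clamp_mem t, hc] with n h1 h2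
  exact ⟨h1.1, h1.2.trans h2.2⟩

theorem IsLimGeo.reverse {g : ℝ → Cone ω e d hd} {L : ℝ} (h : IsLimGeo hd e g L) :
    IsLimGeo hd e (fun r => g (L - r)) L := by
  obtain ⟨q, ℓ, hq, hg⟩ := h
  have hq' : GeoSeq ω e d (fun n r => q n (ℓ n - r)) ℓ L :=
    ⟨by filter_upwards [hq.geo] with n h1 using h1.reverse,
      by
        simp only [sub_zero]
        exact hq.isFin hd (by filter_upwards [hq.geo] with n h1 using ⟨h1.1, le_rfl⟩), hq.len⟩
  refine ⟨_, _, hq', fun t ht => ?_⟩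
  have ht' : L - t ∈ Set.Icc 0 L := ⟨by linarith [ht.2], by linarith [ht.1]⟩
  refine (hg _ ht').trans (hq.conePt_eq_limGeo ht' ?_ ?_).symm
  · filter_upwards [hq'.clamp_mem t] with n h1
    exact ⟨by linarith [h1.2], by linarith [h1.1]⟩
  · simp only [sub_div]
    exact hq.len.sub (hq'.tendsto_clamp hd ht)

theorem IsLimGeo.shift {g : ℝ → Cone ω e d hd} {L s : ℝ} (h : IsLimGeo hd e g L) (hs : 0 ≤ s)
    (hsL : s ≤ L) : IsLimGeo hd e (fun r => g (s + r)) (L - s) := by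
  have h' := (h.reverse.initial (s := L - s) (by linarith) (by linarith)).reverse
  convert h' using 3
  ring

end Cone

end TreeGraded

namespace TreeGraded

/-! ### Convexity of limit pieces -/

section Hit

variable {X : Type u} [MetricSpace X] {ι : Type v}

/-- Geodesics of length `ℓ` with endpoints `ℓ / 3`-close to `A i` meet the `M`-neighbourhood of
`A i`. -/
def HitConst (A : ι → Set X) (M : ℝ) : Prop :=
  0 < M ∧ ∀ (q : ℝ → X) (ℓ : ℝ), IsGeodesic q ℓ → ∀ i,
    (∃ y ∈ A i, dist (q 0) y < ℓ / 3) → (∃ y ∈ A i, dist (q ℓ) y < ℓ / 3) →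
      ∃ t ∈ Set.Icc 0 ℓ, ∃ y ∈ A i, dist (q t) y < M

theorem Alpha2.exists_hitConst {A : ι → Set X} (h : Alpha2 A) : ∃ M, HitConst A M := by
  obtain ⟨M, hM, h⟩ := h (1 / 3) (by norm_num) (by norm_num)
  refine ⟨M, hM, fun q ℓ hq i h0 h1 => ?_⟩
  obtain ⟨x, ⟨t, ht, rfl⟩, hx⟩ := h q ℓ hq i
    (mem_thickening_iff.2 (by simpa [div_eq_inv_mul] using h0))
    (mem_thickening_iff.2 (by simpa [div_eq_inv_mul] using h1))
  exact ⟨t, ht, mem_thickening_iff.1 hx⟩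

theorem HitConst.exists_hit {A : ι → Set X} {M : ℝ} (hM : HitConst A M) {q : ℝ → X} {ℓ s t : ℝ}
    (hq : IsGeodesic q ℓ) (hs : 0 ≤ s) (hst : s ≤ t) (ht : t ≤ ℓ) {i : ι}
    (h0 : ∃ y ∈ A i, dist (q s) y < (t - s) / 3) (h1 : ∃ y ∈ A i, dist (q t) y < (t - s) / 3) :
    ∃ r ∈ Set.Icc s t, ∃ y ∈ A i, dist (q r) y < M := by
  have g := (hq.shift hs (hst.trans ht)).initial (s := t - s) (by linarith) (by linarith)
  obtain ⟨r, hr, h⟩ := hM.2 _ _ g i (by simpa using h0) (by simpa using h1)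
  exact ⟨s + r, ⟨by linarith [hr.1], by linarith [hr.2]⟩, h⟩

/-- A gap between consecutive visits to the closed `M`-neighbourhood has length at most `6 * M`,
since a longer one would contain another visit. So every point is within `3 * M` of a visit. -/
theorem HitConst.quasiconvex {A : ι → Set X} {M : ℝ} (hM : HitConst A M) {q : ℝ → X} {ℓ : ℝ}
    (hq : IsGeodesic q ℓ) {i : ι} (h0 : ∃ y ∈ A i, dist (q 0) y < M)
    (h1 : ∃ y ∈ A i, dist (q ℓ) y < M) {t : ℝ} (ht : t ∈ Set.Icc 0 ℓ) :
    ∃ y ∈ A i, dist (q t) y < 5 * M := by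
  have hM0 := hM.1
  have mem : ∀ {x}, (∃ y ∈ A i, dist x y < M) → x ∈ cthickening M (A i) := fun h =>
    thickening_subset_cthickening _ _ (mem_thickening_iff.2 h)
  have near : ∀ {x}, x ∈ cthickening M (A i) → ∃ y ∈ A i, dist x y < M + M / 8 := fun h =>
    mem_thickening_iff.1 (cthickening_subset_thickening' (by linarith) (by linarith) _ h)
  obtain ⟨a, ha, haC, hmax⟩ := hq.exists_last (S := cthickening M (A i)) isClosed_cthickening
    le_rfl ht.2 (r := 0) ⟨le_rfl, ht.1⟩ (mem h0)
  obtain ⟨b, hb, hbC, hmin⟩ := hq.exists_first (S := cthickening M (A i)) isClosed_cthickening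
    ht.1 le_rfl (r := ℓ) ⟨ht.2, le_rfl⟩ (mem h1)
  obtain ⟨y, hy, hya⟩ := near haC
  obtain ⟨w, hw, hwb⟩ := near hbC
  by_cases hab : b - a ≤ 6 * M
  · rcases le_total (t - a) (b - t) with h | h
    · refine ⟨y, hy, ?_⟩
      have := dist_triangle_left (q t) y (q a)
      rw [hq.dist_eq ha.1 ha.2 ht.2] at this
      linarith
    · refine ⟨w, hw, ?_⟩
      have := dist_triangle (q t) (q b) w
      rw [hq.dist_eq ht.1 hb.1 hb.2] at this
      linarith
  · push Not at hab
    exfalso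
    -- Shrinking by `M / 4` forces the new visit strictly inside the gap. The ends are within `M + M
    -- / 8 + M / 4` of `A i`, less than a third of the remaining length, which exceeds `5.5 * M`.
    obtain ⟨r, hr, hrM⟩ := hM.exists_hit hq (s := a + M / 4) (t := b - M / 4) (by linarith [ha.1])
      (by linarith) (by linarith [hb.2]) (i := i)
      ⟨y, hy, by
        have := dist_triangle_left (q (a + M / 4)) y (q a)
        rw [hq.dist_eq ha.1 (by linarith) (by linarith [hb.2])] at this
        linarith⟩
      ⟨w, hw, by
        have := dist_triangle (q (b - M / 4)) (q b) w
        rw [hq.dist_eq (by linarith [ha.1]) (by linarith) hb.2] at this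
        linarith⟩
    rcases le_total r t with h | h
    · have := hmax r ⟨by linarith [ha.1, hr.1], h⟩ (mem hrM)
      linarith [hr.1]
    · have := hmin r ⟨h, by linarith [hb.2, hr.2]⟩ (mem hrM)
      linarith [hr.2]

variable {I : Type} {ω : Ultrafilter I} {e : I → X} {d : I → ℝ} {hd : Tendsto d ω atTop}
  {A : ι → Set X} {M : ℝ} {q : I → ℝ → X} {ℓ : I → ℝ} {L : ℝ} {i : I → ι}

theorem GeoSeq.eventually_hit_of_near (hq : GeoSeq ω e d q ℓ L) (hd : Tendsto d ω atTop)
    (hM : HitConst A M) {s t : I → ℝ}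
    {a b c : ℝ} (hs : ∀ᶠ n in (ω : Filter I), s n ∈ Set.Icc 0 (ℓ n))
    (ht : ∀ᶠ n in (ω : Filter I), t n ∈ Set.Icc 0 (ℓ n))
    (hsa : Tendsto (fun n => s n / d n) ω (𝓝 a)) (htb : Tendsto (fun n => t n / d n) ω (𝓝 b))
    (hc0 : 0 < c) (hc : c < (b - a) / 3)
    (hs' : ∀ᶠ n in (ω : Filter I), ∃ y ∈ A (i n), dist (q n (s n)) y < c * d n)
    (ht' : ∀ᶠ n in (ω : Filter I), ∃ y ∈ A (i n), dist (q n (t n)) y < c * d n) :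
    ∀ᶠ n in (ω : Filter I), ∃ r ∈ Set.Icc (s n) (t n), ∃ y ∈ A (i n), dist (q n r) y < M := by
  have hlim := (htb.sub hsa).eventually_const_lt (show 3 * c < b - a by linarith)
  filter_upwards [hq.geo, hs, ht, hs', ht', hlim, eventually_scale_pos hd]
    with n h1 h2 h3 ⟨y, hy, hys⟩ ⟨w, hw, hwt⟩ h6 h7
  rw [← sub_div, lt_div_iff₀ h7] at h6
  have : 0 < c * d n := mul_pos hc0 h7
  exact hM.exists_hit h1 h2.1 (by linarith) h3.2 ⟨y, hy, by linarith⟩ ⟨w, hw, by linarith⟩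

theorem GeoSeq.eventually_hit (hq : GeoSeq ω e d q ℓ L) (hM : HitConst A M) {a b : ℝ}
    (ha : 0 ≤ a) (hab : a < b) (hb : b ≤ L)
    (ha' : limGeo hd e q ℓ a ∈ limSet hd e fun n => A (i n))
    (hb' : limGeo hd e q ℓ b ∈ limSet hd e fun n => A (i n)) :
    ∀ᶠ n in (ω : Filter I), ∃ r ∈ Set.Icc (max 0 (min (a * d n) (ℓ n)))
      (max 0 (min (b * d n) (ℓ n))), ∃ y ∈ A (i n), dist (q n r) y < M := by
  have hca := hq.clamp_mem a
  have hcb := hq.clamp_mem b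
  refine hq.eventually_hit_of_near hd hM hca hcb (hq.tendsto_clamp hd ⟨ha, hab.le.trans hb⟩)
    (hq.tendsto_clamp hd ⟨ha.trans hab.le, hb⟩) (c := (b - a) / 4) (by linarith) (by linarith)
    (eventually_of_mem_limSet (hq.isFin hd hca) ha' (by linarith))
    (eventually_of_mem_limSet (hq.isFin hd hcb) hb' (by linarith))

/-- The gap argument on the scale of the cone: an excursion from the closed limit set over `(a, b)`
would contain the limit of points `M`-close to `A (i n)`, and `M` vanishes after rescaling. -/
theorem GeoSeq.limGeo_mem_of_ends_mem (hq : GeoSeq ω e d q ℓ L) (hM : HitConst A M)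
    (h0 : limGeo hd e q ℓ 0 ∈ limSet hd e fun n => A (i n))
    (h1 : limGeo hd e q ℓ L ∈ limSet hd e fun n => A (i n)) :
    ∀ t ∈ Set.Icc 0 L, limGeo hd e q ℓ t ∈ limSet hd e fun n => A (i n) := by
  intro t ht
  by_contra htS
  have hg := hq.isGeodesic (hd := hd)
  set S := limSet hd e fun n => A (i n) with hS
  obtain ⟨a, ha, haS, hmax⟩ := hg.exists_last (S := S) (isClosed_limSet _) le_rfl ht.2 (r := 0)
    ⟨le_rfl, ht.1⟩ h0
  obtain ⟨b, hb, hbS, hmin⟩ := hg.exists_first (S := S) (isClosed_limSet _) ht.1 le_rfl (r := L)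
    ⟨ht.2, le_rfl⟩ h1
  have hat : a < t := lt_of_le_of_ne ha.2 fun h => htS (by rwa [← h])
  have htb : t < b := lt_of_le_of_ne hb.1 fun h => htS (by rwa [h])
  -- On `[a + η, b - η]`, of length `8 * η`, the ends are within `2 * η` of the sets after
  -- rescaling, which is less than a third of the length.
  set η := (b - a) / 10 with hη
  have hη0 : 0 < η := by rw [hη]; linarith
  have hside : ∀ {c c' : ℝ}, c ∈ Set.Icc 0 L → c' ∈ Set.Icc 0 L → |c - c'| = η →
      limGeo hd e q ℓ c' ∈ S → ∀ᶠ n in (ω : Filter I),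
        ∃ y ∈ A (i n), dist (q n (max 0 (min (c * d n) (ℓ n)))) y < 2 * η * d n := by
    intro c c' hc hc' hcc hc'S
    have h2 := eventually_of_mem_limSet (hq.isFin hd (hq.clamp_mem c')) hc'S
      (show (0 : ℝ) < η / 2 by linarith)
    have h3 := eventually_dist_lt (hd := hd) (hq.isFin hd (hq.clamp_mem c))
      (hq.isFin hd (hq.clamp_mem c')) (C := η + η / 2) (by
        rw [hq.dist_conePt (hq.clamp_mem c) (hq.clamp_mem c') (hq.tendsto_clamp hd hc)
          (hq.tendsto_clamp hd hc'), hcc]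
        linarith)
    filter_upwards [h2, h3] with n ⟨y, hy, h4⟩ h5
    exact ⟨y, hy, lt_of_le_of_lt (dist_triangle _ _ _) (lt_of_lt_of_eq (add_lt_add h5 h4)
      (by ring))⟩
  have hA' : a + η ∈ Set.Icc 0 L := ⟨by linarith [ha.1], by linarith [hb.2]⟩
  have hB' : b - η ∈ Set.Icc 0 L := ⟨by linarith [ha.1], by linarith [hb.2]⟩
  have hhit := hq.eventually_hit_of_near hd hM (hq.clamp_mem (a + η)) (hq.clamp_mem (b - η))
    (hq.tendsto_clamp hd hA') (hq.tendsto_clamp hd hB') (c := 2 * η) (by linarith)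
    (by rw [hη]; linarith)
    (hside hA' ⟨ha.1, by linarith [hb.2]⟩ (by simp [abs_of_pos hη0]) haS)
    (hside hB' ⟨by linarith [ha.1], hb.2⟩ (by simp [abs_of_pos hη0]) hbS)
  classical
  have hch : ∀ n, ∃ r, (∃ r ∈ Set.Icc (max 0 (min ((a + η) * d n) (ℓ n)))
      (max 0 (min ((b - η) * d n) (ℓ n))), ∃ y ∈ A (i n), dist (q n r) y < M) →
      r ∈ Set.Icc (max 0 (min ((a + η) * d n) (ℓ n)))
        (max 0 (min ((b - η) * d n) (ℓ n))) ∧ ∃ y ∈ A (i n), dist (q n r) y < M := by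
    intro n
    by_cases h : ∃ r ∈ Set.Icc (max 0 (min ((a + η) * d n) (ℓ n)))
      (max 0 (min ((b - η) * d n) (ℓ n))), ∃ y ∈ A (i n), dist (q n r) y < M
    · obtain ⟨r, hr⟩ := h
      exact ⟨r, fun _ => hr⟩
    · exact ⟨0, fun h' => absurd h' h⟩
  choose r hr using hch
  have hr' := hhit.mono fun n hn => hr n hn
  have hrm : ∀ᶠ n in (ω : Filter I), r n ∈ Set.Icc 0 (ℓ n) := by
    filter_upwards [hr', hq.clamp_mem (b - η)] with n h1 h2
    exact ⟨(le_max_left _ _).trans h1.1.1, h1.1.2.trans h2.2⟩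
  obtain ⟨c, hc, hrc, heq⟩ := hq.exists_limGeo_eq (hd := hd) hrm
  have hca : a + η ≤ c := by
    refine le_of_tendsto_of_tendsto (hq.tendsto_clamp hd hA') hrc ?_
    filter_upwards [hr', eventually_scale_pos hd] with n h1 h2
    gcongr
    exact h1.1.1
  have hcb : c ≤ b - η := by
    refine le_of_tendsto_of_tendsto hrc (hq.tendsto_clamp hd hB') ?_
    filter_upwards [hr', eventually_scale_pos hd] with n h1 h2
    gcongr
    exact h1.1.2
  have hcS : limGeo hd e q ℓ c ∈ S := by
    rw [← heq]
    refine conePt_mem_limSet (hq.isFin hd hrm) fun ε hε => ?_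
    filter_upwards [hr', hd.eventually_ge_atTop (M / ε)] with n ⟨_, y, hy, hym⟩ h2
    rw [div_le_iff₀ hε] at h2
    exact ⟨y, hy, by linarith⟩
  rcases le_total c t with h | h
  · linarith [hmax c ⟨hc.1, h⟩ hcS]
  · linarith [hmin c ⟨h, hc.2⟩ hcS]

end Hit

/-! ### Two limit pieces have at most one common point -/

section Inter

variable {X : Type u} [MetricSpace X] {ι : Type v} {I : Type} {ω : Ultrafilter I} {e : I → X}
  {d : I → ℝ} {hd : Tendsto d ω atTop} {A : ι → Set X}

/-- Between two distinct common points, the approximating geodesics visit both `A (i n)` and `A (j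
n)` in each outer third. By quasiconvexity the middle third is within `5 * M` of both, and its
length tends to infinity, contrary to (α₁). -/
theorem limSet_inter_subsingleton (hX : IsGeodesicSpace X) (h1 : Alpha1 A) {M : ℝ}
    (hM : HitConst A M) {i j : I → ι} (hij : ∀ᶠ n in (ω : Filter I), i n ≠ j n) :
    ((limSet hd e fun n => A (i n)) ∩ limSet hd e fun n => A (j n)).Subsingleton := by
  rintro p ⟨hpi, hpj⟩ p' ⟨hpi', hpj'⟩
  by_contra hne
  obtain ⟨g, L, ⟨q, ℓ, hq, hg⟩, rfl, rfl⟩ := exists_isLimGeo hX p p'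
  have hL0 := hq.nonneg hd
  have hL : 0 < L := lt_of_le_of_ne hL0 fun h => hne (by rw [← h])
  rw [hg 0 ⟨le_rfl, hL0⟩] at hpi hpj
  rw [hg L ⟨hL0, le_rfl⟩] at hpi' hpj'
  have near : ∀ k : I → ι, (limGeo hd e q ℓ 0 ∈ limSet hd e fun n => A (k n)) →
      (limGeo hd e q ℓ L ∈ limSet hd e fun n => A (k n)) →
      ∀ᶠ n in (ω : Filter I), ∀ t ∈ Set.Icc (max 0 (min (L / 3 * d n) (ℓ n)))
        (max 0 (min (2 * L / 3 * d n) (ℓ n))), ∃ y ∈ A (k n), dist (q n t) y < 5 * M := by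
    intro k h0 h1
    have hc := hq.limGeo_mem_of_ends_mem hM h0 h1
    filter_upwards [hq.geo, hq.eventually_hit hM le_rfl (b := L / 3) (by linarith) (by linarith) h0
      (hc _ ⟨by linarith, by linarith⟩), hq.eventually_hit hM (a := 2 * L / 3) (b := L)
      (by linarith) (by linarith) le_rfl (hc _ ⟨by linarith, by linarith⟩) h1,
      hq.clamp_mem L, eventually_scale_pos hd]
      with n hgeo ⟨r, hr, hrM⟩ ⟨r', hr', hrM'⟩ hcL hdn t ht
    have hr0 : 0 ≤ r := (le_max_left _ _).trans hr.1
    have hrt : r ≤ t := hr.2.trans ht.1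
    have htr : t ≤ r' := ht.2.trans hr'.1
    have hrl : r' ≤ ℓ n := hr'.2.trans hcL.2
    have := hM.quasiconvex (i := k n) ((hgeo.shift hr0 (by linarith)).initial (s := r' - r)
      (by linarith) (by linarith)) (by simpa using hrM) (by simpa using hrM') (t := t - r)
      ⟨by linarith, by linarith⟩
    simpa using this
  obtain ⟨D, hD⟩ := h1 (5 * M) (by linarith [hM.1])
  have hA := hq.tendsto_clamp hd (t := L / 3) ⟨by linarith, by linarith⟩
  have hB := hq.tendsto_clamp hd (t := 2 * L / 3) ⟨by linarith, by linarith⟩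
  have hlim := (hB.sub hA).eventually_const_lt (show L / 6 < 2 * L / 3 - L / 3 by linarith)
  have : ∀ᶠ n in (ω : Filter I), False := by
    filter_upwards [hq.geo, near i hpi hpi', near j hpj hpj', hij, hlim, eventually_scale_pos hd,
      hd.eventually_gt_atTop (6 * D / L), hq.clamp_mem (2 * L / 3)] with n hgeo hi hj hne hl hpos
      hbig hcl
    rw [← sub_div, lt_div_iff₀ hpos] at hl
    set s := max 0 (min (L / 3 * d n) (ℓ n))
    set t := max 0 (min (2 * L / 3 * d n) (ℓ n))
    have hst : s ≤ t := by nlinarith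
    have := hD (i n) (j n) hne (q n s)
      ⟨mem_thickening_iff.2 (hi s ⟨le_rfl, hst⟩), mem_thickening_iff.2 (hj s ⟨le_rfl, hst⟩)⟩ (q n t)
      ⟨mem_thickening_iff.2 (hi t ⟨hst, le_rfl⟩), mem_thickening_iff.2 (hj t ⟨hst, le_rfl⟩)⟩
    rw [hgeo.dist_eq (le_max_left _ _) hst hcl.2] at this
    rw [div_lt_iff₀ hL] at hbig
    nlinarith
  exact this.exists.choose_spec

end Inter

end TreeGraded

namespace TreeGraded

/-! ### Fat hexagons -/

section Hexagon

variable {X : Type u} [MetricSpace X]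

/-- Three geodesics `E i`, pairwise far apart, and geodesics `C i` realizing the distance from
`E i` to `E (i + 1)`. -/
structure HexData (X : Type u) [MetricSpace X] (θ ν : ℝ) where
  E : Fin 3 → ℝ → X
  m : Fin 3 → ℝ
  C : Fin 3 → ℝ → X
  μ : Fin 3 → ℝ
  geoE : ∀ i, IsGeodesic (E i) (m i)
  geoC : ∀ i, IsGeodesic (C i) (μ i)
  endE : ∀ i, E i (m i) = C i 0
  endC : ∀ i, C i (μ i) = E (i + 1) 0
  le_μ : ∀ i, ν * θ ≤ μ i
  distEE : ∀ i, ∀ r ∈ Set.Icc 0 (m i), ∀ s ∈ Set.Icc 0 (m (i + 1)),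
    μ i ≤ dist (E i r) (E (i + 1) s)
  distCE : ∀ i, ∀ r ∈ Set.Icc 0 (μ i), ∀ s ∈ Set.Icc 0 (m (i + 2)),
    ν * θ ≤ dist (C i r) (E (i + 2) s)
  distCC : ∀ i, ∀ r ∈ Set.Icc 0 (μ i), ∀ s ∈ Set.Icc 0 (μ (i + 1)),
    ν * θ ≤ dist (C i r) (C (i + 1) s)

namespace HexData

variable {θ ν : ℝ} (D : HexData X θ ν)

/-- The hexagon with edges `E 0, C 0, E 1, C 1, E 2, C 2`. -/
def polygon : GeodesicPolygon X 6 where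
  edge := (![D.E 0, D.C 0, D.E 1, D.C 1, D.E 2, D.C 2] : Fin 6 → ℝ → X)
  len := (![D.m 0, D.μ 0, D.m 1, D.μ 1, D.m 2, D.μ 2] : Fin 6 → ℝ)
  isGeodesic i := by
    change Fin 6 at i
    fin_cases i
    · exact D.geoE 0
    · exact D.geoC 0
    · exact D.geoE 1
    · exact D.geoC 1
    · exact D.geoE 2
    · exact D.geoC 2
  closes i := by
    change Fin 6 at i
    fin_cases i
    · exact D.endE 0
    · exact D.endC 0
    · exact D.endE 1
    · exact D.endC 1
    · exact D.endE 2
    · exact D.endC 2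

/-- The `i`-th long edge as a set. -/
def sideE (i : Fin 3) : Set X := D.E i '' Set.Icc 0 (D.m i)

/-- The `i`-th connecting edge as a set. -/
def sideC (i : Fin 3) : Set X := D.C i '' Set.Icc 0 (D.μ i)

variable {D}

theorem fin3_eq {i j : Fin 3} (h : j ≠ i) : j = i + 1 ∨ i = j + 1 := by
  revert i j; decide

theorem fin3_eq' (i j : Fin 3) : j = i ∨ j = i + 1 ∨ j = i + 2 := by
  revert i j; decide

theorem far_EE {i j : Fin 3} (h : j ≠ i) {z w : X} (hz : z ∈ D.sideE i) (hw : w ∈ D.sideE j) :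
    ν * θ ≤ dist z w := by
  obtain ⟨r, hr, rfl⟩ := hz
  obtain ⟨s, hs, rfl⟩ := hw
  rcases fin3_eq h with rfl | rfl
  · exact (D.le_μ _).trans (D.distEE _ r hr s hs)
  · rw [dist_comm]; exact (D.le_μ _).trans (D.distEE _ s hs r hr)

theorem far_CC {i j : Fin 3} (h : j ≠ i) {z w : X} (hz : z ∈ D.sideC i) (hw : w ∈ D.sideC j) :
    ν * θ ≤ dist z w := by
  obtain ⟨r, hr, rfl⟩ := hz
  obtain ⟨s, hs, rfl⟩ := hw
  rcases fin3_eq h with rfl | rfl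
  · exact D.distCC _ r hr s hs
  · rw [dist_comm]; exact D.distCC _ s hs r hr

/-- A point of `E i` closer than `r` would give a shorter connection from `E i` to `E (i + 1)` than
`C i`. -/
theorem dist_C_E {i : Fin 3} {r : ℝ} (hr : r ∈ Set.Icc 0 (D.μ i)) {w : X} (hw : w ∈ D.sideE i) :
    r ≤ dist (D.C i r) w := by
  obtain ⟨s, hs, rfl⟩ := hw
  have h1 := D.distEE i s hs 0 ⟨le_rfl, (D.geoE (i + 1)).1⟩
  have h2 := (D.geoC i).dist_eq hr.1 hr.2 le_rfl
  rw [← D.endC] at h1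
  have := dist_triangle_left (D.E i s) (D.C i (D.μ i)) (D.C i r)
  linarith

theorem dist_C_E_succ {i : Fin 3} {r : ℝ} (hr : r ∈ Set.Icc 0 (D.μ i)) {w : X}
    (hw : w ∈ D.sideE (i + 1)) : D.μ i - r ≤ dist (D.C i r) w := by
  obtain ⟨s, hs, rfl⟩ := hw
  have h1 := D.distEE i (D.m i) ⟨(D.geoE i).1, le_rfl⟩ s hs
  have h2 := (D.geoC i).dist_zero hr.1 hr.2
  rw [D.endE] at h1
  have := dist_triangle (D.C i 0) (D.C i r) (D.E (i + 1) s)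
  linarith

/-- A point of the shortest connection at distance `r` from a corner is at distance at least `r`
from `z`, and by the triangle inequality at least `2 * θ - r`; one of the two is at least `θ`. -/
theorem edge_E (hθ : 0 < θ) (hν : 8 ≤ ν) {i : Fin 3} {z : X} (hz : z ∈ D.sideE i)
    (h0 : 2 * θ ≤ dist z (D.E i 0)) (h1 : 2 * θ ≤ dist z (D.C i 0)) :
    (∀ j ≠ i, ∀ w ∈ D.sideE j, θ ≤ dist z w) ∧ ∀ j, ∀ w ∈ D.sideC j, θ ≤ dist z w := by
  have hν' : θ ≤ ν * θ := by nlinarith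
  refine ⟨fun j hj w hw => hν'.trans (far_EE hj hz hw), fun j w hw => ?_⟩
  obtain ⟨r, hr, rfl⟩ := hw
  rcases fin3_eq' j i with rfl | rfl | rfl
  · have h2 := D.dist_C_E hr hz
    have h3 := (D.geoC i).dist_zero hr.1 hr.2
    have := dist_triangle_right z (D.C i 0) (D.C i r)
    rw [dist_comm] at h2
    linarith
  · have h2 := D.dist_C_E_succ hr hz
    have h3 := (D.geoC j).dist_eq hr.1 hr.2 le_rfl
    rw [← D.endC] at h0
    have := dist_triangle z (D.C j r) (D.C j (D.μ j))
    rw [dist_comm] at h2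
    linarith
  · obtain ⟨s, hs, rfl⟩ := hz
    rw [dist_comm]
    exact hν'.trans (D.distCE _ r hr s hs)

theorem edge_C (hθ : 0 < θ) (hν : 8 ≤ ν) {i : Fin 3} {z : X} (hz : z ∈ D.sideC i)
    (h0 : 2 * θ ≤ dist z (D.C i 0)) (h1 : 2 * θ ≤ dist z (D.E (i + 1) 0)) :
    (∀ j ≠ i, ∀ w ∈ D.sideC j, θ ≤ dist z w) ∧ ∀ j, ∀ w ∈ D.sideE j, θ ≤ dist z w := by
  have hν' : θ ≤ ν * θ := by nlinarith
  refine ⟨fun j hj w hw => hν'.trans (far_CC hj hz hw), fun j w hw => ?_⟩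
  obtain ⟨r, hr, rfl⟩ := hz
  rcases fin3_eq' i j with rfl | rfl | rfl
  · have h2 := D.dist_C_E hr hw
    have h3 := (D.geoC j).dist_zero hr.1 hr.2
    rw [dist_comm] at h3
    linarith
  · have h2 := D.dist_C_E_succ hr hw
    have h3 := (D.geoC i).dist_eq hr.1 hr.2 le_rfl
    rw [← D.endC] at h1
    linarith
  · obtain ⟨s, hs, rfl⟩ := hw
    exact hν'.trans (D.distCE _ r hr s hs)

theorem vertex_E {i j : Fin 3} (hj : j ≠ i) {w : X} (hw : w ∈ D.sideE j ∪ D.sideC (j - 1)) :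
    ν * θ ≤ dist (D.E i 0) w := by
  have h0 : D.E i 0 ∈ D.sideE i := ⟨0, ⟨le_rfl, (D.geoE i).1⟩, rfl⟩
  rcases hw with hw | hw
  · exact far_EE hj h0 hw
  · have h1 : D.E i 0 ∈ D.sideC (i - 1) := by
      have := D.endC (i - 1)
      rw [sub_add_cancel] at this
      rw [← this]
      exact ⟨_, ⟨(D.geoC _).1, le_rfl⟩, rfl⟩
    exact far_CC (by simpa using hj) h1 hw

theorem vertex_C {i j : Fin 3} (hj : j ≠ i) {w : X} (hw : w ∈ D.sideE j ∪ D.sideC j) :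
    ν * θ ≤ dist (D.C i 0) w := by
  rcases hw with hw | hw
  · refine far_EE hj ?_ hw
    rw [← D.endE]
    exact ⟨_, ⟨(D.geoE _).1, le_rfl⟩, rfl⟩
  · exact far_CC hj ⟨0, ⟨le_rfl, (D.geoC i).1⟩, rfl⟩ hw

theorem isFat (hθ : 0 < θ) (hν : 8 ≤ ν) : D.polygon.IsFat θ 2 ν := by
  have far : ∀ {z x y : X}, z ∉ thickening (2 * θ) {x, y} → 2 * θ ≤ dist z x ∧ 2 * θ ≤ dist z y := by
    intro z x y h
    rw [mem_thickening_iff] at h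
    push Not at h
    exact ⟨h x (by simp), h y (by simp)⟩
  constructor
  · intro i z hz w hw
    obtain ⟨hz, hfar⟩ := hz
    obtain ⟨h0, h1⟩ := far hfar
    simp only [GeodesicPolygon.others, Set.mem_ofPred_eq, Set.mem_iUnion, exists_prop] at hw
    obtain ⟨j, hj, hw⟩ := hw
    change Fin 6 at i j
    fin_cases i
    · have h := D.edge_E hθ hν (i := 0) hz h0 h1
      fin_cases j
      exacts [absurd rfl hj, h.2 0 w hw, h.1 1 (by decide) w hw, h.2 1 w hw,
        h.1 2 (by decide) w hw, h.2 2 w hw]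
    · have h := D.edge_C hθ hν (i := 0) hz h0 h1
      fin_cases j
      exacts [h.2 0 w hw, absurd rfl hj, h.2 1 w hw, h.1 1 (by decide) w hw, h.2 2 w hw,
        h.1 2 (by decide) w hw]
    · have h := D.edge_E hθ hν (i := 1) hz h0 h1
      fin_cases j
      exacts [h.1 0 (by decide) w hw, h.2 0 w hw, absurd rfl hj, h.2 1 w hw,
        h.1 2 (by decide) w hw, h.2 2 w hw]
    · have h := D.edge_C hθ hν (i := 1) hz h0 h1
      fin_cases j
      exacts [h.2 0 w hw, h.1 0 (by decide) w hw, h.2 1 w hw, absurd rfl hj, h.2 2 w hw,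
        h.1 2 (by decide) w hw]
    · have h := D.edge_E hθ hν (i := 2) hz h0 h1
      fin_cases j
      exacts [h.1 0 (by decide) w hw, h.2 0 w hw, h.1 1 (by decide) w hw, h.2 1 w hw,
        absurd rfl hj, h.2 2 w hw]
    · have h := D.edge_C hθ hν (i := 2) hz h0 h1
      fin_cases j
      exacts [h.2 0 w hw, h.1 0 (by decide) w hw, h.2 1 w hw, h.1 1 (by decide) w hw,
        h.2 2 w hw, absurd rfl hj]
  · intro i w hw
    simp only [GeodesicPolygon.opposite, Set.mem_ofPred_eq, Set.mem_iUnion, exists_prop] at hw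
    obtain ⟨j, ⟨hj, hj'⟩, hw⟩ := hw
    change Fin 6 at i j
    fin_cases i
    · have h := fun j hj w hw => D.vertex_E (i := 0) (j := j) hj (w := w) hw
      fin_cases j
      exacts [absurd rfl hj, h 1 (by decide) w (.inr hw), h 1 (by decide) w (.inl hw),
        h 2 (by decide) w (.inr hw), h 2 (by decide) w (.inl hw), absurd rfl hj']
    · have h := fun j hj w hw => D.vertex_C (i := 0) (j := j) hj (w := w) hw
      fin_cases j
      exacts [absurd rfl hj', absurd rfl hj, h 1 (by decide) w (.inl hw),
        h 1 (by decide) w (.inr hw), h 2 (by decide) w (.inl hw), h 2 (by decide) w (.inr hw)]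
    · have h := fun j hj w hw => D.vertex_E (i := 1) (j := j) hj (w := w) hw
      fin_cases j
      exacts [h 0 (by decide) w (.inl hw), absurd rfl hj', absurd rfl hj,
        h 2 (by decide) w (.inr hw), h 2 (by decide) w (.inl hw), h 0 (by decide) w (.inr hw)]
    · have h := fun j hj w hw => D.vertex_C (i := 1) (j := j) hj (w := w) hw
      fin_cases j
      exacts [h 0 (by decide) w (.inl hw), h 0 (by decide) w (.inr hw), absurd rfl hj',
        absurd rfl hj, h 2 (by decide) w (.inl hw), h 2 (by decide) w (.inr hw)]
    · have h := fun j hj w hw => D.vertex_E (i := 2) (j := j) hj (w := w) hw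
      fin_cases j
      exacts [h 0 (by decide) w (.inl hw), h 1 (by decide) w (.inr hw),
        h 1 (by decide) w (.inl hw), absurd rfl hj', absurd rfl hj, h 0 (by decide) w (.inr hw)]
    · have h := fun j hj w hw => D.vertex_C (i := 2) (j := j) hj (w := w) hw
      fin_cases j
      exacts [h 0 (by decide) w (.inl hw), h 0 (by decide) w (.inr hw),
        h 1 (by decide) w (.inl hw), h 1 (by decide) w (.inr hw), absurd rfl hj', absurd rfl hj]

theorem exists_near {ι : Type v} {A : ι → Set X} {χ : ℝ} (hθ : 0 < θ) (hν : 8 ≤ ν)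
    (h : ∀ P : GeodesicPolygon X 6, P.IsFat θ 2 ν → ∃ i, P.carrier ⊆ thickening χ (A i))
    (D : HexData X θ ν) : ∃ i, ∀ j, ∀ z ∈ D.sideE j, z ∈ thickening χ (A i) := by
  obtain ⟨i, hi⟩ := h D.polygon (D.isFat hθ hν)
  refine ⟨i, fun j z hz => hi ?_⟩
  fin_cases j
  · exact Set.mem_iUnion.2 ⟨(0 : Fin 6), hz⟩
  · exact Set.mem_iUnion.2 ⟨(2 : Fin 6), hz⟩
  · exact Set.mem_iUnion.2 ⟨(4 : Fin 6), hz⟩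

end HexData

/-- The part of `g` before time `t` is at distance at least `μ = dist (g t) (h s)` from `h`, where
`μ` is the maximum of `lam` and the distance from `g` to `h`. -/
theorem exists_corner {g h : ℝ → X} {ℓ ℓ' lam : ℝ} (hg : IsGeodesic g ℓ) (hh : IsGeodesic h ℓ')
    (hfar : ∀ s ∈ Set.Icc 0 ℓ', lam ≤ dist (g 0) (h s)) :
    ∃ t ∈ Set.Icc 0 ℓ, ∃ s ∈ Set.Icc 0 ℓ', lam ≤ dist (g t) (h s) ∧
      dist (g t) (h s) ≤ max lam (dist (g ℓ) (h 0)) ∧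
      ∀ r ∈ Set.Icc 0 t, ∀ s' ∈ Set.Icc 0 ℓ', dist (g t) (h s) ≤ dist (g r) (h s') := by
  set K := h '' Set.Icc 0 ℓ' with hK
  have hKc : IsCompact K := hh.isCompact_image
  have hKn : K.Nonempty := ⟨h 0, 0, ⟨le_rfl, hh.1⟩, rfl⟩
  have hcont : ContinuousOn (fun r => infDist (g r) K) (Set.Icc 0 ℓ) :=
    (continuous_infDist_pt K).comp_continuousOn hg.continuousOn
  obtain ⟨r₀, hr₀, hmin⟩ := isCompact_Icc.exists_isMinOn (Set.nonempty_Icc.2 hg.1) hcont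
  set μ := max lam (infDist (g r₀) K) with hμ
  have hcomp : IsCompact {r | r ∈ Set.Icc 0 ℓ ∧ infDist (g r) K ∈ Set.Iic μ} :=
    isCompact_Icc.of_isClosed_subset
      (hcont.preimage_isClosed_of_isClosed isClosed_Icc isClosed_Iic) fun x hx => hx.1
  obtain ⟨t, ⟨ht, htμ⟩, hleast⟩ := hcomp.exists_isLeast ⟨r₀, hr₀, show infDist (g r₀) K ≤ μ from le_max_right _ _⟩
  have hge : ∀ r ∈ Set.Icc 0 t, μ ≤ infDist (g r) K := by
    intro r hr
    by_contra! hlt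
    have hrℓ : r ≤ ℓ := hr.2.trans ht.2
    rcases hr.1.eq_or_lt with h0 | h0
    · subst h0
      rcases max_cases lam (infDist (g r₀) K) with ⟨hm, -⟩ | ⟨hm, -⟩
      · rw [hμ, hm] at hlt
        obtain ⟨y, ⟨s, hs, rfl⟩, hy⟩ := (infDist_lt_iff hKn).1 hlt
        linarith [hfar s hs]
      · rw [hμ, hm] at hlt
        exact absurd (hmin ⟨le_rfl, hg.1⟩) (not_le.2 hlt)
    -- The distance to `K` is 1-Lipschitz along `g`, so moving back by `δ` keeps it at most `μ`,
    -- against the choice of `t` as the first such time.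
    · set δ := min r (μ - infDist (g r) K) with hδ
      have hδ0 : 0 < δ := lt_min h0 (by linarith)
      have h1 : infDist (g (r - δ)) K ≤ infDist (g r) K + dist (g (r - δ)) (g r) :=
        infDist_le_infDist_add_dist
      have hδr : δ ≤ r := min_le_left _ _
      rw [hg.dist_eq (by linarith) (by linarith) hrℓ] at h1
      have h2 : δ ≤ μ - infDist (g r) K := min_le_right _ _
      have := hleast ⟨⟨by linarith, by linarith⟩, show infDist (g (r - δ)) K ≤ μ by linarith⟩
      linarith [hr.2]
  obtain ⟨y, ⟨s, hs, rfl⟩, hy⟩ := hKc.exists_infDist_eq_dist hKn (g t)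
  have hts : dist (g t) (h s) = μ := by
    rw [← hy]; exact le_antisymm htμ (hge t ⟨ht.1, le_rfl⟩)
  refine ⟨t, ht, s, hs, ?_, ?_, ?_⟩
  · rw [hts]; exact le_max_left _ _
  · rw [hts]
    refine max_le_max le_rfl ?_
    exact (isMinOn_iff.1 hmin ℓ ⟨hg.1, le_rfl⟩).trans
      (infDist_le_dist_of_mem ⟨0, ⟨le_rfl, hh.1⟩, rfl⟩)
  · intro r hr s' hs'
    rw [hts]
    exact (hge r hr).trans (infDist_le_dist_of_mem ⟨s', hs', rfl⟩)

end Hexagon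

end TreeGraded

namespace TreeGraded

/-! ### Triangles in the cone -/

section Far

variable {X : Type u} [MetricSpace X] {I : Type} {ω : Ultrafilter I} {e : I → X} {d : I → ℝ}
  {L L' : ℝ} {q q' : I → ℝ → X} {ℓ ℓ' : I → ℝ} {hd : Tendsto d ω atTop}

/-- Sets whose limits are disjoint are far from each other. -/
theorem eventually_far {S T : I → Set X} {x₀ : I → X} {C : ℝ} (hx₀ : IsFin ω e d x₀)
    (hS : ∀ᶠ n in (ω : Filter I), ∀ x ∈ S n, dist x (x₀ n) ≤ C * d n)
    (hST : Disjoint (limSet hd e S) (limSet hd e T)) (K : ℝ) :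
    ∀ᶠ n in (ω : Filter I), ∀ x ∈ S n, ∀ y ∈ T n, K ≤ dist x y := by
  by_contra hcon
  rw [Ultrafilter.eventually_not.symm] at hcon
  have h : ∀ᶠ n in (ω : Filter I), ∃ p : X × X, p.1 ∈ S n ∧ p.2 ∈ T n ∧ dist p.1 p.2 < K := by
    filter_upwards [hcon] with n hn
    push Not at hn
    obtain ⟨x, hx, y, hy, hxy⟩ := hn
    exact ⟨(x, y), hx, hy, hxy⟩
  have : Nonempty (X × X) := h.exists.choose_spec.nonempty
  obtain ⟨p, hp⟩ := h.choice
  have h1 : IsFin ω e d fun n => (p n).1 := hx₀.of_dist_le hd (C := C) (by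
    filter_upwards [hp, hS] with n h1 h2 using h2 _ h1.1)
  have hKd : ∀ ε > 0, ∀ᶠ n in (ω : Filter I), dist (p n).1 (p n).2 ≤ ε * d n := by
    intro ε hε
    filter_upwards [hp, hd.eventually_ge_atTop (K / ε)] with n h1 h2
    rw [div_le_iff₀ hε] at h2
    linarith [h1.2.2]
  have h2 : IsFin ω e d fun n => (p n).2 := h1.of_dist_le hd (C := 1) (by
    filter_upwards [hKd 1 one_pos] with n hn
    rwa [dist_comm])
  have heq := conePt_eq (hd := hd) h1 h2 hKd
  refine Set.disjoint_left.1 hST (conePt_mem_limSet_of_mem h1 (hp.mono fun n hn => hn.1)) ?_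
  rw [heq]
  exact conePt_mem_limSet_of_mem h2 (hp.mono fun n hn => hn.2.1)

theorem GeoSeq.exists_of_mem_limSet_image (h : GeoSeq ω e d q ℓ L) {s t : I → ℝ}
    (hs : ∀ᶠ n in (ω : Filter I), 0 ≤ s n) (ht : ∀ᶠ n in (ω : Filter I), t n ≤ ℓ n)
    {p : Cone ω e d hd} (hp : p ∈ limSet hd e fun n => q n '' Set.Icc (s n) (t n)) :
    ∃ a ∈ Set.Icc 0 L, p = limGeo hd e q ℓ a := by
  obtain ⟨x, hx, rfl, hxm⟩ := exists_of_mem_limSet hp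
  obtain ⟨r, hr⟩ := hxm.choice
  have hr' : ∀ᶠ n in (ω : Filter I), r n ∈ Set.Icc 0 (ℓ n) := by
    filter_upwards [hr, hs, ht] with n h1 h2 h3
    exact ⟨h2.trans h1.1.1, h1.1.2.trans h3⟩
  obtain ⟨a, ha, -, heq⟩ := h.exists_limGeo_eq (hd := hd) hr'
  refine ⟨a, ha, ?_⟩
  rw [← heq]
  refine conePt_eq hx (h.isFin hd hr') fun ε hε => ?_
  filter_upwards [hr, eventually_scale_pos hd] with n h1 h2
  rw [h1.2, dist_self]
  positivity

/-- Two limit geodesics meeting only at the end of the first and the beginning of the second are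
approximated by geodesics whose distance is realized near these points, at least up to the given
scale `lam`. -/
theorem GeoSeq.exists_corners (h : GeoSeq ω e d q ℓ L) (h' : GeoSeq ω e d q' ℓ' L') (hL : 0 < L)
    (hend : limGeo hd e q ℓ L = limGeo hd e q' ℓ' 0)
    (hmeet : ∀ s ∈ Set.Icc 0 L, ∀ t ∈ Set.Icc 0 L',
      limGeo hd e q ℓ s = limGeo hd e q' ℓ' t → t = 0) (lam : ℝ) :
    ∃ t s : I → ℝ, (∀ᶠ n in (ω : Filter I), t n ∈ Set.Icc 0 (ℓ n) ∧ s n ∈ Set.Icc 0 (ℓ' n) ∧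
      lam ≤ dist (q n (t n)) (q' n (s n)) ∧ ∀ r ∈ Set.Icc 0 (t n), ∀ s' ∈ Set.Icc 0 (ℓ' n),
        dist (q n (t n)) (q' n (s n)) ≤ dist (q n r) (q' n s')) ∧
      Tendsto (fun n => t n / d n) ω (𝓝 L) ∧ Tendsto (fun n => s n / d n) ω (𝓝 0) := by
  have hL0 : (0 : ℝ) ∈ Set.Icc 0 L := ⟨le_rfl, hL.le⟩
  have hLL : L ∈ Set.Icc 0 L := ⟨hL.le, le_rfl⟩
  have meet : ∀ s ∈ Set.Icc 0 L, ∀ t ∈ Set.Icc 0 L',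
      limGeo hd e q ℓ s = limGeo hd e q' ℓ' t → s = L ∧ t = 0 := by
    intro s hs t ht hst
    have ht0 := hmeet s hs t ht hst
    subst ht0
    exact ⟨h.isGeodesic.injOn hs hLL (hst.trans hend.symm), rfl⟩
  -- The origin of the first geodesic is off the second one in the limit, hence farther than `lam`
  -- from it in `X`; this is what a corner search with lower bound `lam` needs.
  have hfar := eventually_far (hd := hd) (S := fun n => {q n 0})
    (T := fun n => q' n '' Set.Icc 0 (ℓ' n)) (C := 0) h.start (by simp) (by
      rw [Set.disjoint_left]
      intro p hp hp'
      obtain ⟨x, hx, rfl, hx0⟩ := exists_of_mem_limSet hp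
      obtain ⟨a, ha, hpa⟩ := h'.exists_of_mem_limSet_image (Eventually.of_forall fun _ => le_rfl)
        (Eventually.of_forall fun _ => le_rfl) hp'
      have : conePt hd e x = limGeo hd e q ℓ 0 := by
        rw [h.limGeo_zero]
        refine conePt_eq hx h.start fun ε hε => ?_
        filter_upwards [hx0, eventually_scale_pos hd] with n h1 h2
        rw [show x n = q n 0 from h1, dist_self]
        positivity
      exact hL.ne (meet 0 hL0 a ha (this.symm.trans hpa)).1) lam
  have hex : ∀ᶠ n in (ω : Filter I), ∃ p : ℝ × ℝ, p.1 ∈ Set.Icc 0 (ℓ n) ∧ p.2 ∈ Set.Icc 0 (ℓ' n) ∧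
      lam ≤ dist (q n p.1) (q' n p.2) ∧
      dist (q n p.1) (q' n p.2) ≤ max lam (dist (q n (ℓ n)) (q' n 0)) ∧
      ∀ r ∈ Set.Icc 0 p.1, ∀ s' ∈ Set.Icc 0 (ℓ' n),
        dist (q n p.1) (q' n p.2) ≤ dist (q n r) (q' n s') := by
    filter_upwards [h.geo, h'.geo, hfar] with n h1 h2 h3
    obtain ⟨t, ht, s, hs, h4⟩ := exists_corner h1 h2 (lam := lam)
      fun s hs => h3 _ rfl _ ⟨s, hs, rfl⟩
    exact ⟨(t, s), ht, hs, h4⟩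
  obtain ⟨p, hp⟩ := hex.choice
  have hp1 := hp.mono fun n hn => hn.1
  have hp2 := hp.mono fun n hn => hn.2.1
  obtain ⟨a, ha, hta, hca⟩ := h.exists_limGeo_eq (hd := hd) hp1
  obtain ⟨b, hb, htb, hcb⟩ := h'.exists_limGeo_eq (hd := hd) hp2
  have heq : limGeo hd e q ℓ a = limGeo hd e q' ℓ' b := by
    rw [← hca, ← hcb]
    refine conePt_eq (h.isFin hd hp1) (h'.isFin hd hp2) fun ε hε => ?_
    have hends := eventually_dist_lt_of_eq (hd := hd)
      (h.isFin hd (h.geo.mono fun _ hn => ⟨hn.1, le_rfl⟩)) h'.start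
      (by rw [← h.limGeo_len, ← h'.limGeo_zero]; exact hend) hε
    filter_upwards [hp, hends, hd.eventually_ge_atTop (lam / ε)] with n h1 h2 h3
    rw [div_le_iff₀ hε] at h3
    exact h1.2.2.2.1.trans (max_le (by linarith) h2.le)
  obtain ⟨rfl, rfl⟩ := meet a ha b hb heq
  exact ⟨fun n => (p n).1, fun n => (p n).2,
    hp.mono fun n hn => ⟨hn.1, hn.2.1, hn.2.2.1, hn.2.2.2.2⟩, hta, htb⟩

end Far

section Triangle

variable {X : Type u} [MetricSpace X] {ι : Type v} {I : Type} {ω : Ultrafilter I} {e : I → X}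
  {d : I → ℝ} {hd : Tendsto d ω atTop} {A : ι → Set X}

theorem fin3_add_two_add_one (j : Fin 3) : j + 2 + 1 = j := by
  revert j; decide

/-- Simple triangles of limit geodesics lie in a limit set. -/
theorem exists_limSet_of_triangle (hX : IsGeodesicSpace X) (h3 : Alpha3 A)
    {q : Fin 3 → I → ℝ → X} {ℓ : Fin 3 → I → ℝ} {L : Fin 3 → ℝ}
    (h : ∀ j, GeoSeq ω e d (q j) (ℓ j) (L j)) (hL : ∀ j, 0 < L j)
    (hend : ∀ j, limGeo hd e (q j) (ℓ j) (L j) = limGeo hd e (q (j + 1)) (ℓ (j + 1)) 0)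
    (hmeet : ∀ j, ∀ s ∈ Set.Icc 0 (L j), ∀ t ∈ Set.Icc 0 (L (j + 1)),
      limGeo hd e (q j) (ℓ j) s = limGeo hd e (q (j + 1)) (ℓ (j + 1)) t → t = 0) :
    ∃ i : I → ι, ∀ j, ∀ t ∈ Set.Icc 0 (L j),
      limGeo hd e (q j) (ℓ j) t ∈ limSet hd e fun n => A (i n) := by
  -- Each vertex of the triangle is replaced by a shortest connection of length at least `ν * θ`;
  -- the three truncated edges and the three connections form a hexagon.
  obtain ⟨θ, hθ, ν, hν, χ, hχ, h6⟩ := h3 6 (by norm_num)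
  choose t s' hts htL hs0 using fun j => (h j).exists_corners (h (j + 1)) (hL j) (hend j) (hmeet j)
    (ν * θ)
  -- reindex the starting times
  set s : Fin 3 → I → ℝ := fun j => s' (j + 2) with hs
  have hs's : ∀ j, s' j = s (j + 1) := by
    intro j; rw [hs]; congr 1; revert j; decide
  have hs0' : ∀ j, Tendsto (fun n => s j n / d n) ω (𝓝 0) := fun j => hs0 (j + 2)
  have hsm : ∀ j, ∀ᶠ n in (ω : Filter I), s j n ∈ Set.Icc 0 (ℓ j n) := by
    intro j
    filter_upwards [hts (j + 2)] with n hn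
    have := hn.2.1
    rwa [fin3_add_two_add_one] at this
  have htm : ∀ j, ∀ᶠ n in (ω : Filter I), t j n ∈ Set.Icc 0 (ℓ j n) := fun j =>
    (hts j).mono fun n hn => hn.1
  have hst : ∀ j, ∀ᶠ n in (ω : Filter I), s j n ≤ t j n := by
    intro j
    filter_upwards [((htL j).sub (hs0' j)).eventually_const_lt (show 0 < L j - 0 by
      simpa using hL j), eventually_scale_pos hd] with n h1 h2
    rw [← sub_div] at h1
    have := (div_pos_iff_of_pos_right h2).1 h1
    linarith
  choose C μ hC hC0 hC1 _ using fun (j : Fin 3) (n : I) =>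
    hX (q j n (t j n)) trivial (q (j + 1) n (s (j + 1) n)) trivial
  have hμ : ∀ j n, μ j n = dist (q j n (t j n)) (q (j + 1) n (s (j + 1) n)) := by
    intro j n
    rw [← hC0, ← hC1, (hC j n).dist_ends]
  have htL' : ∀ j, (conePt hd e fun n => q j n (t j n)) = limGeo hd e (q j) (ℓ j) (L j) :=
    fun j => (h j).conePt_eq_limGeo ⟨(hL j).le, le_rfl⟩ (htm j) (htL j)
  have hs0L : ∀ j, (conePt hd e fun n => q j n (s j n)) = limGeo hd e (q j) (ℓ j) 0 :=
    fun j => (h j).conePt_eq_limGeo ⟨le_rfl, (hL j).le⟩ (hsm j) (hs0' j)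
  have hsmall : ∀ j, ∀ ε > 0, ∀ᶠ n in (ω : Filter I), μ j n ≤ ε * d n := by
    intro j ε hε
    filter_upwards [eventually_dist_lt_of_eq (hd := hd) ((h j).isFin hd (htm j))
      ((h (j + 1)).isFin hd (hsm (j + 1))) (by rw [htL', hs0L, hend]) hε] with n hn
    rw [hμ]; exact hn.le
  have hCfar : ∀ j, ∀ ε > 0, ∀ᶠ n in (ω : Filter I), ∀ x ∈ C j n '' Set.Icc 0 (μ j n),
      dist x (q j n (t j n)) ≤ ε * d n := by
    intro j ε hε
    filter_upwards [hsmall j ε hε] with n hn x hx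
    obtain ⟨r, hr, rfl⟩ := hx
    rw [dist_comm, ← hC0, (hC j n).dist_zero hr.1 hr.2]
    exact hr.2.trans hn
  -- After rescaling a connection shrinks to a vertex. Since the limit triangle is simple, it is
  -- then far from the opposite edge and from the other connections.
  have hClim : ∀ j, ∀ p ∈ limSet hd e (fun n => C j n '' Set.Icc 0 (μ j n)),
      p = limGeo hd e (q j) (ℓ j) (L j) := by
    intro j p hp
    obtain ⟨x, hx, rfl, hxm⟩ := exists_of_mem_limSet hp
    rw [← htL']
    refine conePt_eq hx ((h j).isFin hd (htm j)) fun ε hε => ?_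
    filter_upwards [hxm, hCfar j ε hε] with n h1 h2 using h2 _ h1
  have hCE : ∀ j, ∀ᶠ n in (ω : Filter I), ∀ x ∈ C j n '' Set.Icc 0 (μ j n),
      ∀ y ∈ q (j + 2) n '' Set.Icc 0 (ℓ (j + 2) n), ν * θ ≤ dist x y := by
    intro j
    refine eventually_far (hd := hd) ((h j).isFin hd (htm j)) (hCfar j 1 one_pos) ?_ _
    rw [Set.disjoint_left]
    intro p hp hp'
    obtain ⟨a, ha, hpa⟩ := (h (j + 2)).exists_of_mem_limSet_image
      (Eventually.of_forall fun _ => le_rfl) (Eventually.of_forall fun _ => le_rfl) hp'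
    rw [hClim j p hp] at hpa
    have := hmeet (j + 2) a ha (L j) (by rw [fin3_add_two_add_one]; exact ⟨(hL j).le, le_rfl⟩)
      (by rw [fin3_add_two_add_one]; exact hpa.symm)
    exact (hL j).ne' this
  have hCC : ∀ j, ∀ᶠ n in (ω : Filter I), ∀ x ∈ C j n '' Set.Icc 0 (μ j n),
      ∀ y ∈ C (j + 1) n '' Set.Icc 0 (μ (j + 1) n), ν * θ ≤ dist x y := by
    intro j
    refine eventually_far (hd := hd) ((h j).isFin hd (htm j)) (hCfar j 1 one_pos) ?_ _
    rw [Set.disjoint_left]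
    intro p hp hp'
    have := (hClim j p hp).symm.trans (hClim (j + 1) p hp')
    rw [hend] at this
    exact (hL (j + 1)).ne ((h (j + 1)).isGeodesic.injOn ⟨le_rfl, (hL _).le⟩ ⟨(hL _).le, le_rfl⟩ this)
  have hnear : ∀ᶠ n in (ω : Filter I), ∃ i, ∀ j, ∀ r ∈ Set.Icc (s j n) (t j n),
      q j n r ∈ thickening χ (A i) := by
    have hall : ∀ᶠ n in (ω : Filter I), ∀ j, IsGeodesic (q j n) (ℓ j n) ∧
        s j n ∈ Set.Icc 0 (ℓ j n) ∧ t j n ∈ Set.Icc 0 (ℓ j n) ∧ s j n ≤ t j n := by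
      rw [eventually_all]
      intro j
      filter_upwards [(h j).geo, hsm j, htm j, hst j] with n h1 h2 h3 h4 using ⟨h1, h2, h3, h4⟩
    filter_upwards [hall, eventually_all.2 hts, eventually_all.2 hCE, eventually_all.2 hCC]
      with n hn hc hce hcc
    have hsE : ∀ j, ∀ r ∈ Set.Icc 0 (t j n - s j n), s j n + r ∈ Set.Icc 0 (ℓ j n) := by
      intro j r hr
      exact ⟨by linarith [(hn j).2.1.1, hr.1], by linarith [(hn j).2.2.1.2, hr.2]⟩
    let D : HexData X θ ν :=
      { E := fun j r => q j n (s j n + r)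
        m := fun j => t j n - s j n
        C := fun j => C j n
        μ := fun j => μ j n
        geoE := fun j => ((hn j).1.shift (hn j).2.1.1 (hn j).2.1.2).initial
          (by linarith [(hn j).2.2.2]) (by linarith [(hn j).2.2.1.2])
        geoC := fun j => hC j n
        endE := fun j => by rw [hC0]; congr 1; ring
        endC := fun j => by rw [hC1, add_zero]
        le_μ := fun j => by
          rw [hμ, ← hs's]; exact (hc j).2.2.1
        distEE := fun j r hr r' hr' => by
          have h4 := (hc j).2.2.2 _ ⟨(hsE j r hr).1, by linarith [hr.2]⟩ _ (hsE _ r' hr')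
          rw [hs's] at h4
          rw [hμ]
          exact h4
        distCE := fun j r hr r' hr' =>
          hce j _ ⟨r, hr, rfl⟩ _ ⟨_, hsE _ r' hr', rfl⟩
        distCC := fun j r hr r' hr' => hcc j _ ⟨r, hr, rfl⟩ _ ⟨r', hr', rfl⟩ }
    obtain ⟨i, hi⟩ := HexData.exists_near hθ hν h6 D
    refine ⟨i, fun j r hr => hi j _ ⟨r - s j n, ⟨by linarith [hr.1], ?_⟩, ?_⟩⟩
    · change r - s j n ≤ t j n - s j n
      linarith [hr.2]
    · change q j n (s j n + (r - s j n)) = _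
      congr 1; ring
  have : Nonempty ι := hnear.exists.choose_spec.nonempty
  obtain ⟨i, hi⟩ := hnear.choice
  refine ⟨i, fun j a ha => ?_⟩
  -- Clamping to the truncated edge does not change the limit, as the cut-off parts are negligible
  -- after rescaling.
  set r : I → ℝ := fun n => max (s j n) (min (t j n) (a * d n)) with hr
  have hrm : ∀ᶠ n in (ω : Filter I), r n ∈ Set.Icc (s j n) (t j n) := by
    filter_upwards [hst j] with n hn
    exact ⟨le_max_left _ _, max_le hn (min_le_left _ _)⟩
  have hrm' : ∀ᶠ n in (ω : Filter I), r n ∈ Set.Icc 0 (ℓ j n) := by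
    filter_upwards [hrm, hsm j, htm j] with n h1 h2 h3
    exact ⟨h2.1.trans h1.1, h1.2.trans h3.2⟩
  have hrt : Tendsto (fun n => r n / d n) ω (𝓝 a) := by
    have h1 : Tendsto (fun n => max (s j n / d n) (min (t j n / d n) a)) ω
        (𝓝 (max 0 (min (L j) a))) := (hs0' j).max ((htL j).min tendsto_const_nhds)
    rw [min_eq_right ha.2, max_eq_right ha.1] at h1
    refine h1.congr' ?_
    filter_upwards [eventually_scale_pos hd] with n hn
    rw [hr, ← max_div_div_right hn.le, ← min_div_div_right hn.le, mul_div_cancel_right₀ _ hn.ne']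
  rw [← (h j).conePt_eq_limGeo ha hrm' hrt]
  refine conePt_mem_limSet ((h j).isFin hd hrm') fun ε hε => ?_
  filter_upwards [hi, hrm, hd.eventually_ge_atTop (χ / ε)] with n h1 h2 h3
  obtain ⟨y, hy, hlt⟩ := mem_thickening_iff.1 (h1 j _ h2)
  rw [div_le_iff₀ hε] at h3
  exact ⟨y, hy, by linarith⟩

theorem isBoundedIndex_of_mem {i : I → ι} {p : Cone ω e d hd}
    (hp : p ∈ limSet hd e fun n => A (i n)) :
    IsBoundedIndex e d A (i : (ω : Filter I).Germ ι) := by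
  obtain ⟨x, ⟨C, hC⟩, -, hx⟩ := exists_of_mem_limSet hp
  refine ⟨C, ?_⟩
  filter_upwards [hC, hx, eventually_scale_pos hd] with n h1 h2 h3
  refine (infEDist_le_edist_of_mem h2).trans ?_
  rw [edist_dist]
  refine ENNReal.ofReal_le_ofReal ?_
  rw [div_le_iff₀ h3] at h1
  rwa [dist_comm]

theorem isGeodesic_zero {q : ℝ → X} : IsGeodesic q 0 := by
  refine ⟨le_rfl, fun s hs t ht => ?_⟩
  rw [le_antisymm hs.2 hs.1, le_antisymm ht.2 ht.1]
  simp

/-- A constant bigon is fat: no point is away from its endpoints, and the vertex condition is void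
for `k = 2`. -/
theorem Alpha3.exists_near_point (h3 : Alpha3 A) : ∃ χ > 0, ∀ x : X, ∃ i, x ∈ thickening χ (A i) := by
  obtain ⟨θ, hθ, ν, hν, χ, hχ, h⟩ := h3 2 le_rfl
  refine ⟨χ, hχ, fun x => ?_⟩
  let P : GeodesicPolygon X 2 := ⟨fun _ _ => x, fun _ => 0, fun _ => isGeodesic_zero, fun _ => rfl⟩
  have hside : ∀ i, P.side i ⊆ {x} := by
    rintro i _ ⟨r, -, rfl⟩
    rfl
  obtain ⟨i, hi⟩ := h P ⟨fun i z hz => by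
      exfalso
      refine hz.2 (mem_thickening_iff.2 ⟨x, Or.inl rfl, ?_⟩)
      rw [show z = x from hside i hz.1, dist_self]
      positivity, fun i w hw => by
      exfalso
      simp only [GeodesicPolygon.opposite, Set.mem_ofPred_eq, Set.mem_iUnion, exists_prop] at hw
      obtain ⟨j, ⟨hj, hj'⟩, -⟩ := hw
      have key : ∀ i j : Fin 2, j = i ∨ j = i - 1 := by decide
      exact (key i j).elim hj hj'⟩
  exact ⟨i, hi (Set.mem_iUnion.2 ⟨0, 0, ⟨le_rfl, le_rfl⟩, rfl⟩)⟩

/-- This collects what (α) gives directly in a cone; convexity and triangles are only available for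
limits of geodesics. -/
theorem pieceSystem_isLimGeo (hX : IsGeodesicSpace X) (h1 : Alpha1 A) (h2 : Alpha2 A)
    (h3 : Alpha3 A) :
    PieceSystem (IsLimGeo hd e) fun g : {g : (ω : Filter I).Germ ι // IsBoundedIndex e d A g} =>
      limPiece hd e A g.1 := by
  obtain ⟨M, hM⟩ := h2.exists_hitConst
  refine ⟨fun h => h.isGeodesic, exists_isLimGeo hX, fun h => h.initial, fun h => h.shift,
    fun h => h.reverse, ?_, ?_, ?_, ?_⟩
  · rintro ⟨g, hg⟩
    induction g using Germ.inductionOn with | _ i => exact isClosed_limSet _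
  · rintro g L ⟨a, ha⟩ ⟨q, ℓ, hq, hgq⟩ h0 hL t ht
    induction a using Germ.inductionOn with | _ i =>
    rw [hgq _ ⟨le_rfl, ht.1.trans ht.2⟩] at h0
    rw [hgq _ ⟨ht.1.trans ht.2, le_rfl⟩] at hL
    rw [hgq _ ht]
    exact hq.limGeo_mem_of_ends_mem hM h0 hL t ht
  · rintro ⟨a, ha⟩ ⟨b, hb⟩ hab
    induction a using Germ.inductionOn with | _ i =>
    induction b using Germ.inductionOn with | _ j =>
    refine limSet_inter_subsingleton hX h1 hM ?_
    rw [Ultrafilter.eventually_not]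
    exact fun h => hab (Subtype.ext (Germ.coe_eq.2 h))
  · rintro g₁ L₁ g₂ L₂ g₃ L₃ ⟨q₁, ℓ₁, h₁, hg₁⟩ ⟨q₂, ℓ₂, h₂, hg₂⟩ ⟨q₃, ℓ₃, h₃, hg₃⟩ p₁ p₂ p₃ e₁ e₂ e₃
      m₁ m₂ m₃
    have z₁ : (0 : ℝ) ∈ Set.Icc 0 L₁ := ⟨le_rfl, p₁.le⟩
    have z₂ : (0 : ℝ) ∈ Set.Icc 0 L₂ := ⟨le_rfl, p₂.le⟩
    have z₃ : (0 : ℝ) ∈ Set.Icc 0 L₃ := ⟨le_rfl, p₃.le⟩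
    rw [hg₁ L₁ ⟨p₁.le, le_rfl⟩, hg₂ 0 z₂] at e₁
    rw [hg₂ L₂ ⟨p₂.le, le_rfl⟩, hg₃ 0 z₃] at e₂
    rw [hg₃ L₃ ⟨p₃.le, le_rfl⟩, hg₁ 0 z₁] at e₃
    obtain ⟨i, hi⟩ := exists_limSet_of_triangle (A := A) hX h3 (q := ![q₁, q₂, q₃])
      (ℓ := ![ℓ₁, ℓ₂, ℓ₃]) (L := ![L₁, L₂, L₃]) (hd := hd) (e := e)
      (by intro j; fin_cases j; exacts [h₁, h₂, h₃])
      (by intro j; fin_cases j; exacts [p₁, p₂, p₃])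
      (by intro j; fin_cases j; exacts [e₁, e₂, e₃])
      (by
        intro j
        fin_cases j
        · intro s hs t ht h
          exact m₁ s hs t ht (by rw [hg₁ s hs, hg₂ t ht]; exact h)
        · intro s hs t ht h
          exact m₂ s hs t ht (by rw [hg₂ s hs, hg₃ t ht]; exact h)
        · intro s hs t ht h
          exact m₃ s hs t ht (by rw [hg₃ s hs, hg₁ t ht]; exact h))
    refine ⟨⟨(i : (ω : Filter I).Germ ι), isBoundedIndex_of_mem (hi 0 0 z₁)⟩,
      fun t ht => ?_, fun t ht => ?_, fun t ht => ?_⟩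
    · rw [hg₁ t ht]; exact hi 0 t ht
    · rw [hg₂ t ht]; exact hi 1 t ht
    · rw [hg₃ t ht]; exact hi 2 t ht

theorem exists_piece_point (h3 : Alpha3 A) (p : Cone ω e d hd) :
    ∃ g : {g : (ω : Filter I).Germ ι // IsBoundedIndex e d A g}, p ∈ limPiece hd e A g.1 := by
  obtain ⟨χ, hχ, h⟩ := h3.exists_near_point
  obtain ⟨x, hx, rfl⟩ := exists_conePt p
  choose i hi using fun n => h (x n)
  have hp : conePt hd e x ∈ limSet hd e fun n => A (i n) := by
    refine conePt_mem_limSet hx fun ε hε => ?_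
    filter_upwards [hd.eventually_ge_atTop (χ / ε)] with n hn
    obtain ⟨y, hy, hlt⟩ := mem_thickening_iff.1 (hi n)
    rw [div_le_iff₀ hε] at hn
    exact ⟨y, hy, by linarith⟩
  exact ⟨⟨(i : (ω : Filter I).Germ ι), isBoundedIndex_of_mem hp⟩, hp⟩

end Triangle

/-! ### Conditions (α) imply that the cones are tree-graded. -/

section Sufficiency

theorem GeodesicPolygon.isSimpleTri {F : Type*} [MetricSpace F] {T : GeodesicPolygon F 3}
    (hT : T.IsSimpleTriangle) (hpos : ∀ i, 0 < T.len i) :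
    IsSimpleTri (T.edge 0) (T.len 0) (T.edge 1) (T.len 1) (T.edge 2) (T.len 2) := by
  have meet : ∀ i, ∀ s ∈ Set.Icc 0 (T.len i), ∀ t ∈ Set.Icc 0 (T.len (i + 1)),
      T.edge i s = T.edge (i + 1) t → t = 0 := by
    intro i s hs t ht hst
    have h0 : T.edge (i + 1) t = T.edge (i + 1) 0 := hT i ⟨⟨s, hs, hst⟩, ⟨t, ht, rfl⟩⟩
    exact (T.isGeodesic _).injOn ht ⟨le_rfl, (hpos _).le⟩ h0
  exact ⟨T.isGeodesic 0, T.isGeodesic 1, T.isGeodesic 2, hpos 0, hpos 1, hpos 2, T.closes 0,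
    T.closes 1, T.closes 2, meet 0, meet 1, meet 2⟩

/-- If one edge is constant, its point lies on both remaining edges, which meet only in their common
vertex; so all vertices coincide. -/
theorem GeodesicPolygon.carrier_subset_of_len_eq_zero {F : Type*} [MetricSpace F]
    {T : GeodesicPolygon F 3} (hT : T.IsSimpleTriangle) {i : ZMod 3} (hi : T.len i = 0) :
    T.carrier ⊆ {T.vertex i} := by
  have hv : ∀ j, T.vertex (j + 1) = T.edge j (T.len j) := fun j => (T.closes j).symm
  have h0 : ∀ j, T.vertex j ∈ T.side j := fun j => ⟨0, ⟨le_rfl, (T.isGeodesic j).1⟩, rfl⟩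
  have h1 : ∀ j, T.vertex (j + 1) ∈ T.side j := fun j =>
    ⟨_, ⟨(T.isGeodesic j).1, le_rfl⟩, (hv j).symm⟩
  have hdeg : ∀ j, T.vertex (j + 1) = T.vertex j → T.side j ⊆ {T.vertex j} := by
    rintro j hj _ ⟨r, hr, rfl⟩
    have : T.len j = 0 := by
      rw [← (T.isGeodesic j).dist_ends, ← hv, hj]
      exact dist_self _
    rw [this] at hr
    rw [le_antisymm hr.2 hr.1]
    rfl
  have e0 : T.vertex (i + 1) = T.vertex i := by
    rw [hv, hi]; rfl
  have hmod : i + 1 + 1 + 1 = i :=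
    (show ∀ i : Fin 3, i + 1 + 1 + 1 = i by decide) i
  have e2 : T.vertex (i + 1 + 1) = T.vertex (i + 1) := by
    have := @hT (i + 1) (T.vertex (i + 1)) ⟨h0 _, by
      rw [e0]
      have := h1 (i + 1 + 1)
      rwa [hmod] at this⟩
    exact this.symm
  have hs0 := hdeg i e0
  have hs1 := hdeg (i + 1) e2
  have hs2 := hdeg (i + 1 + 1) (by rw [hmod, e2, e0])
  rw [e2, e0] at hs2
  rw [e0] at hs1
  intro x hx
  obtain ⟨j, hj⟩ := Set.mem_iUnion.1 hx
  have : j = i ∨ j = i + 1 ∨ j = i + 1 + 1 :=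
    (show ∀ i j : Fin 3, j = i ∨ j = i + 1 ∨ j = i + 1 + 1 by decide) i j
  rcases this with rfl | rfl | rfl
  exacts [hs0 hj, hs1 hj, hs2 hj]

theorem isAsymptoticallyTreeGraded_of_alpha {X : Type u} [MetricSpace X] {ι : Type v}
    (hX : IsGeodesicSpace X) {A : ι → Set X} (h1 : Alpha1 A) (h2 : Alpha2 A) (h3 : Alpha3 A) :
    IsAsymptoticallyTreeGraded A := by
  intro I _ ω hω e d hd
  have H := pieceSystem_isLimGeo (hd := hd) (e := e) hX h1 h2 h3
  refine ⟨cone_complete hω, isGeodesicSpace_cone hX, H.closed, ?_, H.inter, ?_⟩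
  · intro a x hx y hy
    obtain ⟨g, L, hg, rfl, rfl⟩ := exists_isLimGeo hX x y
    refine ⟨g, L, hg.isGeodesic, rfl, rfl, ?_⟩
    rintro _ ⟨t, ht, rfl⟩
    exact H.convex hg hx hy t ht
  · intro T hT
    by_cases hpos : ∀ i, 0 < T.len i
    · obtain ⟨a, ha⟩ := H.exists_piece_of_isSimpleTri (GeodesicPolygon.isSimpleTri hT hpos)
      refine ⟨a, fun x hx => ha ?_⟩
      obtain ⟨j, hj⟩ := Set.mem_iUnion.1 hx
      change Fin 3 at j
      fin_cases j
      exacts [Or.inl (Or.inl hj), Or.inl (Or.inr hj), Or.inr hj]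
    · push Not at hpos
      obtain ⟨i, hi⟩ := hpos
      obtain ⟨a, ha⟩ := exists_piece_point (A := A) h3 (T.vertex i)
      refine ⟨a, (GeodesicPolygon.carrier_subset_of_len_eq_zero hT
        (le_antisymm hi (T.isGeodesic i).1)).trans (Set.singleton_subset_iff.2 ha)⟩

end Sufficiency

end TreeGraded

namespace TreeGraded

/-! ### Necessity: contradiction sequences -/

section Sequences

variable {X : Type u} [MetricSpace X] {ι : Type v} {A : ι → Set X}

theorem tendsto_hyperfilter_atTop {s : ℕ → ℝ} (h : ∀ n : ℕ, (n : ℝ) ≤ s n) :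
    Tendsto s (hyperfilter ℕ : Filter ℕ) atTop :=
  (tendsto_atTop_mono h tendsto_natCast_atTop_atTop).mono_left
    (by rw [← Nat.cofinite_eq_atTop]; exact hyperfilter_le_cofinite)

theorem eventually_inv_le {ε : ℝ} (hε : 0 < ε) :
    ∀ᶠ n : ℕ in (hyperfilter ℕ : Filter ℕ), 1 / ((n : ℝ) + 1) ≤ ε := by
  have h := tendsto_one_div_add_atTop_nhds_zero_nat (𝕜 := ℝ)
  have h' : (hyperfilter ℕ : Filter ℕ) ≤ atTop := by
    rw [← Nat.cofinite_eq_atTop]; exact hyperfilter_le_cofinite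
  exact (((h.mono_left h').eventually_lt_const hε)).mono fun n hn => hn.le

theorem IsAsymptoticallyTreeGraded.isTreeGraded (hA : IsAsymptoticallyTreeGraded A) {d : ℕ → ℝ}
    (hd : Tendsto d (hyperfilter ℕ : Filter ℕ) atTop) (e : ℕ → X) :
    IsTreeGraded fun g : {g : (hyperfilter ℕ : Filter ℕ).Germ ι // IsBoundedIndex e d A g} =>
      limPiece hd e A g.1 :=
  hA ℕ (hyperfilter ℕ) hyperfilter_le_cofinite e d hd

theorem IsAsymptoticallyTreeGraded.pieceSystem (hA : IsAsymptoticallyTreeGraded A) {d : ℕ → ℝ}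
    (hd : Tendsto d (hyperfilter ℕ : Filter ℕ) atTop) (e : ℕ → X) :
    PieceSystem IsGeodesic
      fun g : {g : (hyperfilter ℕ : Filter ℕ).Germ ι // IsBoundedIndex e d A g} =>
        limPiece hd e A g.1 :=
  (hA.isTreeGraded hd e).pieceSystem

variable {I : Type} {ω : Ultrafilter I} {e : I → X} {d : I → ℝ} {hd : Tendsto d ω atTop}

/-- The index of the piece `lim^ω A (i n)`. -/
def pieceIdx {i : I → ι} {p : Cone ω e d hd} (hp : p ∈ limSet hd e fun n => A (i n)) :
    {g : (ω : Filter I).Germ ι // IsBoundedIndex e d A g} :=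
  ⟨(i : (ω : Filter I).Germ ι), isBoundedIndex_of_mem hp⟩

theorem pieceIdx_ne {i j : I → ι} {p p' : Cone ω e d hd}
    (hp : p ∈ limSet hd e fun n => A (i n)) (hp' : p' ∈ limSet hd e fun n => A (j n))
    (hij : ∀ᶠ n in (ω : Filter I), i n ≠ j n) : pieceIdx hp ≠ pieceIdx hp' := by
  intro h
  have h1 : ((i : (ω : Filter I).Germ ι)) = j := congrArg Subtype.val h
  obtain ⟨n, h2, h3⟩ := (hij.and (Germ.coe_eq.1 h1)).exists
  exact h2 h3

theorem exists_pieceIdx_eq (a : {g : (ω : Filter I).Germ ι // IsBoundedIndex e d A g}) :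
    ∃ i : I → ι, limPiece hd e A a.1 = limSet hd e fun n => A (i n) := by
  obtain ⟨g, hg⟩ := a
  induction g using Germ.inductionOn with | _ i => exact ⟨i, rfl⟩

theorem exists_geoSeq (hd : Tendsto d ω atTop) {q : I → ℝ → X} {ℓ : I → ℝ} {C : ℝ}
    (hq : ∀ᶠ n in (ω : Filter I), IsGeodesic (q n) (ℓ n)) (h0 : IsFin ω e d fun n => q n 0)
    (hC : ∀ᶠ n in (ω : Filter I), ℓ n ≤ C * d n) : ∃ L ∈ Set.Icc 0 C, GeoSeq ω e d q ℓ L := by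
  obtain ⟨L, hL, hlim⟩ := exists_tendsto_of_eventually_mem_Icc (ω := ω) (f := fun n => ℓ n / d n)
    (a := 0) (b := C) (by
      filter_upwards [hq, hC, eventually_scale_pos hd] with n h1 h2 h3
      exact ⟨div_nonneg h1.1 h3.le, (div_le_iff₀ h3).2 h2⟩)
  exact ⟨L, hL, hq, h0, hlim⟩

theorem conePt_mem_limSet_of_dist_le {x : I → X} {S : I → Set X} (hx : IsFin ω e d x) {c : ℝ}
    (h : ∀ᶠ n in (ω : Filter I), ∃ y ∈ S n, dist (x n) y ≤ c) : conePt hd e x ∈ limSet hd e S := by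
  refine conePt_mem_limSet hx fun ε hε => ?_
  filter_upwards [h, hd.eventually_ge_atTop (c / ε)] with n ⟨y, hy, hyc⟩ hn
  rw [div_le_iff₀ hε] at hn
  exact ⟨y, hy, by linarith⟩

end Sequences

/-! ### Asymptotically tree-graded implies (α₁) and (α₂). -/

section Necessity

variable {X : Type u} [MetricSpace X] {ι : Type v} {A : ι → Set X}

/-- Pairs of points at distances `dist (x n) (y n) ≥ n`, rescaled by these distances, give two
points at distance `1` common to two different pieces. -/
theorem IsAsymptoticallyTreeGraded.alpha1 (hA : IsAsymptoticallyTreeGraded A) : Alpha1 A := by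
  intro δ hδ
  by_contra! hcon
  choose i j hij x hx y hy hxy using fun n : ℕ => hcon n
  have hd := tendsto_hyperfilter_atTop fun n => (hxy n).le
  have H := hA.pieceSystem hd x
  have hxF : IsFin (hyperfilter ℕ) x (fun n => dist (x n) (y n)) x := isFin_base x
  have hyF : IsFin (hyperfilter ℕ) x (fun n => dist (x n) (y n)) y :=
    hxF.of_dist_le hd (C := 1) (Eventually.of_forall fun n => by rw [one_mul, dist_comm])
  have near : ∀ {z : X} {k : ι}, z ∈ thickening δ (A k) → ∃ w ∈ A k, dist z w ≤ δ := by
    intro z k hz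
    obtain ⟨w, hw, hlt⟩ := mem_thickening_iff.1 hz
    exact ⟨w, hw, hlt.le⟩
  have hxi := conePt_mem_limSet_of_dist_le (hd := hd) (S := fun n => A (i n)) hxF
    (Eventually.of_forall fun n => near (hx n).1)
  have hxj := conePt_mem_limSet_of_dist_le (hd := hd) (S := fun n => A (j n)) hxF
    (Eventually.of_forall fun n => near (hx n).2)
  have hyi := conePt_mem_limSet_of_dist_le (hd := hd) (S := fun n => A (i n)) hyF
    (Eventually.of_forall fun n => near (hy n).1)
  have hyj := conePt_mem_limSet_of_dist_le (hd := hd) (S := fun n => A (j n)) hyF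
    (Eventually.of_forall fun n => near (hy n).2)
  have heq := H.inter (pieceIdx hxi) (pieceIdx hxj)
    (pieceIdx_ne hxi hxj (Eventually.of_forall hij)) ⟨hxi, hxj⟩ ⟨hyi, hyj⟩
  have h1 : 1 ≤ dist (conePt hd x x) (conePt hd x y) :=
    le_dist_conePt hxF hyF (Eventually.of_forall fun n => by rw [one_mul])
  rw [heq, dist_self] at h1
  linarith

/-- A constant triangle is simple, so the base point of any cone lies in a piece; points ever
farther from the whole family would contradict this. -/
theorem IsAsymptoticallyTreeGraded.exists_near_point (hA : IsAsymptoticallyTreeGraded A) :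
    ∃ χ > 0, ∀ x : X, ∃ i, ∃ y ∈ A i, dist x y < χ := by
  by_contra! hcon
  choose x hx using fun n : ℕ => hcon (n + 1) (by positivity)
  have hd : Tendsto (fun n : ℕ => (n : ℝ) + 1) (hyperfilter ℕ : Filter ℕ) atTop :=
    tendsto_hyperfilter_atTop fun n => by linarith
  have hF : IsFin (hyperfilter ℕ) x (fun n : ℕ => (n : ℝ) + 1) x := isFin_base x
  obtain ⟨a, ha⟩ := (hA.isTreeGraded hd x).triangle_subset
    ⟨fun _ _ => conePt hd x x, fun _ => 0, fun _ => isGeodesic_zero, fun _ => rfl⟩ (by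
      rintro i _ ⟨⟨r, -, rfl⟩, -⟩
      rfl)
  obtain ⟨i, hi⟩ := exists_pieceIdx_eq (hd := hd) a
  have hmem : conePt hd x x ∈ limSet hd x fun n => A (i n) := by
    rw [← hi]
    exact ha (Set.mem_iUnion.2 ⟨0, 0, ⟨le_rfl, le_rfl⟩, rfl⟩)
  obtain ⟨n, y, hy, hlt⟩ := (eventually_of_mem_limSet hF hmem (ε := 1) one_pos).exists
  linarith [hx n (i n) y hy]

/-- In a tree-graded space, a geodesic of length `1` with endpoints at distance at most `θ < 1/2`
from a piece has two close points in that piece. -/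
theorem PieceSystem.exists_two_hits {F κ : Type*} [MetricSpace F] {P : κ → Set F}
    (H : PieceSystem IsGeodesic P) {g : ℝ → F} (hg : IsGeodesic g 1) {θ : ℝ} (hθ : θ < 1 / 2)
    {a : κ} {c c' : F} (hc : c ∈ P a) (hc' : c' ∈ P a) (h0 : dist (g 0) c ≤ θ)
    (h1 : dist (g 1) c' ≤ θ) :
    ∃ s t, 0 ≤ s ∧ s < t ∧ t ≤ 1 ∧ t - s ≤ 1 / 3 ∧ g s ∈ P a ∧ g t ∈ P a := by
  by_cases hmeet : ∃ t ∈ Set.Icc (0 : ℝ) 1, g t ∈ P a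
  · obtain ⟨t, ht, hta⟩ := hmeet
    obtain ⟨r, hr, hra, hfirst⟩ := hg.exists_first (H.closed a) le_rfl le_rfl ht hta
    obtain ⟨r', hr', hra', hlast⟩ := hg.exists_last (H.closed a) le_rfl le_rfl ht hta
    rcases (hfirst r' hr' hra').eq_or_lt with heq | hlt
    -- A single meeting time `r` is impossible: `g r` is the nearest point of the piece for both
    -- ends, so `r ≤ θ` and `1 - r ≤ θ`.
    · exfalso
      subst heq
      have hb : 1 - r ≤ dist (g 1) c' := by
        have := H.gate_dist_le (σ := fun x => g (r + x)) (ℓ := 1 - r) (H.shift hg hr.1 hr.2)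
          (by simpa using hra) (fun x hx hxa => by
            linarith [hlast (r + x) ⟨by linarith [hx.1, hr.1], by linarith [hx.2]⟩ hxa, hx.1]) hc'
        simpa using this
      have hf : r ≤ dist (g 0) c := by
        have := H.gate_dist_le (σ := fun x => g (r - x)) (ℓ := r) (H.reverse (H.initial hg hr.1 hr.2))
          (by simpa using hra) (fun x hx hxa => by
            linarith [hfirst (r - x) ⟨by linarith [hx.2], by linarith [hx.1, hr.2]⟩ hxa, hx.1]) hc
        simpa using this
      linarith
    · refine ⟨r, min r' (r + 1 / 3), hr.1, lt_min hlt (by linarith), (min_le_left _ _).trans hr'.2,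
        by linarith [min_le_right r' (r + 1 / 3)], hra, ?_⟩
      have := H.convex (a := a) (H.initial (H.shift hg hr.1 hr.2) (s := r' - r) (by linarith)
        (by linarith [hr'.2])) (by simpa using hra) (by simpa using hra') (min r' (r + 1 / 3) - r)
        ⟨by linarith [lt_min hlt (by linarith : r < r + 1 / 3)],
          by linarith [min_le_left r' (r + 1 / 3)]⟩
      simpa using this
  -- If `g` misses the piece, both ends have the same nearest point in it, and their distance is at
  -- most `2 * θ < 1`.
  · exfalso
    push Not at hmeet
    obtain ⟨σ, ℓ, hσ, hσ0, hσℓ, hout, hle⟩ := H.exists_gate (g 0) hc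
    obtain ⟨σ', ℓ', hσ', hσ0', hσℓ', hout', hle'⟩ := H.exists_gate (g 1) hc'
    have := H.gate_eq hσ hσ0 hout hσ' hσ0' hout' hg hσℓ.symm hσℓ'.symm hmeet
    have h2 := hg.dist_ends
    have h3 := dist_triangle_left (g 0) (g 1) (σ 0)
    rw [← hσℓ, hσ.dist_ends] at h3
    rw [hσℓ, this, ← hσℓ', hσ'.dist_ends, hσℓ'] at h3
    linarith

/-- The halving step for (α₂): the two points found in the limit piece are strictly apart, so in `X`
their distances to `A i` are below `θ` times the length of the subgeodesic, and the hypothesis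
reproduces itself. -/
theorem IsAsymptoticallyTreeGraded.exists_subgeodesic (hA : IsAsymptoticallyTreeGraded A) {θ : ℝ}
    (hθ0 : 0 < θ) (hθ : θ < 1 / 2) :
    ∃ L > 0, ∀ (q : ℝ → X) (ℓ : ℝ) (i : ι), IsGeodesic q ℓ → L ≤ ℓ →
      (∃ y ∈ A i, dist (q 0) y < θ * ℓ) → (∃ y ∈ A i, dist (q ℓ) y < θ * ℓ) →
      ∃ s t, 0 ≤ s ∧ s ≤ t ∧ t ≤ ℓ ∧ t - s ≤ ℓ / 2 ∧
        (∃ y ∈ A i, dist (q s) y < θ * (t - s)) ∧ ∃ y ∈ A i, dist (q t) y < θ * (t - s) := by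
  by_contra! hcon
  choose q ℓ i hq hℓ hq0 hq1 hno using fun n : ℕ => hcon (n + 1) (by positivity)
  choose y hy hy0 using hq0
  choose y' hy' hy1 using hq1
  have hd := tendsto_hyperfilter_atTop fun n => (by linarith [hℓ n] : (n : ℝ) ≤ ℓ n)
  have hG : GeoSeq (hyperfilter ℕ) (fun n => q n 0) ℓ q ℓ 1 := by
    refine ⟨Eventually.of_forall hq, isFin_base _, tendsto_const_nhds.congr' ?_⟩
    filter_upwards [eventually_scale_pos hd] with n hn
    rw [div_self hn.ne']
  have hend : IsFin (hyperfilter ℕ) (fun n => q n 0) ℓ fun n => q n (ℓ n) :=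
    hG.isFin hd (Eventually.of_forall fun n => ⟨(hq n).1, le_rfl⟩)
  have hyF : IsFin (hyperfilter ℕ) (fun n => q n 0) ℓ y := hG.start.of_dist_le hd (C := θ)
    (Eventually.of_forall fun n => by rw [dist_comm]; exact (hy0 n).le)
  have hyF' : IsFin (hyperfilter ℕ) (fun n => q n 0) ℓ y' := hend.of_dist_le hd (C := θ)
    (Eventually.of_forall fun n => by rw [dist_comm]; exact (hy1 n).le)
  have hc := conePt_mem_limSet_of_mem (hd := hd) (S := fun n => A (i n)) hyF
    (Eventually.of_forall hy)
  have hc' := conePt_mem_limSet_of_mem (hd := hd) (S := fun n => A (i n)) hyF'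
    (Eventually.of_forall hy')
  obtain ⟨s, t, hs, hst, ht, hts, hsm, htm⟩ := (hA.pieceSystem hd fun n => q n 0).exists_two_hits
    (hG.isGeodesic (hd := hd)) hθ (a := pieceIdx hc) hc hc'
    (by
      rw [hG.limGeo_zero]
      exact dist_conePt_le hG.start hyF (Eventually.of_forall fun n => (hy0 n).le))
    (by
      rw [hG.limGeo_len]
      exact dist_conePt_le hend hyF' (Eventually.of_forall fun n => (hy1 n).le))
  have hpos := eventually_scale_pos hd
  have hle : ∀ {r : ℝ}, r ≤ 1 → ∀ᶠ n in (hyperfilter ℕ : Filter ℕ), r * ℓ n ≤ ℓ n := fun hr =>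
    hpos.mono fun n hn => by nlinarith
  have hmem : ∀ {r : ℝ}, 0 ≤ r → r ≤ 1 → limGeo hd (fun n => q n 0) q ℓ r ∈
      limSet hd (fun n => q n 0) (fun n => A (i n)) → ∀ᶠ n in (hyperfilter ℕ : Filter ℕ),
        ∃ w ∈ A (i n), dist (q n (r * ℓ n)) w < θ * (t - s) * ℓ n := by
    intro r hr hr1 hrm
    rw [hG.limGeo_eq ⟨hr, hr1⟩ (hle hr1)] at hrm
    refine eventually_of_mem_limSet (hG.isFin hd ?_) hrm (mul_pos hθ0 (by linarith))
    filter_upwards [hpos, hle hr1] with n h1 h2 using ⟨by positivity, h2⟩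
  obtain ⟨n, h1, h2, h3⟩ := (hpos.and ((hmem hs (by linarith) hsm).and
    (hmem (by linarith) ht htm))).exists
  obtain ⟨w, hw, hlt⟩ := h2
  obtain ⟨w', hw', hlt'⟩ := h3
  have := hno n (s * ℓ n) (t * ℓ n) (by positivity) (by nlinarith) (by nlinarith) (by nlinarith)
    ⟨w, hw, by linarith⟩ w' hw'
  linarith

theorem IsAsymptoticallyTreeGraded.alpha2 (hA : IsAsymptoticallyTreeGraded A) : Alpha2 A := by
  intro θ hθ0 hθ
  rcases hθ0.eq_or_lt with rfl | hθ0
  -- For `θ = 0` the thickening of radius `0` is empty.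
  · refine ⟨1, one_pos, fun q ℓ _ i h0 => ?_⟩
    rw [zero_mul, thickening_of_nonpos le_rfl] at h0
    exact absurd h0 (Set.notMem_empty _)
  obtain ⟨L, hL, hsub⟩ := hA.exists_subgeodesic hθ0 hθ
  -- Halving is repeated until the length is at most `L`; then the starting point itself is within
  -- `θ * L`.
  have key : ∀ n : ℕ, ∀ (q : ℝ → X) (ℓ : ℝ) (i : ι), IsGeodesic q ℓ → ℓ ≤ 2 ^ n * L →
      (∃ y ∈ A i, dist (q 0) y < θ * ℓ) → (∃ y ∈ A i, dist (q ℓ) y < θ * ℓ) →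
      ∃ t ∈ Set.Icc 0 ℓ, ∃ y ∈ A i, dist (q t) y < θ * L := by
    intro n
    induction n with
    | zero =>
      intro q ℓ i hq hℓ h0 _
      obtain ⟨y, hy, hlt⟩ := h0
      rw [pow_zero, one_mul] at hℓ
      exact ⟨0, ⟨le_rfl, hq.1⟩, y, hy, hlt.trans_le (by nlinarith)⟩
    | succ n ih =>
      intro q ℓ i hq hℓ h0 h1
      rcases le_total ℓ L with h | h
      · obtain ⟨y, hy, hlt⟩ := h0
        exact ⟨0, ⟨le_rfl, hq.1⟩, y, hy, hlt.trans_le (by nlinarith)⟩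
      obtain ⟨s, t, hs, hst, ht, hts, h0', h1'⟩ := hsub q ℓ i hq h h0 h1
      rw [pow_succ] at hℓ
      obtain ⟨r, hr, hrA⟩ := ih (fun r => q (s + r)) (t - s) i
        ((hq.shift hs (hst.trans ht)).initial (by linarith) (by linarith)) (by linarith)
        (by simpa using h0') (by simpa using h1')
      exact ⟨s + r, ⟨by linarith [hr.1], by linarith [hr.2]⟩, hrA⟩
  refine ⟨θ * L, by positivity, fun q ℓ hq i h0 h1 => ?_⟩
  obtain ⟨n, hn⟩ := pow_unbounded_of_one_lt (ℓ / L) (one_lt_two)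
  rw [div_lt_iff₀ hL] at hn
  obtain ⟨t, ht, hy⟩ := key n q ℓ i hq hn.le (mem_thickening_iff.1 h0) (mem_thickening_iff.1 h1)
  exact ⟨q t, ⟨t, ht, rfl⟩, mem_thickening_iff.2 hy⟩

end Necessity

end TreeGraded

namespace TreeGraded

/-! ### Geodesics leaving a set of the family -/

section Bridge

variable {F : Type*} [MetricSpace F] {κ : Type*} {𝒢 : (ℝ → F) → ℝ → Prop} {P : κ → Set F}

/-- The endpoints are joined inside `P b` by some `e`. If `e` avoids `P a`, the exit points agree.
Otherwise `e` passes through both of them on its way to `P a`, so both are in `P a ∩ P b`. -/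
theorem PieceSystem.bridge_start_eq (H : PieceSystem 𝒢 P) {a b : κ} (hab : a ≠ b) {g τ : ℝ → F}
    {S T : ℝ} (hg : 𝒢 g S) (hg0 : g 0 ∈ P a) (hga : ∀ t ∈ Set.Ioc 0 S, g t ∉ P a)
    (hgb : g S ∈ P b) (hτ : 𝒢 τ T) (hτ0 : τ 0 ∈ P a) (hτa : ∀ t ∈ Set.Ioc 0 T, τ t ∉ P a)
    (hτb : τ T ∈ P b) : g 0 = τ 0 := by
  obtain ⟨e, m, he, he0, hem⟩ := H.exists_join (g S) (τ T)
  have heb := H.convex he (by rwa [he0]) (by rwa [hem])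
  by_cases hav : ∀ t ∈ Set.Icc 0 m, e t ∉ P a
  · exact H.gate_eq hg hg0 hga hτ hτ0 hτa he he0 hem hav
  push Not at hav
  obtain ⟨c, hc, hca⟩ := hav
  obtain ⟨t, ht, hte⟩ := H.gate_mem hg hg0 hga (H.initial he hc.1 hc.2) he0 hca
  obtain ⟨t', ht', hte'⟩ := H.gate_mem hτ hτ0 hτa
    (H.initial (H.reverse he) (s := m - c) (by linarith [hc.2]) (by linarith [hc.1]))
    (by rw [sub_zero, hem]) (by rw [sub_sub_cancel]; exact hca)
  have h1 := heb t ⟨ht.1, ht.2.trans hc.2⟩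
  have h2 := heb (m - t') ⟨by linarith [ht'.2, hc.1], by linarith [ht'.1]⟩
  rw [hte] at h1
  rw [hte'] at h2
  exact H.inter a b hab ⟨hg0, h1⟩ ⟨hτ0, h2⟩

/-- Two geodesics that leave one piece and then enter another one start and end at the same
points. -/
theorem PieceSystem.bridge_eq (H : PieceSystem 𝒢 P) {a b : κ} (hab : a ≠ b) {g τ : ℝ → F}
    {S T : ℝ} (hg : 𝒢 g S) (hg0 : g 0 ∈ P a) (hga : ∀ t ∈ Set.Ioc 0 S, g t ∉ P a)
    (hgS : g S ∈ P b) (hgb : ∀ t ∈ Set.Ico 0 S, g t ∉ P b) (hτ : 𝒢 τ T) (hτ0 : τ 0 ∈ P a)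
    (hτa : ∀ t ∈ Set.Ioc 0 T, τ t ∉ P a) (hτT : τ T ∈ P b) (hτb : ∀ t ∈ Set.Ico 0 T, τ t ∉ P b) :
    g 0 = τ 0 ∧ g S = τ T := by
  refine ⟨H.bridge_start_eq hab hg hg0 hga hgS hτ hτ0 hτa hτT, ?_⟩
  have := H.bridge_start_eq hab.symm (H.reverse hg) (by simpa using hgS)
    (fun t ht => hgb _ ⟨by linarith [ht.2], by linarith [ht.1]⟩) (by simpa using hg0)
    (H.reverse hτ) (by simpa using hτT)
    (fun t ht => hτb _ ⟨by linarith [ht.2], by linarith [ht.1]⟩) (by simpa using hτ0)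
  simpa using this

end Bridge

section Leaves

variable {X : Type u} [MetricSpace X] {ι : Type v} {A : ι → Set X} {M : ℝ}

/-- The geodesic `g` of length `S` starts at distance at most `h` from `A i` and is outside of the
`M`-neighbourhood of `A i` after time `h`. -/
structure Leaves (A : ι → Set X) (M : ℝ) (i : ι) (g : ℝ → X) (S h : ℝ) : Prop where
  geo : IsGeodesic g S
  start : ∃ y ∈ A i, dist (g 0) y ≤ h
  miss : ∀ t ∈ Set.Icc h S, ∀ y ∈ A i, M ≤ dist (g t) y

theorem Leaves.mono {i : ι} {g : ℝ → X} {S h S' h' : ℝ} (H : Leaves A M i g S h) (hS0 : 0 ≤ S')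
    (hS : S' ≤ S) (hh : h ≤ h') : Leaves A M i g S' h' := by
  obtain ⟨y, hy, hle⟩ := H.start
  exact ⟨H.geo.initial hS0 hS, ⟨y, hy, hle.trans hh⟩,
    fun t ht => H.miss t ⟨hh.trans ht.1, ht.2.trans hS⟩⟩

variable {I : Type} {ω : Ultrafilter I} {e : I → X} {d : I → ℝ} {hd : Tendsto d ω atTop}
  {q : I → ℝ → X} {ℓ : I → ℝ} {L : ℝ} {i : I → ι}

theorem GeoSeq.lt_clamp (hq : GeoSeq ω e d q ℓ L) (hd : Tendsto d ω atTop) {a c : ℝ} (hca : c < a)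
    (ha : a ∈ Set.Icc 0 L) :
    ∀ᶠ n in (ω : Filter I), c * d n < max 0 (min (a * d n) (ℓ n)) := by
  filter_upwards [(hq.tendsto_clamp hd ha).eventually_const_lt hca, eventually_scale_pos hd]
    with n h1 h2
  rwa [lt_div_iff₀ h2] at h1

theorem GeoSeq.clamp_lt (hq : GeoSeq ω e d q ℓ L) (hd : Tendsto d ω atTop) {a c : ℝ} (hac : a < c)
    (ha : a ∈ Set.Icc 0 L) :
    ∀ᶠ n in (ω : Filter I), max 0 (min (a * d n) (ℓ n)) < c * d n := by
  filter_upwards [(hq.tendsto_clamp hd ha).eventually_lt_const hac, eventually_scale_pos hd]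
    with n h1 h2
  rwa [div_lt_iff₀ h2] at h1

theorem start_mem_limSet (hq : GeoSeq ω e d q ℓ L) {η : I → ℝ}
    (hL : ∀ᶠ n in (ω : Filter I), Leaves A M (i n) (q n) (ℓ n) (η n))
    (hη : ∀ ε > 0, ∀ᶠ n in (ω : Filter I), η n ≤ ε * d n) :
    limGeo hd e q ℓ 0 ∈ limSet hd e fun n => A (i n) := by
  rw [hq.limGeo_zero]
  refine conePt_mem_limSet hq.start fun ε hε => ?_
  filter_upwards [hL, hη ε hε] with n h1 h2
  obtain ⟨y, hy, hle⟩ := h1.start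
  exact ⟨y, hy, hle.trans h2⟩

/-- A later return would by convexity put the segment up to it into the limit piece. Then the
geodesics would visit `A (i n)` on the second half of that segment, after the time when they are
assumed to stay away. -/
theorem notMem_limSet_of_leaves {κ : Type*} {P : κ → Set (Cone ω e d hd)}
    (H : PieceSystem IsGeodesic P) {a : κ} (ha : P a = limSet hd e fun n => A (i n))
    (hM : HitConst A M) (hq : GeoSeq ω e d q ℓ L) {η : I → ℝ}
    (hL : ∀ᶠ n in (ω : Filter I), Leaves A M (i n) (q n) (ℓ n) (η n))
    (hη : ∀ ε > 0, ∀ᶠ n in (ω : Filter I), η n ≤ ε * d n) :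
    ∀ t ∈ Set.Ioc 0 L, limGeo hd e q ℓ t ∉ P a := by
  intro t ht htm
  have h0 : limGeo hd e q ℓ 0 ∈ P a := by rw [ha]; exact start_mem_limSet hq hL hη
  have h1 := H.convex (H.initial hq.isGeodesic ht.1.le ht.2) h0 htm (t / 2)
    ⟨by linarith [ht.1], by linarith [ht.1]⟩
  rw [ha] at h1 htm
  have ht2 : t / 2 ∈ Set.Icc 0 L := ⟨by linarith [ht.1], by linarith [ht.1, ht.2]⟩
  obtain ⟨n, ⟨r, hr, y, hy, hlt⟩, h2, h3, h4, h5⟩ :=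
    ((hq.eventually_hit hM ht2.1 (by linarith [ht.1]) ht.2 h1 htm).and (hL.and
      ((hη (t / 4) (by linarith [ht.1])).and ((hq.lt_clamp hd (c := t / 4)
        (by linarith [ht.1]) ht2).and (hq.clamp_mem t))))).exists
  exact absurd (h2.miss r ⟨by linarith [hr.1], hr.2.trans h5.2⟩ y hy) (not_le.2 hlt)

theorem notMem_limSet_of_arrives {κ : Type*} {P : κ → Set (Cone ω e d hd)}
    (H : PieceSystem IsGeodesic P) {a : κ} (ha : P a = limSet hd e fun n => A (i n))
    (hM : HitConst A M) (hq : GeoSeq ω e d q ℓ L) {η : I → ℝ}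
    (hend : limGeo hd e q ℓ L ∈ P a)
    (hmiss : ∀ᶠ n in (ω : Filter I), ∀ t ∈ Set.Icc 0 (ℓ n - η n), ∀ y ∈ A (i n), M ≤ dist (q n t) y)
    (hη : ∀ ε > 0, ∀ᶠ n in (ω : Filter I), η n ≤ ε * d n) :
    ∀ t ∈ Set.Ico 0 L, limGeo hd e q ℓ t ∉ P a := by
  intro t ht htm
  have hgeo := hq.isGeodesic (hd := hd)
  set c := (t + L) / 2 with hc
  have hcm : c ∈ Set.Icc 0 L := ⟨by linarith [ht.1, ht.2], by linarith [ht.2]⟩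
  have h1 := H.convex (H.shift hgeo ht.1 ht.2.le) (by simpa using htm) (by simpa using hend)
    (c - t) ⟨by linarith [ht.2], by linarith [hcm.2]⟩
  simp only [add_sub_cancel] at h1
  rw [ha] at h1 htm
  obtain ⟨n, ⟨r, hr, y, hy, hlt⟩, h2, h3, h4, h5, h6⟩ :=
    ((hq.eventually_hit hM ht.1 (by linarith [ht.2] : t < c) hcm.2 htm h1).and (hmiss.and
      ((hη ((L - t) / 8) (by linarith [ht.2])).and ((hq.clamp_lt hd (c := (c + L) / 2)
        (by linarith [ht.2]) hcm).and ((hq.len.eventually_const_lt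
          (show (c + 3 * L) / 4 < L by linarith [ht.2])).and (eventually_scale_pos hd)))))).exists
  rw [lt_div_iff₀ h6] at h5
  refine absurd (h2 r ⟨(le_max_left _ _).trans hr.1, hr.2.trans ?_⟩ y hy) (not_le.2 hlt)
  have : (c + L) / 2 + (L - t) / 8 = (c + 3 * L) / 4 := by rw [hc]; ring
  nlinarith

end Leaves

/-! ### Comparison of geodesics leaving a set of the family at large scale. -/

section FiniteLemmas

variable {X : Type u} [MetricSpace X] {ι : Type v} {A : ι → Set X} {M : ℝ}

theorem eventually_inv_mul_le {d : ℕ → ℝ} (hd : Tendsto d (hyperfilter ℕ : Filter ℕ) atTop) :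
    ∀ ε > 0, ∀ᶠ n : ℕ in (hyperfilter ℕ : Filter ℕ), 1 / ((n : ℝ) + 1) * d n ≤ ε * d n := by
  intro ε hε
  filter_upwards [eventually_inv_le hε, eventually_scale_pos hd] with n h1 h2
  exact mul_le_mul_of_nonneg_right h1 h2.le

theorem geoSeq_self {d : ℕ → ℝ} (hd : Tendsto d (hyperfilter ℕ : Filter ℕ) atTop) {e : ℕ → X}
    {q : ℕ → ℝ → X} (hq : ∀ n, IsGeodesic (q n) (d n))
    (h0 : IsFin (hyperfilter ℕ) e d fun n => q n 0) : GeoSeq (hyperfilter ℕ) e d q d 1 := by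
  refine ⟨Eventually.of_forall hq, h0, tendsto_const_nhds.congr' ?_⟩
  filter_upwards [eventually_scale_pos hd] with n hn
  exact (div_self (ne_of_gt hn)).symm

/-- A geodesic leaving `A i` moves away from it at almost unit speed. -/
theorem IsAsymptoticallyTreeGraded.exists_height (hA : IsAsymptoticallyTreeGraded A)
    (hM : HitConst A M) :
    ∃ κ > 0, ∃ L : ℝ, ∀ (i : ι) (g : ℝ → X) (s : ℝ), L ≤ s → Leaves A M i g s (κ * s) →
      ∀ y ∈ A i, 9 / 10 * s ≤ dist (g s) y := by
  by_contra! hcon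
  -- Failure for `κ = 1 / (n + 1)` and `L = n` at lengths `s n ≥ n`; rescaled by `s n`, the initial
  -- parts near `A (i n)` vanish and the limit leaves its piece at once.
  choose i g s hs hg y hy hlt using fun n : ℕ => hcon (1 / ((n : ℝ) + 1)) (by positivity) n
  have hd := tendsto_hyperfilter_atTop hs
  have hG := geoSeq_self hd (e := fun n => g n 0) (fun n => (hg n).geo) (isFin_base _)
  have hη := eventually_inv_mul_le hd
  have h0 := start_mem_limSet (hd := hd) hG (Eventually.of_forall hg) hη
  have H := hA.pieceSystem hd fun n => g n 0
  have hout := notMem_limSet_of_leaves H (a := pieceIdx h0) rfl hM hG (Eventually.of_forall hg) hη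
  have hend := hG.isFin hd (Eventually.of_forall fun n => ⟨(hg n).geo.1, le_rfl⟩)
  have hyF : IsFin (hyperfilter ℕ) (fun n => g n 0) s y := hend.of_dist_le hd (C := 9 / 10)
    (Eventually.of_forall fun n => by rw [dist_comm]; exact (hlt n).le)
  have hyS := conePt_mem_limSet_of_mem (hd := hd) (S := fun n => A (i n)) hyF
    (Eventually.of_forall hy)
  have h1 := H.gate_dist_le (a := pieceIdx h0) hG.isGeodesic h0 hout hyS
  have h2 : dist (limGeo hd (fun n => g n 0) g s 1) (conePt hd (fun n => g n 0) y) ≤ 9 / 10 := by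
    rw [hG.limGeo_len]
    exact dist_conePt_le hend hyF (Eventually.of_forall fun n => (hlt n).le)
  linarith

/-- Two geodesics leaving `A i` which are close at time `s`, but not before time `s / 2`, both
visit some other set of the family. -/
theorem IsAsymptoticallyTreeGraded.exists_common_hit (hA : IsAsymptoticallyTreeGraded A)
    (hM : HitConst A M) :
    ∃ κ > 0, ∃ L : ℝ, ∀ (i : ι) (g τ : ℝ → X) (s : ℝ), L ≤ s → Leaves A M i g s (κ * s) →
      Leaves A M i τ s (κ * s) → dist (g s) (τ s) ≤ s / 2 →
      (∀ r ∈ Set.Icc (κ * s) (s / 2), r / 2 < dist (g r) (τ r)) →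
      ∃ j, j ≠ i ∧ (∃ t ∈ Set.Icc 0 (s / 2), ∃ y ∈ A j, dist (g t) y < M) ∧
        ∃ t ∈ Set.Icc 0 (s / 2), ∃ y ∈ A j, dist (τ t) y < M := by
  by_contra! hcon
  choose i g τ s hs hg hτ hclose hfar hno using fun n : ℕ =>
    hcon (1 / ((n : ℝ) + 1)) (by positivity) n
  have hd := tendsto_hyperfilter_atTop hs
  set e : ℕ → X := fun n => g n 0 with he
  have hη := eventually_inv_mul_le hd
  have hG := geoSeq_self hd (e := e) (fun n => (hg n).geo) (isFin_base _)
  have hGs := hG.isFin hd (Eventually.of_forall fun n => ⟨(hg n).geo.1, le_rfl⟩)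
  have hTs : IsFin (hyperfilter ℕ) e s fun n => τ n (s n) := hGs.of_dist_le hd (C := 1 / 2)
    (Eventually.of_forall fun n => by rw [dist_comm]; linarith [hclose n])
  have hT0 : IsFin (hyperfilter ℕ) e s fun n => τ n 0 := hTs.of_dist_le hd (C := 1)
    (Eventually.of_forall fun n => by rw [(hτ n).geo.dist_ends, one_mul])
  have hT := geoSeq_self hd (e := e) (fun n => (hτ n).geo) hT0
  have hg0 := start_mem_limSet (hd := hd) hG (Eventually.of_forall hg) hη
  have hτ0 := start_mem_limSet (hd := hd) hT (Eventually.of_forall hτ) hη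
  have H := hA.pieceSystem hd e
  have hga := notMem_limSet_of_leaves H (a := pieceIdx hg0) rfl hM hG (Eventually.of_forall hg) hη
  have hτa := notMem_limSet_of_leaves H (a := pieceIdx hg0) rfl hM hT (Eventually.of_forall hτ) hη
  obtain ⟨c, m, hc, hc0, hcm⟩ := H.exists_join (limGeo hd e g s 1) (limGeo hd e τ s 1)
  have hm : m ≤ 1 / 2 := by
    rw [← hc.dist_ends, hc0, hcm, hG.limGeo_len, hT.limGeo_len]
    exact dist_conePt_le hGs hTs (Eventually.of_forall fun n => by linarith [hclose n])
  -- The limit endpoint is at distance at least `1` from the piece and `c` has length at most `1 /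
  -- 2`. Hence both limits leave the piece at the same point.
  have hav : ∀ t ∈ Set.Icc 0 m, c t ∉ limPiece hd e A (pieceIdx hg0).1 := by
    intro t ht hta
    have h1 := H.gate_dist_le (a := pieceIdx hg0) hG.isGeodesic hg0 hga hta
    have h2 := hc.dist_zero ht.1 ht.2
    rw [hc0] at h2
    linarith [ht.2]
  have h00 := H.gate_eq (a := pieceIdx hg0) hG.isGeodesic hg0 hga hT.isGeodesic hτ0 hτa hc hc0 hcm
    hav
  have hfar' : ∀ r, 0 < r → r ≤ 1 / 4 → limGeo hd e g s r ≠ limGeo hd e τ s r := by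
    intro r hr hr4 heq
    have hr1 : r ∈ Set.Icc (0 : ℝ) 1 := ⟨hr.le, by linarith⟩
    have hle : ∀ᶠ n in (hyperfilter ℕ : Filter ℕ), r * s n ≤ s n := by
      filter_upwards [eventually_scale_pos hd] with n hn
      nlinarith
    have hmem : ∀ᶠ n in (hyperfilter ℕ : Filter ℕ), r * s n ∈ Set.Icc 0 (s n) := by
      filter_upwards [hle, eventually_scale_pos hd] with n h1 h2
      exact ⟨by positivity, h1⟩
    rw [hG.limGeo_eq hr1 hle, hT.limGeo_eq hr1 hle] at heq
    obtain ⟨n, h1, h2, h3⟩ := ((eventually_dist_lt_of_eq (hG.isFin hd hmem) (hT.isFin hd hmem) heq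
      (show 0 < r / 2 by linarith)).and ((hη r hr).and (eventually_scale_pos hd))).exists
    have := hfar n (r * s n) ⟨h2, by nlinarith⟩
    linarith
  -- Meetings at small times are excluded by `hfar'`, so both limits start in a common piece,
  -- different from the one they leave.
  rcases H.meet_or_startsIn hG.isGeodesic hT.isGeodesic hc one_pos one_pos h00 hc0 hcm
    (fun t ht hz => hav t ht (by rw [hz]; exact hg0)) with hmeet | ⟨b, ⟨r, hr, hr1, hrb⟩, r', hr', hr1',
      hrb'⟩
  · obtain ⟨r, hr, hr4, -, -, heq⟩ := hmeet (1 / 4) (by norm_num)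
    exact hfar' r hr hr4 heq
  · obtain ⟨j, hj⟩ := exists_pieceIdx_eq (hd := hd) b
    have hitG : ∀ {q : ℕ → ℝ → X} {r : ℝ}, GeoSeq (hyperfilter ℕ) e s q s 1 → 0 < r → r ≤ 1 →
        (∀ t ∈ Set.Icc 0 r, limGeo hd e q s t ∈ limPiece hd e A b.1) →
        ∀ᶠ n in (hyperfilter ℕ : Filter ℕ), ∃ t ∈ Set.Icc 0 (s n / 2), ∃ y ∈ A (j n),
          dist (q n t) y < M := by
      intro q r hQ hr hr1 hrb
      set r₂ := min r (1 / 4) with hr₂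
      have h4 : r₂ ≤ 1 / 4 := min_le_right _ _
      have h0 : 0 < r₂ := lt_min hr (by norm_num)
      have hb0 := hrb 0 ⟨le_rfl, hr.le⟩
      have hb1 := hrb r₂ ⟨h0.le, min_le_left _ _⟩
      rw [hj] at hb0 hb1
      filter_upwards [hQ.eventually_hit hM le_rfl h0 (by linarith) hb0 hb1,
        hQ.clamp_lt hd (c := 1 / 2) (by linarith) ⟨h0.le, by linarith⟩] with n ⟨t, ht, hy⟩ h5
      exact ⟨t, ⟨(le_max_left _ _).trans ht.1, by linarith [ht.2]⟩, hy⟩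
    have hne : ∀ᶠ n in (hyperfilter ℕ : Filter ℕ), j n ≠ i n := by
      rw [Ultrafilter.eventually_not]
      intro hji
      refine hga r ⟨hr, hr1⟩ ?_
      have h1 := hrb r ⟨hr.le, le_rfl⟩
      rw [hj] at h1
      change limGeo hd e g s r ∈ limSet hd e fun n => A (i n)
      obtain ⟨x, hx, hxp, hxA⟩ := exists_of_mem_limSet h1
      rw [← hxp]
      refine conePt_mem_limSet_of_mem hx ?_
      filter_upwards [hxA, hji] with n h2 h3
      rwa [← h3]
    obtain ⟨n, h1, h2, t, ht, y, hy, hlt⟩ := (hne.and ((hitG hG hr hr1 hrb).and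
      (hitG hT hr' hr1' hrb'))).exists
    exact absurd (hno n (j n) h1 h2 t ht y hy) (not_le.2 hlt)

/-- Two geodesics which leave `A i` and arrive at `A j` fellow travel at the largest scale
involved. -/
theorem IsAsymptoticallyTreeGraded.exists_bridge (hA : IsAsymptoticallyTreeGraded A)
    (hM : HitConst A M) :
    ∃ κ > 0, ∃ L : ℝ, ∀ (i j : ι) (g τ : ℝ → X) (a b s : ℝ), L ≤ s → i ≠ j →
      s = max (dist (g 0) (τ 0)) (max a b) → Leaves A M i g a (κ * s) → Leaves A M i τ b (κ * s) →
      (∃ y ∈ A j, dist (g a) y ≤ κ * s) → (∃ y ∈ A j, dist (τ b) y ≤ κ * s) →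
      (∀ t ∈ Set.Icc 0 (a - κ * s), ∀ y ∈ A j, M ≤ dist (g t) y) →
      (∀ t ∈ Set.Icc 0 (b - κ * s), ∀ y ∈ A j, M ≤ dist (τ t) y) →
      s / 2 ≤ min a b ∧ dist (g (min a b)) (τ (min a b)) ≤ min a b / 2 := by
  by_contra! hcon
  choose i j g τ a b s hs hij hmax hg hτ hga hτb hgm hτm hno using fun n : ℕ =>
    hcon (1 / ((n : ℝ) + 1)) (by positivity) n
  have hd := tendsto_hyperfilter_atTop hs
  set e : ℕ → X := fun n => g n 0 with he
  have hη := eventually_inv_mul_le hd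
  have has : ∀ n, a n ≤ s n := fun n => by
    rw [hmax n]; exact (le_max_left _ _).trans (le_max_right _ _)
  have hbs : ∀ n, b n ≤ s n := fun n => by
    rw [hmax n]; exact (le_max_right _ _).trans (le_max_right _ _)
  have h0s : ∀ n, dist (g n 0) (τ n 0) ≤ s n := fun n => by rw [hmax n]; exact le_max_left _ _
  have hG0 : IsFin (hyperfilter ℕ) e s fun n => g n 0 := isFin_base e
  have hT0 : IsFin (hyperfilter ℕ) e s fun n => τ n 0 := hG0.of_dist_le hd (C := 1)
    (Eventually.of_forall fun n => by rw [dist_comm, one_mul]; exact h0s n)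
  obtain ⟨S, hS, hG⟩ := exists_geoSeq hd (C := 1) (Eventually.of_forall fun n => (hg n).geo) hG0
    (Eventually.of_forall fun n => by rw [one_mul]; exact has n)
  obtain ⟨T, hTm, hT⟩ := exists_geoSeq hd (C := 1) (Eventually.of_forall fun n => (hτ n).geo) hT0
    (Eventually.of_forall fun n => by rw [one_mul]; exact hbs n)
  have hGs := hG.isFin hd (Eventually.of_forall fun n => ⟨(hg n).geo.1, le_rfl⟩)
  have hTs := hT.isFin hd (Eventually.of_forall fun n => ⟨(hτ n).geo.1, le_rfl⟩)
  have H := hA.pieceSystem hd e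
  have hg0 := start_mem_limSet (hd := hd) hG (Eventually.of_forall hg) hη
  have hτ0 := start_mem_limSet (hd := hd) hT (Eventually.of_forall hτ) hη
  have hga' := notMem_limSet_of_leaves H (a := pieceIdx hg0) rfl hM hG (Eventually.of_forall hg) hη
  have hτa' := notMem_limSet_of_leaves H (a := pieceIdx hg0) rfl hM hT (Eventually.of_forall hτ) hη
  have hgS : limGeo hd e g a S ∈ limSet hd e fun n => A (j n) := by
    rw [hG.limGeo_len]
    refine conePt_mem_limSet hGs fun ε hε => ?_
    filter_upwards [hη ε hε] with n hn
    obtain ⟨y, hy, hle⟩ := hga n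
    exact ⟨y, hy, hle.trans hn⟩
  have hτT : limGeo hd e τ b T ∈ limSet hd e fun n => A (j n) := by
    rw [hT.limGeo_len]
    refine conePt_mem_limSet hTs fun ε hε => ?_
    filter_upwards [hη ε hε] with n hn
    obtain ⟨y, hy, hle⟩ := hτb n
    exact ⟨y, hy, hle.trans hn⟩
  have hgb := notMem_limSet_of_arrives H (a := pieceIdx hgS) rfl hM hG hgS
    (Eventually.of_forall hgm) hη
  have hτb' := notMem_limSet_of_arrives H (a := pieceIdx hgS) rfl hM hT hτT
    (Eventually.of_forall hτm) hη
  -- Both limits are bridges between the same two pieces, so they share both ends and their length.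
  obtain ⟨hst, hen⟩ := H.bridge_eq (a := pieceIdx hg0) (b := pieceIdx hgS)
    (pieceIdx_ne hg0 hgS (Eventually.of_forall hij)) hG.isGeodesic hg0 hga' hgS hgb
    hT.isGeodesic hτ0 hτa' hτT hτb'
  have hSd := (hG.isGeodesic (hd := hd)).dist_ends
  have hTd := (hT.isGeodesic (hd := hd)).dist_ends
  rw [← hst, ← hen, hSd] at hTd
  subst hTd
  -- the common length is `1`
  have hS1 : S = 1 := by
    refine le_antisymm hS.2 (not_lt.1 fun hlt => ?_)
    rw [hG.limGeo_zero, hT.limGeo_zero] at hst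
    obtain ⟨n, h1, h2, h3, h4⟩ := ((hG.len.eventually_lt_const hlt).and
      ((hT.len.eventually_lt_const hlt).and ((eventually_dist_lt_of_eq hG0 hT0 hst one_pos).and
        (eventually_scale_pos hd)))).exists
    rw [div_lt_one h4] at h1 h2
    have := hmax n
    have h5 : max (dist (g n 0) (τ n 0)) (max (a n) (b n)) < s n :=
      max_lt (by linarith) (max_lt h1 h2)
    linarith
  subst hS1
  have hmin : Tendsto (fun n => min (a n) (b n) / s n) (hyperfilter ℕ : Filter ℕ) (𝓝 1) := by
    have := hG.len.min hT.len
    rw [min_self] at this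
    refine this.congr' ?_
    filter_upwards [eventually_scale_pos hd] with n hn
    exact min_div_div_right hn.le _ _
  have hmG : ∀ᶠ n in (hyperfilter ℕ : Filter ℕ), min (a n) (b n) ∈ Set.Icc 0 (a n) :=
    Eventually.of_forall fun n => ⟨le_min (hg n).geo.1 (hτ n).geo.1, min_le_left _ _⟩
  have hmT : ∀ᶠ n in (hyperfilter ℕ : Filter ℕ), min (a n) (b n) ∈ Set.Icc 0 (b n) :=
    Eventually.of_forall fun n => ⟨le_min (hg n).geo.1 (hτ n).geo.1, min_le_right _ _⟩
  have heq := (hG.conePt_eq_limGeo (hd := hd) hS hmG hmin).trans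
    (hen.trans (hT.conePt_eq_limGeo hS hmT hmin).symm)
  obtain ⟨n, h1, h2, h3⟩ := ((eventually_dist_lt_of_eq (hG.isFin hd hmG) (hT.isFin hd hmT) heq
    (show (0 : ℝ) < 1 / 4 by norm_num)).and ((hmin.eventually_const_lt
      (show (1 / 2 : ℝ) < 1 by norm_num)).and (eventually_scale_pos hd))).exists
  rw [lt_div_iff₀ h3] at h2
  linarith [hno n (by linarith)]

end FiniteLemmas

end TreeGraded

namespace TreeGraded

/-! ### Almost projections -/

section Projection

variable {X : Type u} [MetricSpace X] {ι : Type v} {A : ι → Set X} {M : ℝ} {i j : ι}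

/-- `p` is an almost closest point to `x` in `A i`. -/
def IsProj (A : ι → Set X) (i : ι) (x p : X) : Prop :=
  p ∈ A i ∧ ∀ y ∈ A i, dist x p ≤ dist x y + 1

/-- The almost projections of `x` and `y` to `A i` are at distance at most `K`. -/
def ProjClose (A : ι → Set X) (i : ι) (K : ℝ) (x y : X) : Prop :=
  ∀ p q, IsProj A i x p → IsProj A i y q → dist p q ≤ K

theorem exists_isProj (hA : (A i).Nonempty) (x : X) : ∃ p, IsProj A i x p := by
  obtain ⟨p, hp, hlt⟩ := (infDist_lt_iff (x := x) hA).1 (lt_add_one _)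
  exact ⟨p, hp, fun y hy => by linarith [infDist_le_dist_of_mem (x := x) hy]⟩

theorem ProjClose.symm {K : ℝ} {x y : X} (h : ProjClose A i K x y) : ProjClose A i K y x :=
  fun p q hp hq => by rw [dist_comm]; exact h q p hq hp

theorem ProjClose.trans {K K' : ℝ} {x y z : X} (h : ProjClose A i K x y)
    (h' : ProjClose A i K' y z) : ProjClose A i (K + K') x z := by
  intro p q hp hq
  obtain ⟨w, hw⟩ := exists_isProj ⟨p, hp.1⟩ y
  linarith [dist_triangle p w q, h p w hp hw, h' w q hw hq]

theorem ProjClose.mono {K K' : ℝ} {x y : X} (h : ProjClose A i K x y) (hK : K ≤ K') :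
    ProjClose A i K' x y :=
  fun p q hp hq => (h p q hp hq).trans hK

/-- `σ` is almost a shortest geodesic from `A i` to each of its points. -/
structure Perp (A : ι → Set X) (i : ι) (σ : ℝ → X) (a : ℝ) : Prop where
  geo : IsGeodesic σ a
  start : σ 0 ∈ A i
  le_dist : ∀ t ∈ Set.Icc 0 a, ∀ y ∈ A i, t ≤ dist (σ t) y + 1

theorem Perp.isProj {σ : ℝ → X} {a t : ℝ} (h : Perp A i σ a) (ht : t ∈ Set.Icc 0 a) :
    IsProj A i (σ t) (σ 0) :=
  ⟨h.start, fun y hy => by rw [dist_comm, h.geo.dist_zero ht.1 ht.2]; exact h.le_dist t ht y hy⟩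

theorem Perp.leaves {σ : ℝ → X} {a S h : ℝ} (H : Perp A i σ a) (hM : 0 < M) (hS : 0 ≤ S)
    (hSa : S ≤ a) (hh : M + 1 ≤ h) : Leaves A M i σ S h :=
  ⟨H.geo.initial hS hSa, ⟨σ 0, H.start, by rw [dist_self]; linarith⟩,
    fun t ht y hy => by
      linarith [H.le_dist t ⟨by linarith [ht.1], ht.2.trans hSa⟩ y hy, ht.1]⟩

theorem IsProj.exists_perp (hX : IsGeodesicSpace X) {x p : X} (h : IsProj A i x p) :
    ∃ σ, Perp A i σ (dist x p) ∧ σ 0 = p ∧ σ (dist x p) = x := by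
  obtain ⟨σ, a, hσ, h0, h1, -⟩ := hX p trivial x trivial
  have ha : a = dist x p := by rw [← hσ.dist_ends, h0, h1, dist_comm]
  subst ha
  refine ⟨σ, ⟨hσ, by rw [h0]; exact h.1, fun t ht y hy => ?_⟩, h0, h1⟩
  have h2 := h.2 y hy
  have h3 := hσ.dist_eq ht.1 ht.2 le_rfl
  have h4 := dist_triangle_left x y (σ t)
  rw [h1] at h3
  linarith

/-- Two geodesics that leave `A i` and come close to each other do so early, or else visit early
some other set of the family. -/
theorem IsAsymptoticallyTreeGraded.exists_meeting (hA : IsAsymptoticallyTreeGraded A)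
    (hM : HitConst A M) :
    ∃ K : ℝ, 1 ≤ K ∧ ∀ (i : ι) (g τ : ℝ → X) (S h : ℝ), M + 1 ≤ h → h ≤ S → Leaves A M i g S h →
      Leaves A M i τ S h → dist (g S) (τ S) ≤ S / 2 →
      (∃ r ∈ Set.Icc h S, r ≤ K * h ∧ dist (g r) (τ r) ≤ r / 2) ∨
      ∃ j, j ≠ i ∧ dist (g 0) (τ 0) ≤ K * h ∧
        (∃ t ∈ Set.Icc 0 S, t ≤ K * h ∧ ∃ y ∈ A j, dist (g t) y ≤ M + 1) ∧
        ∃ t ∈ Set.Icc 0 S, t ≤ K * h ∧ ∃ y ∈ A j, dist (τ t) y ≤ M + 1 := by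
  obtain ⟨κ₁, hκ₁, L₁, hhit⟩ := hA.exists_common_hit hM
  obtain ⟨κ₂, hκ₂, L₂, hbr⟩ := hA.exists_bridge hM
  have hM0 := hM.1
  set K := 2 + 1 / κ₁ + 1 / κ₂ + |L₁| + |L₂| with hK
  have hk₁ : 0 < 1 / κ₁ := by positivity
  have hk₂ : 0 < 1 / κ₂ := by positivity
  have ha₁ := abs_nonneg L₁
  have ha₂ := abs_nonneg L₂
  refine ⟨K, by linarith, fun i g τ S h hh hhS hg hτ hclose => ?_⟩
  have hh1 : 1 ≤ h := by linarith
  have hbig : ∀ {c r : ℝ}, c ≤ K → K * h < r → c * h ≤ r := fun hc hr => by nlinarith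
  set R : Set ℝ := {r | r ∈ Set.Icc h S ∧ dist (g r) (τ r) ≤ r / 2} with hR
  have hSR : S ∈ R := ⟨⟨hhS, le_rfl⟩, hclose⟩
  have hbdd : BddBelow R := ⟨h, fun r hr => hr.1.1⟩
  have hinf : h ≤ sInf R := le_csInf ⟨S, hSR⟩ fun r hr => hr.1.1
  -- A time of closeness within a factor `2` of the infimum, so that there is none in `[h, r₀ / 2]`.
  obtain ⟨r₀, hr₀, hlt⟩ := exists_lt_of_csInf_lt ⟨S, hSR⟩ (show sInf R < 2 * sInf R by linarith)
  have hnot : ∀ r, h ≤ r → r ≤ r₀ / 2 → r / 2 < dist (g r) (τ r) := by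
    intro r hr hr2
    by_contra! hle
    have : sInf R ≤ r := csInf_le hbdd ⟨⟨hr, by linarith [hr₀.1.2]⟩, hle⟩
    linarith
  by_cases hr₀K : r₀ ≤ K * h
  · exact Or.inl ⟨r₀, hr₀.1, hr₀K, hr₀.2⟩
  push Not at hr₀K
  right
  have hr₀h : h ≤ κ₁ * r₀ := by
    have := hbig (c := 1 / κ₁) (by linarith) hr₀K
    rw [div_mul_eq_mul_div, one_mul, div_le_iff₀ hκ₁] at this
    linarith
  have hr₀L : L₁ ≤ r₀ := by
    have := hbig (c := |L₁|) (by linarith) hr₀K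
    nlinarith [le_abs_self L₁]
  have hr₀0 : 0 ≤ r₀ := by linarith [hr₀.1.1]
  obtain ⟨j, hji, ⟨t₁, ht₁, y₁, hy₁, hlt₁⟩, t₂, ht₂, y₂, hy₂, hlt₂⟩ := hhit i g τ r₀ hr₀L
    (hg.mono hr₀0 hr₀.1.2 hr₀h) (hτ.mono hr₀0 hr₀.1.2 hr₀h) hr₀.2
    fun r hr => hnot r (hr₀h.trans hr.1) hr.2
  have mem : ∀ {x y : X}, y ∈ A j → dist x y < M → x ∈ cthickening M (A j) := fun hy h =>
    thickening_subset_cthickening _ _ (mem_thickening_iff.2 ⟨_, hy, h⟩)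
  have near : ∀ {x : X}, x ∈ cthickening M (A j) → ∃ y ∈ A j, dist x y ≤ M + 1 := fun h => by
    obtain ⟨y, hy, hlt⟩ := mem_thickening_iff.1
      (cthickening_subset_thickening' (by linarith) (by linarith : M < M + 1) _ h)
    exact ⟨y, hy, hlt.le⟩
  have hr₀S : r₀ / 2 ≤ S := by linarith [hr₀.1.2]
  obtain ⟨a, ha, haj, hafirst⟩ := hg.geo.exists_first (S := cthickening M (A j))
    isClosed_cthickening le_rfl hr₀S ht₁ (mem hy₁ hlt₁)
  obtain ⟨b, hb, hbj, hbfirst⟩ := hτ.geo.exists_first (S := cthickening M (A j))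
    isClosed_cthickening le_rfl hr₀S ht₂ (mem hy₂ hlt₂)
  set s := max (dist (g 0) (τ 0)) (max a b) with hs
  have has : a ≤ s := (le_max_left _ _).trans (le_max_right _ _)
  have hbs : b ≤ s := (le_max_right _ _).trans (le_max_right _ _)
  -- Both geodesics reach `A j` by time `r₀ / 2`. If this, or the distance of their origins, were
  -- large compared to `h`, the bridge comparison would make them close at time `min a b ≤ r₀ / 2`,
  -- which `hnot` forbids.
  have hsK : s ≤ K * h := by
    by_contra! hsK
    have hsh : h ≤ κ₂ * s := by
      have := hbig (c := 1 / κ₂) (by linarith) hsK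
      rw [div_mul_eq_mul_div, one_mul, div_le_iff₀ hκ₂] at this
      linarith
    have hsL : L₂ ≤ s := by
      have := hbig (c := |L₂|) (by linarith) hsK
      nlinarith [le_abs_self L₂]
    have hs2 : 2 * h ≤ s := hbig (by linarith) hsK
    obtain ⟨y, hy, hya⟩ := near haj
    obtain ⟨w, hw, hwb⟩ := near hbj
    obtain ⟨h1, h2⟩ := hbr i j g τ a b s hsL hji.symm hs
      (hg.mono ha.1 (by linarith [ha.2]) hsh) (hτ.mono hb.1 (by linarith [hb.2]) hsh)
      ⟨y, hy, by linarith⟩ ⟨w, hw, by linarith⟩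
      (fun t ht z hz => by
        by_contra! hlt
        linarith [hafirst t ⟨ht.1, by linarith [ht.2, ha.2]⟩ (mem hz hlt), ht.2])
      (fun t ht z hz => by
        by_contra! hlt
        linarith [hbfirst t ⟨ht.1, by linarith [ht.2, hb.2]⟩ (mem hz hlt), ht.2])
    have := hnot (min a b) (by linarith) ((min_le_left _ _).trans ha.2)
    linarith
  exact ⟨j, hji, (le_max_left _ _).trans hsK, ⟨a, ⟨ha.1, ha.2.trans hr₀S⟩, has.trans hsK, near haj⟩,
    ⟨b, ⟨hb.1, hb.2.trans hr₀S⟩, hbs.trans hsK, near hbj⟩⟩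

/-- Perpendiculars leave `A i` at the fixed height `M + 1`. Either outcome of the meeting
alternative bounds the distance of their feet, whatever `S` is. -/
theorem IsAsymptoticallyTreeGraded.exists_perp_close (hA : IsAsymptoticallyTreeGraded A)
    (hM : HitConst A M) :
    ∃ D : ℝ, 0 ≤ D ∧ ∀ (i : ι) (σ τ : ℝ → X) (a b S : ℝ), Perp A i σ a → Perp A i τ b → 0 ≤ S →
      S ≤ a → S ≤ b → dist (σ S) (τ S) ≤ S / 2 → dist (σ 0) (τ 0) ≤ D := by
  obtain ⟨K, hK, hmeet⟩ := hA.exists_meeting hM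
  have hM0 := hM.1
  refine ⟨3 * (K * (M + 1)), by positivity, fun i σ τ a b S hσ hτ hS hSa hSb hclose => ?_⟩
  have hKM : M + 1 ≤ K * (M + 1) := by nlinarith
  have bound : ∀ r, 0 ≤ r → r ≤ S → r ≤ K * (M + 1) → dist (σ r) (τ r) ≤ r / 2 →
      dist (σ 0) (τ 0) ≤ 3 * (K * (M + 1)) := by
    intro r hr hrS hrK hle
    have h1 := hσ.geo.dist_zero hr (hrS.trans hSa)
    have h2 := hτ.geo.dist_zero hr (hrS.trans hSb)
    have h3 := dist_triangle4 (σ 0) (σ r) (τ r) (τ 0)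
    rw [dist_comm (τ r)] at h3
    linarith
  by_cases hSh : S < M + 1
  · exact bound S hS le_rfl (by linarith) hclose
  push Not at hSh
  rcases hmeet i σ τ S (M + 1) le_rfl hSh (hσ.leaves hM0 hS hSa le_rfl) (hτ.leaves hM0 hS hSb le_rfl)
    hclose with ⟨r, hr, hrK, hle⟩ | ⟨j, -, hle, -⟩
  · exact bound r (by linarith [hr.1]) hr.2 hrK hle
  · nlinarith

/-- The projection is coarsely contracting: the perpendiculars to `x` and `y` are still close at the
time when the shorter one ends. -/
theorem IsAsymptoticallyTreeGraded.exists_projClose_step (hX : IsGeodesicSpace X)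
    (hA : IsAsymptoticallyTreeGraded A) (hM : HitConst A M) :
    ∃ D : ℝ, 0 ≤ D ∧ ∀ (i : ι) (x y : X), (∀ z ∈ A i, 8 * dist x y ≤ dist x z) →
      ProjClose A i D x y := by
  obtain ⟨D, hD, hperp⟩ := hA.exists_perp_close hM
  refine ⟨max D 19, hD.trans (le_max_left _ _), fun i x y hxy p q hp hq => ?_⟩
  have h1 := hxy p hp.1
  have h2 := hp.2 q hq.1
  have h3 := hq.2 p hp.1
  have h4 := dist_triangle x y q
  have h5 := dist_triangle_left y p x
  -- With `a = dist x p`, the points at time `S` are within `a / 4 + 1`, while `S / 2 ≥ 7 * a / 16 -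
  -- 1 / 2`; this suffices for `a ≥ 8`. For smaller `a` the feet are within `8 + 1 + 10`.
  by_cases ha : dist x p < 8
  · refine le_max_of_le_right ?_
    have := dist_triangle4 p x y q
    rw [dist_comm p x] at this
    linarith
  push Not at ha
  refine le_max_of_le_left ?_
  obtain ⟨σ, hσ, hσ0, hσa⟩ := hp.exists_perp hX
  obtain ⟨τ, hτ, hτ0, hτb⟩ := hq.exists_perp hX
  set S := min (dist x p) (dist y q) with hS
  have hS1 : S ≤ dist x p := min_le_left _ _
  have hS2 : S ≤ dist y q := min_le_right _ _
  have hS0 : 0 ≤ S := le_min dist_nonneg dist_nonneg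
  have h6 := hσ.geo.dist_eq hS0 hS1 le_rfl
  have h7 := hτ.geo.dist_eq hS0 hS2 le_rfl
  rw [hσa] at h6
  rw [hτb] at h7
  have h8 := dist_triangle4 (σ S) x y (τ S)
  rw [dist_comm y (τ S)] at h8
  have := hperp i σ τ _ _ S hσ hτ hS0 hS1 hS2 (by
    rcases min_choice (dist x p) (dist y q) with h | h <;> rw [← hS] at h <;> linarith)
  rwa [hσ0, hτ0] at this

/-- Geodesics that are not too long compared to their distance to `A i` have close projections. -/
theorem projClose_of_steps {D : ℝ} (hD0 : 0 ≤ D)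
    (hD : ∀ (i : ι) (x y : X), (∀ z ∈ A i, 8 * dist x y ≤ dist x z) → ProjClose A i D x y)
    (N : ℕ) : ∀ (i : ι) (γ : ℝ → X) (l η : ℝ), IsGeodesic γ l → 0 ≤ η →
      (∀ t ∈ Set.Icc 0 l, ∀ y ∈ A i, η ≤ dist (γ t) y) → l ≤ N * (η / 8) →
      ProjClose A i ((N + 1) * D) (γ 0) (γ l) := by
  induction N with
  | zero =>
    intro i γ l η hγ _ _ hl
    have : l = 0 := le_antisymm (by simpa using hl) hγ.1
    subst this
    refine (hD i _ _ fun z _ => ?_).mono (by simp)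
    rw [dist_self, mul_zero]
    exact dist_nonneg
  | succ N ih =>
    intro i γ l η hγ hη hfar hl
    push_cast at hl ⊢
    rcases le_total l (η / 8) with h | h
    · refine (hD i _ _ fun z hz => ?_).mono (by nlinarith [(Nat.cast_nonneg N : (0 : ℝ) ≤ N)])
      rw [hγ.dist_ends]
      linarith [hfar 0 ⟨le_rfl, hγ.1⟩ z hz]
    · have h1 : ProjClose A i D (γ 0) (γ (η / 8)) := hD i _ _ fun z hz => by
        rw [hγ.dist_zero (by linarith) h]
        linarith [hfar 0 ⟨le_rfl, hγ.1⟩ z hz]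
      have h2 := ih i (fun r => γ (η / 8 + r)) (l - η / 8) η (hγ.shift (by linarith) h) hη
        (fun t ht => hfar _ ⟨by linarith [ht.1], by linarith [ht.2]⟩) (by linarith)
      simp only [add_zero, add_sub_cancel] at h2
      exact (h1.trans h2).mono (by linarith)

/-- The almost projection of `A j` to `A i` is bounded. -/
theorem IsAsymptoticallyTreeGraded.exists_projClose_piece (hX : IsGeodesicSpace X)
    (hA : IsAsymptoticallyTreeGraded A) (hM : HitConst A M) :
    ∃ D : ℝ, 0 ≤ D ∧ ∀ (i j : ι) (x y : X), i ≠ j → (∃ w ∈ A j, dist x w ≤ M + 1) →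
      (∃ w ∈ A j, dist y w ≤ M + 1) → ProjClose A i D x y := by
  obtain ⟨D, hD, hperp⟩ := hA.exists_perp_close hM
  obtain ⟨κ, hκ, L, hbr⟩ := hA.exists_bridge hM
  have hM0 := hM.1
  refine ⟨max D (max L ((M + 2) / κ)), hD.trans (le_max_left _ _),
    fun i j x y hij hx hy p q hp hq => ?_⟩
  obtain ⟨σ, hσ, hσ0, hσa⟩ := hp.exists_perp hX
  obtain ⟨τ, hτ, hτ0, hτb⟩ := hq.exists_perp hX
  have mem : ∀ {x : X}, (∃ w ∈ A j, dist x w ≤ M + 1) → x ∈ cthickening (M + 1) (A j) := by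
    rintro x ⟨w, hw, h⟩
    exact mem_cthickening_of_dist_le x w _ _ hw h
  have near : ∀ {x : X}, x ∈ cthickening (M + 1) (A j) → ∃ y ∈ A j, dist x y ≤ M + 2 := fun h => by
    obtain ⟨y, hy, hlt⟩ := mem_thickening_iff.1
      (cthickening_subset_thickening' (by linarith) (by linarith : M + 1 < M + 2) _ h)
    exact ⟨y, hy, hlt.le⟩
  -- Cut at their first approach to `A j`, the perpendiculars become bridges from `A i` to `A j`; if
  -- their scale is large they are close at time `min a b`, so their feet are close.
  obtain ⟨a, ha, haj, hafirst⟩ := hσ.geo.exists_first (S := cthickening (M + 1) (A j))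
    isClosed_cthickening le_rfl le_rfl (r := dist x p) ⟨dist_nonneg, le_rfl⟩
    (by rw [hσa]; exact mem hx)
  obtain ⟨b, hb, hbj, hbfirst⟩ := hτ.geo.exists_first (S := cthickening (M + 1) (A j))
    isClosed_cthickening le_rfl le_rfl (r := dist y q) ⟨dist_nonneg, le_rfl⟩
    (by rw [hτb]; exact mem hy)
  set s := max (dist (σ 0) (τ 0)) (max a b) with hs
  rw [← hσ0, ← hτ0]
  by_cases hsL : s < max L ((M + 2) / κ)
  · exact le_max_of_le_right ((le_max_left _ _).trans hsL.le)
  push Not at hsL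
  refine le_max_of_le_left ?_
  have hsM : M + 2 ≤ κ * s := by
    have := (le_max_right L ((M + 2) / κ)).trans hsL
    rw [div_le_iff₀ hκ] at this
    linarith
  obtain ⟨y', hy', hya⟩ := near haj
  obtain ⟨w', hw', hwb⟩ := near hbj
  obtain ⟨-, h2⟩ := hbr i j σ τ a b s ((le_max_left _ _).trans hsL) hij hs
    (hσ.leaves hM0 ha.1 ha.2 (by linarith)) (hτ.leaves hM0 hb.1 hb.2 (by linarith))
    ⟨y', hy', by linarith⟩ ⟨w', hw', by linarith⟩
    (fun t ht z hz => by
      by_contra! hlt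
      linarith [hafirst t ⟨ht.1, by linarith [ht.2, ha.2]⟩ (mem ⟨z, hz, by linarith⟩), ht.2])
    (fun t ht z hz => by
      by_contra! hlt
      linarith [hbfirst t ⟨ht.1, by linarith [ht.2, hb.2]⟩ (mem ⟨z, hz, by linarith⟩), ht.2])
  exact hperp i σ τ _ _ (min a b) hσ hτ (le_min ha.1 hb.1) ((min_le_left _ _).trans ha.2)
    ((min_le_right _ _).trans hb.2) h2

/-- Geodesics outside of a neighbourhood of `A i` that start at an almost closest point to `A i`
have bounded projections. -/
theorem IsAsymptoticallyTreeGraded.exists_projClose_half (hX : IsGeodesicSpace X)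
    (hA : IsAsymptoticallyTreeGraded A) (hM : HitConst A M) :
    ∃ M₁ C : ℝ, 0 < M₁ ∧ ∀ (i : ι) (g : ℝ → X) (ℓ h : ℝ), IsGeodesic g ℓ → M₁ ≤ h →
      (∃ y ∈ A i, dist (g 0) y ≤ h + 1) → (∀ t ∈ Set.Icc 0 ℓ, ∀ y ∈ A i, h ≤ dist (g t) y) →
      ProjClose A i C (g 0) (g ℓ) := by
  obtain ⟨K, hK, hmeet⟩ := hA.exists_meeting hM
  obtain ⟨κ, hκ, L, hheight⟩ := hA.exists_height hM
  obtain ⟨D, hD, hstep⟩ := hA.exists_projClose_step hX hM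
  obtain ⟨D₂, hD₂, hpiece⟩ := hA.exists_projClose_piece hX hM
  have hM0 := hM.1
  have hκ' : 0 < 1 / κ := by positivity
  set K₀ := 10 + K + 1 / κ + |L| with hK₀
  have hL0 := abs_nonneg L
  obtain ⟨N, hN⟩ := exists_nat_ge (16 * K₀)
  have hNN : (0 : ℝ) ≤ N := Nat.cast_nonneg N
  refine ⟨M + 4, (N + 1) * D + 17 * D + D₂, by linarith, fun i g ℓ h hg hh hstart hfar p p' hp hp' => ?_⟩
  -- Along `g` the distance to `A i` is at least `h`, so steps of length `h / 8` are allowed; as `h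
  -- ≥ 1`, `N ≥ 16 * K₀` of them cover length `K₀ * (h + 1)`.
  have hsteps : ∀ r ∈ Set.Icc 0 ℓ, r ≤ K₀ * (h + 1) → ProjClose A i ((N + 1) * D) (g 0) (g r) := by
    intro r hr hrK
    refine projClose_of_steps hD hstep N i g r h (hg.initial hr.1 hr.2) (by linarith)
      (fun t ht => hfar t ⟨ht.1, ht.2.trans hr.2⟩) ?_
    nlinarith
  by_cases hℓ : ℓ ≤ K₀ * (h + 1)
  · have := hsteps ℓ ⟨hg.1, le_rfl⟩ hℓ p p' hp hp'
    linarith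
  push Not at hℓ
  have hbig : ∀ {c : ℝ}, c ≤ K₀ → c * (h + 1) ≤ ℓ := fun hc => by nlinarith
  have hgL : Leaves A M i g ℓ (h + 1) := ⟨hg, hstart, fun t ht y hy => by
    linarith [hfar t ⟨by linarith [ht.1], ht.2⟩ y hy]⟩
  have hℓκ : h + 1 ≤ κ * ℓ := by
    have := hbig (c := 1 / κ) (by linarith)
    rw [div_mul_eq_mul_div, one_mul, div_le_iff₀ hκ] at this
    linarith
  have hℓL : L ≤ ℓ := by
    have := hbig (c := |L|) (by linarith)
    nlinarith [le_abs_self L]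
  have hℓ10 : 10 * (h + 1) ≤ ℓ := hbig (by linarith)
  have hb1 := hheight i g ℓ hℓL (hgL.mono hg.1 le_rfl hℓκ) p' hp'.1
  obtain ⟨y, hy, hy0⟩ := hstart
  have hb2 : dist (g ℓ) p' ≤ ℓ + (h + 1) + 1 := by
    have h1 := hp'.2 y hy
    have h2 := dist_triangle_left (g ℓ) y (g 0)
    rw [hg.dist_ends] at h2
    linarith
  obtain ⟨τ, hτ, hτ0, hτb⟩ := hp'.exists_perp hX
  set b := dist (g ℓ) p' with hb
  set S := min ℓ b with hS
  have hSℓ : S ≤ ℓ := min_le_left _ _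
  have hSb : S ≤ b := min_le_right _ _
  have hS9 : 9 / 10 * ℓ ≤ S := le_min (by linarith [hg.1]) hb1
  have hS0 : 0 ≤ S := by linarith [hg.1]
  -- The height estimate makes `g` and the perpendicular `τ` to its endpoint almost equally long, so
  -- they can be compared at time `S`. All points of `τ` project almost to `p'`, so it suffices to
  -- get from `g` to `τ` early.
  have hclose : dist (g S) (τ S) ≤ S / 2 := by
    have h1 := hg.dist_eq hS0 hSℓ le_rfl
    have h2 := hτ.geo.dist_eq hS0 hSb le_rfl
    rw [hτb] at h2
    have h3 := dist_triangle_right (g S) (τ S) (g ℓ)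
    rcases min_choice ℓ b with h | h <;> rw [← hS] at h <;> linarith
  have htri : ∀ {t : ℝ}, t ∈ Set.Icc 0 S → ∀ {c : ℝ}, ProjClose A i c (g 0) (τ t) →
      dist p p' ≤ c := by
    intro t ht c hc
    have := hτ.isProj (t := t) ⟨ht.1, ht.2.trans hSb⟩
    rw [hτ0] at this
    exact hc p p' hp this
  rcases hmeet i g τ S (h + 1) (by linarith) (by linarith) (hgL.mono hS0 hSℓ le_rfl)
    (hτ.leaves hM0 hS0 hSb (by linarith)) hclose with ⟨r, hr, hrK, hrc⟩ | ⟨j, hji, -, ⟨t, ht, htK, hgt⟩,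
      t', ht', -, hτt⟩
  · have hr0 : 0 ≤ r := by linarith [hr.1]
    have h1 := hsteps r ⟨hr0, hr.2.trans hSℓ⟩ (hrK.trans (by nlinarith))
    obtain ⟨c, m, hc, hc0, hcm, -⟩ := hX (g r) trivial (τ r) trivial
    have hm : m ≤ r / 2 := by rw [← hc.dist_ends, hc0, hcm]; exact hrc
    -- The crossing has length at most `r / 2` and stays at distance at least `r - 1 - r / 2 ≥ r /
    -- 4` from `A i`, so `16` steps of length `r / 32` suffice.
    have h2 := projClose_of_steps hD hstep 16 i c m (r / 4) hc (by linarith)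
      (fun t ht y hy => by
        have h3 := hτ.le_dist r ⟨hr0, hr.2.trans hSb⟩ y hy
        have h4 := hc.dist_eq ht.1 ht.2 le_rfl
        have h5 := dist_triangle_left (τ r) y (c t)
        rw [hcm] at h4
        linarith [ht.1, hr.1]) (by norm_num; linarith)
    rw [hc0, hcm] at h2
    have := htri ⟨hr0, hr.2⟩ (h1.trans h2)
    norm_num at this
    linarith
  · have h1 := hsteps t ⟨ht.1, ht.2.trans hSℓ⟩ (htK.trans (by nlinarith))
    have := htri ht' (h1.trans (hpiece i j _ _ hji.symm hgt hτt))
    linarith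

/-- Geodesics outside of a neighbourhood of `A i` have bounded projections to `A i`. -/
theorem IsAsymptoticallyTreeGraded.exists_projClose (hX : IsGeodesicSpace X)
    (hA : IsAsymptoticallyTreeGraded A) (hM : HitConst A M) :
    ∃ M₁ C : ℝ, 0 < M₁ ∧ 0 ≤ C ∧ ∀ (i : ι) (g : ℝ → X) (ℓ : ℝ), IsGeodesic g ℓ →
      (∀ t ∈ Set.Icc 0 ℓ, ∀ y ∈ A i, M₁ ≤ dist (g t) y) → ProjClose A i C (g 0) (g ℓ) := by
  obtain ⟨M₁, C, hM₁, hhalf⟩ := hA.exists_projClose_half hX hM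
  refine ⟨M₁, 2 * |C|, hM₁, by positivity, fun i g ℓ hg hfar p q hp hq => ?_⟩
  have hne : (A i).Nonempty := ⟨p, hp.1⟩
  have hcont : ContinuousOn (fun r => infDist (g r) (A i)) (Set.Icc 0 ℓ) :=
    (continuous_infDist_pt _).comp_continuousOn hg.continuousOn
  -- The one-sided estimate is applied in both directions from a point of `g` closest to `A i`.
  obtain ⟨t, ht, hmin⟩ := isCompact_Icc.exists_isMinOn (Set.nonempty_Icc.2 hg.1) hcont
  rw [isMinOn_iff] at hmin
  set h := infDist (g t) (A i) with hh
  have hhM : M₁ ≤ h := (le_infDist hne).2 fun y hy => hfar t ht y hy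
  obtain ⟨y, hy, hlt⟩ := (infDist_lt_iff hne).1 (lt_add_one h)
  have hge : ∀ r ∈ Set.Icc 0 ℓ, ∀ y ∈ A i, h ≤ dist (g r) y := fun r hr y hy =>
    (hmin r hr).trans (infDist_le_dist_of_mem hy)
  have h1 := hhalf i (fun r => g (t + r)) (ℓ - t) h (hg.shift ht.1 ht.2) hhM
    ⟨y, hy, by simpa using hlt.le⟩ fun r hr => hge _ ⟨by linarith [hr.1, ht.1], by linarith [hr.2]⟩
  have h2 := hhalf i (fun r => g (t - r)) t h (hg.initial ht.1 ht.2).reverse hhM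
    ⟨y, hy, by simpa using hlt.le⟩ fun r hr => hge _ ⟨by linarith [hr.2], by linarith [hr.1, ht.2]⟩
  simp only [add_zero, add_sub_cancel] at h1
  simp only [sub_zero, sub_self] at h2
  exact ((h2.symm.trans h1).mono (by linarith [le_abs_self C])) p q hp hq

end Projection

end TreeGraded

namespace TreeGraded

/-! ### Cut points of geodesics transverse to the family -/

section Chain

variable {X : Type u} [MetricSpace X] {ι : Type v} {A : ι → Set X} {M : ℝ}

/-- `x = y`, or `x` and `y` are joined by a geodesic whose distance to `z` is between `s / 2` and
`R * s`. -/
def Step (z : X) (s R : ℝ) (x y : X) : Prop :=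
  x = y ∨ ∃ q ℓ, IsGeodesic q ℓ ∧ q 0 = x ∧ q ℓ = y ∧
    ∀ t ∈ Set.Icc 0 ℓ, s / 2 ≤ dist (q t) z ∧ dist (q t) z ≤ R * s

/-- Chains of `N` steps. -/
def Chain (z : X) (s R : ℝ) : ℕ → X → X → Prop
  | 0, x, y => x = y
  | N + 1, x, y => ∃ w, Step z s R x w ∧ Chain z s R N w y

theorem Step.symm {z x y : X} {s R : ℝ} (h : Step z s R x y) : Step z s R y x := by
  rcases h with h | ⟨q, ℓ, hq, h0, h1, hz⟩
  · exact Or.inl h.symm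
  · exact Or.inr ⟨_, ℓ, hq.reverse, by simpa using h1, by simpa using h0,
      fun t ht => hz _ ⟨by linarith [ht.2], by linarith [ht.1]⟩⟩

theorem Step.of_le {z : X} {s R : ℝ} {q : ℝ → X} {ℓ a b : ℝ} (hq : IsGeodesic q ℓ) (ha : 0 ≤ a)
    (hab : a ≤ b) (hb : b ≤ ℓ)
    (hz : ∀ t ∈ Set.Icc a b, s / 2 ≤ dist (q t) z ∧ dist (q t) z ≤ R * s) :
    Step z s R (q a) (q b) :=
  Or.inr ⟨fun r => q (a + r), b - a, (hq.shift ha (hab.trans hb)).initial (by linarith)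
    (by linarith), by simp, by simp, fun t ht => hz _ ⟨by linarith [ht.1], by linarith [ht.2]⟩⟩

theorem Step.of_far {z : X} {s R c : ℝ} {q : ℝ → X} {ℓ a b : ℝ} (hq : IsGeodesic q ℓ) (hs : 0 ≤ s)
    (ha : a ∈ Set.Icc 0 ℓ) (hb : b ∈ Set.Icc 0 ℓ) (hfar : ∀ t ∈ Set.Icc 0 ℓ, s ≤ dist (q t) z)
    (hca : dist (q a) z ≤ c) (hc : c + dist (q a) (q b) ≤ R * s) : Step z s R (q a) (q b) := by
  have key : ∀ t ∈ Set.Icc 0 ℓ, dist (q a) (q t) ≤ dist (q a) (q b) →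
      s / 2 ≤ dist (q t) z ∧ dist (q t) z ≤ R * s := fun t ht hle =>
    ⟨by linarith [hfar t ht], by linarith [dist_triangle_left (q t) z (q a)]⟩
  rcases le_total a b with hab | hab
  · refine Step.of_le hq ha.1 hab hb.2 fun t ht => key t ⟨ha.1.trans ht.1, ht.2.trans hb.2⟩ ?_
    rw [hq.dist_eq ha.1 ht.1 (ht.2.trans hb.2), hq.dist_eq ha.1 hab hb.2]
    linarith [ht.2]
  · refine (Step.of_le hq hb.1 hab ha.2 fun t ht => key t ⟨hb.1.trans ht.1, ht.2.trans ha.2⟩ ?_).symm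
    rw [dist_comm, hq.dist_eq (hb.1.trans ht.1) ht.2 ha.2, dist_comm, hq.dist_eq hb.1 hab ha.2]
    linarith [ht.1]

theorem Step.of_dist_le (hX : IsGeodesicSpace X) {z x y : X} {s R : ℝ} (hxy : dist x y ≤ s)
    (h1 : 3 / 2 * s ≤ dist x z) (h2 : dist x z + s ≤ R * s) : Step z s R x y := by
  obtain ⟨q, ℓ, hq, h0, hℓ, -⟩ := hX x trivial y trivial
  refine Or.inr ⟨q, ℓ, hq, h0, hℓ, fun t ht => ?_⟩
  have h3 := hq.dist_zero ht.1 ht.2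
  have h4 := hq.dist_ends
  rw [h0] at h3
  rw [h0, hℓ] at h4
  have h5 := dist_triangle x (q t) z
  have h6 := dist_triangle_left (q t) z x
  exact ⟨by linarith [ht.2], by linarith [ht.2]⟩

section Limit

variable {I : Type} {ω : Ultrafilter I} {e : I → X} {d : I → ℝ} {hd : Tendsto d ω atTop}

theorem conePt_congr {x y : I → X} (hx : IsFin ω e d x) (hy : IsFin ω e d y)
    (h : ∀ᶠ n in (ω : Filter I), x n = y n) : conePt hd e x = conePt hd e y := by
  refine conePt_eq hx hy fun ε hε => ?_
  filter_upwards [h, eventually_scale_pos hd] with n h1 h2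
  rw [h1, dist_self]
  positivity

/-- The lower bound in `Step` keeps the limit chain off the limit of `z`, and the upper bound keeps
the points at finite rescaled distance. -/
theorem joined_of_chain {R : ℝ} {z y : I → X} (hz : IsFin ω e d z) (hy : IsFin ω e d y) (N : ℕ) :
    ∀ x : I → X, IsFin ω e d x → (∀ᶠ n in (ω : Filter I), Chain (z n) (d n) R N (x n) (y n)) →
      Joined IsGeodesic (conePt hd e z) (conePt hd e x) (conePt hd e y) := by
  induction N with
  | zero =>
    intro x hx h
    rw [conePt_congr hx hy h]
    exact Relation.ReflTransGen.refl
  | succ N ih =>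
    intro x hx h
    have : Nonempty X := ⟨x h.exists.choose⟩
    obtain ⟨w, hw⟩ := h.choice
    have hor : ∀ᶠ n in (ω : Filter I), x n = w n ∨ ∃ p : (ℝ → X) × ℝ, IsGeodesic p.1 p.2 ∧
        p.1 0 = x n ∧ p.1 p.2 = w n ∧ ∀ t ∈ Set.Icc 0 p.2, d n / 2 ≤ dist (p.1 t) (z n) ∧
          dist (p.1 t) (z n) ≤ R * d n := by
      filter_upwards [hw] with n hn
      rcases hn.1 with h | ⟨q, ℓ, h⟩
      · exact Or.inl h
      · exact Or.inr ⟨(q, ℓ), h⟩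
    have hNw := hw.mono fun n hn => hn.2
    rw [Ultrafilter.eventually_or] at hor
    rcases hor with heq | hlink
    · have hwF : IsFin ω e d w := hx.of_dist_le hd (C := 0) (by
        filter_upwards [heq] with n hn
        rw [hn, dist_self, zero_mul])
      rw [conePt_congr hx hwF heq]
      exact ih w hwF hNw
    · have : Nonempty ((ℝ → X) × ℝ) := ⟨hlink.exists.choose_spec.choose⟩
      obtain ⟨p, hp⟩ := hlink.choice
      have hwF : IsFin ω e d w := hz.of_dist_le hd (C := R) (by
        filter_upwards [hp] with n hn
        rw [← hn.2.2.1]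
        exact (hn.2.2.2 _ ⟨hn.1.1, le_rfl⟩).2)
      have hp0 : IsFin ω e d fun n => (p n).1 0 := hx.of_dist_le hd (C := 0) (by
        filter_upwards [hp] with n hn
        rw [hn.2.1, dist_self, zero_mul])
      obtain ⟨L, -, hG⟩ := exists_geoSeq hd (C := R + R) (hp.mono fun n hn => hn.1) hp0 (by
        filter_upwards [hp] with n hn
        have h1 := hn.1.dist_ends
        have h2 := (hn.2.2.2 0 ⟨le_rfl, hn.1.1⟩).2
        have h3 := (hn.2.2.2 _ ⟨hn.1.1, le_rfl⟩).2
        have h4 := dist_triangle_right ((p n).1 0) ((p n).1 (p n).2) (z n)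
        linarith)
      refine Relation.ReflTransGen.head ⟨limGeo hd e (fun n => (p n).1) fun n => (p n).2, L,
        hG.isGeodesic, ?_, ?_, fun t ht hzt => ?_⟩ (ih w hwF hNw)
      · rw [hG.limGeo_zero]
        exact conePt_congr hp0 hx (hp.mono fun n hn => hn.2.1)
      · rw [hG.limGeo_len]
        exact conePt_congr (hG.isFin hd (hp.mono fun n hn => ⟨hn.1.1, le_rfl⟩)) hwF
          (hp.mono fun n hn => hn.2.2.1)
      · have h1 : 1 / 2 ≤ dist (limGeo hd e (fun n => (p n).1) (fun n => (p n).2) t)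
            (conePt hd e z) := by
          refine le_dist_conePt (hG.isFin hd (hG.clamp_mem t)) hz ?_
          filter_upwards [hp, hG.clamp_mem t] with n h1 h2
          linarith [(h1.2.2.2 _ h2).1]
        rw [hzt, dist_self] at h1
        linarith

end Limit

/-- A geodesic that visits every set of the family only briefly cannot be bypassed. -/
theorem IsAsymptoticallyTreeGraded.exists_not_chain (hA : IsAsymptoticallyTreeGraded A)
    (hM : HitConst A M) (K R : ℝ) (N : ℕ) :
    ∃ L : ℝ, ∀ (s : ℝ) (g : ℝ → X) (T r : ℝ), L ≤ s → IsGeodesic g T → T ≤ R * s → s ≤ r →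
      r + s ≤ T → (∀ i, ∀ t ∈ Set.Icc 0 T, ∀ t' ∈ Set.Icc 0 T, (∃ y ∈ A i, dist (g t) y < M) →
        (∃ y ∈ A i, dist (g t') y < M) → t' - t ≤ K) →
      ¬ Chain (g r) s R N (g 0) (g T) := by
  by_contra! hcon
  choose s g T r hs hg hTR hsr hrT hhit hchain using fun n : ℕ => hcon n
  have hd := tendsto_hyperfilter_atTop hs
  have hpos := eventually_scale_pos hd
  set z : ℕ → X := fun n => g n (r n) with hz
  have hzF : IsFin (hyperfilter ℕ) z s z := isFin_base z
  have hrm : ∀ᶠ n in (hyperfilter ℕ : Filter ℕ), r n ∈ Set.Icc 0 (T n) := by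
    filter_upwards [hpos] with n hn
    exact ⟨by linarith [hsr n], by linarith [hrT n]⟩
  have h0 : IsFin (hyperfilter ℕ) z s fun n => g n 0 := hzF.of_dist_le hd (C := R) (by
    filter_upwards [hrm] with n hn
    rw [(hg n).dist_zero hn.1 hn.2]
    linarith [hTR n, hn.2])
  obtain ⟨L, hL, hG⟩ := exists_geoSeq hd (Eventually.of_forall hg) h0 (Eventually.of_forall hTR)
  obtain ⟨ρ, hρ, hρlim, hρeq⟩ := hG.exists_limGeo_eq (hd := hd) hrm
  have hρ1 : 1 ≤ ρ := by
    refine ge_of_tendsto hρlim ?_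
    filter_upwards [hpos] with n hn
    rw [le_div_iff₀ hn]
    linarith [hsr n]
  have hρL : ρ + 1 ≤ L := by
    refine le_of_tendsto_of_tendsto (hρlim.add_const 1) hG.len ?_
    filter_upwards [hpos] with n hn
    have : r n / s n + 1 = (r n + s n) / s n := by rw [add_div, div_self hn.ne']
    rw [this]
    gcongr
    exact hrT n
  have H := hA.pieceSystem hd z
  have hT : IsFin (hyperfilter ℕ) z s fun n => g n (T n) :=
    hG.isFin hd (Eventually.of_forall fun n => ⟨(hg n).1, le_rfl⟩)
  have hj := joined_of_chain (hd := hd) hzF hT N _ h0 (Eventually.of_forall hchain)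
  rw [← hG.limGeo_zero, ← hG.limGeo_len, show conePt hd z z = _ from hρeq] at hj
  -- The limit of the chains bypasses an interior point, so a segment around it lies in a piece;
  -- then `g n` visits one set at two times differing by at least `ε / 2` times the scale, more than
  -- `K`.
  obtain ⟨a, ε, hε, hερ, hεL, hmem⟩ := H.mem_piece_of_joined hG.isGeodesic (by linarith)
    (by linarith) hj
  obtain ⟨i, hi⟩ := exists_pieceIdx_eq (hd := hd) a
  rw [hi] at hmem
  have hhit1 := hG.eventually_hit hM (a := ρ - ε) (b := ρ - ε / 2) (by linarith) (by linarith)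
    (by linarith) (hmem _ ⟨le_rfl, by linarith⟩) (hmem _ ⟨by linarith, by linarith⟩)
  have hhit2 := hG.eventually_hit hM (a := ρ + ε / 2) (b := ρ + ε) (by linarith) (by linarith)
    hεL (hmem _ ⟨by linarith, by linarith⟩) (hmem _ ⟨by linarith, le_rfl⟩)
  obtain ⟨n, ⟨t, ht, hty⟩, ⟨t', ht', hty'⟩, h3, h4, h5, h6, h7, h8⟩ := (hhit1.and (hhit2.and
    ((hG.clamp_mem (ρ - ε / 2)).and ((hG.clamp_mem (ρ + ε)).and
      ((hG.clamp_lt hd (a := ρ - ε / 2) (c := ρ - ε / 4) (by linarith)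
        ⟨by linarith, by linarith⟩).and ((hG.lt_clamp hd (a := ρ + ε / 2) (c := ρ + ε / 4)
          (by linarith) ⟨by linarith, by linarith⟩).and
          (hpos.and (hd.eventually_gt_atTop (2 * K / ε))))))))).exists
  have := hhit n (i n) t ⟨(le_max_left _ _).trans ht.1, ht.2.trans h3.2⟩ t'
    ⟨(le_max_left _ _).trans ht'.1, ht'.2.trans h4.2⟩ hty hty'
  rw [div_lt_iff₀ hε] at h8
  nlinarith [ht.2, ht'.1]

end Chain

/-! ### Bypassing the thickest point of a triangle. -/

section Bypass

variable {X : Type u} [MetricSpace X]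

/-- In a triangle, a point of maximal thickness `δ` can be bypassed by a short chain. -/
theorem exists_chain_of_thick (hX : IsGeodesicSpace X) {e f g : ℝ → X} {a b c t₀ δ : ℝ}
    (he : IsGeodesic e a) (hf : IsGeodesic f b) (hg : IsGeodesic g c) (hef : e a = f 0)
    (hfg : f b = g 0) (hge : g c = e 0) (hδ : 0 < δ) (ht₀ : t₀ ∈ Set.Icc 0 a)
    (farf : ∀ t ∈ Set.Icc 0 b, δ ≤ dist (f t) (e t₀))
    (farg : ∀ t ∈ Set.Icc 0 c, δ ≤ dist (g t) (e t₀))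
    (thine : ∀ t ∈ Set.Icc 0 a, (∃ s ∈ Set.Icc 0 b, dist (e t) (f s) ≤ δ) ∨
      ∃ s ∈ Set.Icc 0 c, dist (e t) (g s) ≤ δ)
    (thinf : ∀ t ∈ Set.Icc 0 b, (∃ s ∈ Set.Icc 0 a, dist (f t) (e s) ≤ δ) ∨
      ∃ s ∈ Set.Icc 0 c, dist (f t) (g s) ≤ δ) :
    ∃ t₁ t₂, 0 ≤ t₁ ∧ t₁ + δ ≤ t₀ ∧ t₀ + δ ≤ t₂ ∧ t₂ ≤ a ∧ t₂ - t₁ ≤ 20 * δ ∧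
      Chain (e t₀) δ 300 5 (e t₁) (e t₂) := by
  set z := e t₀ with hz
  have hb0 : (0 : ℝ) ∈ Set.Icc 0 b := ⟨le_rfl, hf.1⟩
  have hbb : b ∈ Set.Icc 0 b := ⟨hf.1, le_rfl⟩
  have hc0 : (0 : ℝ) ∈ Set.Icc 0 c := ⟨le_rfl, hg.1⟩
  have hcc : c ∈ Set.Icc 0 c := ⟨hg.1, le_rfl⟩
  have hdz : ∀ t ∈ Set.Icc 0 a, t ≤ t₀ → dist (e t) z = t₀ - t := fun t ht h =>
    he.dist_eq ht.1 h ht₀.2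
  have hdz' : ∀ t ∈ Set.Icc 0 a, t₀ ≤ t → dist (e t) z = t - t₀ := fun t ht h => by
    rw [dist_comm]; exact he.dist_eq ht₀.1 h ht.2
  have hx : δ ≤ t₀ := by
    have := farg c hcc
    rwa [hge, hdz 0 ⟨le_rfl, he.1⟩ ht₀.1, sub_zero] at this
  have hy : t₀ + δ ≤ a := by
    have := farf 0 hb0
    rw [← hef, hdz' a ⟨he.1, le_rfl⟩ ht₀.2] at this
    linarith
  -- Points `10 * δ` to either side of `z`, or the vertices if these are nearer. Each is `δ`-close
  -- to `f` or `g`; if both are close to the same edge, the bypass follows that edge.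
  obtain ⟨t₁, ht₁⟩ : ∃ t₁, t₁ = max 0 (t₀ - 10 * δ) := ⟨_, rfl⟩
  obtain ⟨t₂, ht₂⟩ : ∃ t₂, t₂ = min a (t₀ + 10 * δ) := ⟨_, rfl⟩
  have h10 : 0 ≤ t₁ := ht₁ ▸ le_max_left _ _
  have h1δ : t₁ + δ ≤ t₀ := by
    have : t₁ ≤ t₀ - δ := ht₁ ▸ max_le (by linarith) (by linarith)
    linarith
  have h1' : t₀ - 10 * δ ≤ t₁ := ht₁ ▸ le_max_right _ _
  have h2a : t₂ ≤ a := ht₂ ▸ min_le_left _ _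
  have h2δ : t₀ + δ ≤ t₂ := ht₂ ▸ le_min hy (by linarith)
  have h2' : t₂ ≤ t₀ + 10 * δ := ht₂ ▸ min_le_right _ _
  have h1a : t₁ ∈ Set.Icc 0 a := ⟨h10, by linarith⟩
  have h2m : t₂ ∈ Set.Icc 0 a := ⟨by linarith, h2a⟩
  have hd1 := hdz t₁ h1a (by linarith)
  have hd2 := hdz' t₂ h2m (by linarith)
  refine ⟨t₁, t₂, h10, h1δ, h2δ, h2a, by linarith, ?_⟩
  have hv₁ : (∃ s ∈ Set.Icc 0 b, dist (e t₁) (f s) ≤ δ ∧ Step z δ 300 (e t₁) (f s)) ∨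
      ∃ s ∈ Set.Icc 0 c, dist (e t₁) (g s) ≤ δ ∧ Step z δ 300 (e t₁) (g s) := by
    rcases max_choice 0 (t₀ - 10 * δ) with h | h <;> rw [← ht₁] at h
    · refine Or.inr ⟨c, hcc, ?_, Or.inl ?_⟩
      · rw [hge, h, dist_self]; exact hδ.le
      · rw [hge, h]
    · rcases thine t₁ h1a with ⟨s, hs, hle⟩ | ⟨s, hs, hle⟩
      · exact Or.inl ⟨s, hs, hle, Step.of_dist_le hX hle (by linarith) (by linarith)⟩
      · exact Or.inr ⟨s, hs, hle, Step.of_dist_le hX hle (by linarith) (by linarith)⟩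
  have hv₂ : (∃ s ∈ Set.Icc 0 b, dist (e t₂) (f s) ≤ δ ∧ Step z δ 300 (f s) (e t₂)) ∨
      ∃ s ∈ Set.Icc 0 c, dist (e t₂) (g s) ≤ δ ∧ Step z δ 300 (g s) (e t₂) := by
    rcases min_choice a (t₀ + 10 * δ) with h | h <;> rw [← ht₂] at h
    · refine Or.inl ⟨0, hb0, ?_, Or.inl ?_⟩
      · rw [← hef, h, dist_self]; exact hδ.le
      · rw [← hef, h]
    · rcases thine t₂ h2m with ⟨s, hs, hle⟩ | ⟨s, hs, hle⟩
      · exact Or.inl ⟨s, hs, hle, (Step.of_dist_le hX hle (by linarith) (by linarith)).symm⟩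
      · exact Or.inr ⟨s, hs, hle, (Step.of_dist_le hX hle (by linarith) (by linarith)).symm⟩
  have near₁ : ∀ {u : X}, dist (e t₁) u ≤ δ → dist u z ≤ 11 * δ := fun {u} h => by
    linarith [dist_triangle_left u z (e t₁)]
  have near₂ : ∀ {u : X}, dist (e t₂) u ≤ δ → dist u z ≤ 11 * δ := fun {u} h => by
    linarith [dist_triangle_left u z (e t₂)]
  have rf : ∀ u, Step z δ 300 u u := fun u => Or.inl rfl
  have hab : ∀ {u w : X} {p q : ℝ}, dist u z ≤ p * δ → dist w z ≤ q * δ →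
      dist u w ≤ (p + q) * δ := fun {u w p q} hu hw => by
    linarith [dist_triangle_right u w z]
  rcases hv₁ with ⟨s, hs, hle, hst⟩ | ⟨s, hs, hle, hst⟩ <;>
    rcases hv₂ with ⟨s', hs', hle', hst'⟩ | ⟨s', hs', hle', hst'⟩
  · exact ⟨_, hst, _, Step.of_far hf hδ.le hs hs' farf (near₁ hle)
      (by linarith [hab (near₁ hle) (near₂ hle')]), _, hst', _, rf _, _, rf _, rfl⟩
  -- The crossed case: `e t₁` is near `f` and `e t₂` near `g`. Follow `f` towards the vertex `e a`
  -- for `100 * δ`; the point reached is close to `g`, or to `e` beyond `t₂`, and the bypass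
  -- continues there.
  · obtain ⟨s₁, hs₁⟩ : ∃ s₁, s₁ = max 0 (s - 100 * δ) := ⟨_, rfl⟩
    have hs₁m : s₁ ∈ Set.Icc 0 b :=
      ⟨hs₁ ▸ le_max_left _ _, hs₁ ▸ max_le hf.1 (by linarith [hs.2])⟩
    have hs₁s : s₁ ≤ s := hs₁ ▸ max_le hs.1 (by linarith)
    have hs₁d : dist (f s) (f s₁) ≤ 100 * δ := by
      rw [dist_comm, hf.dist_eq hs₁m.1 hs₁s hs.2]
      have : s - 100 * δ ≤ s₁ := hs₁ ▸ le_max_right _ _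
      linarith
    have hfs := near₁ hle
    have hstep₁ : Step z δ 300 (f s) (f s₁) := Step.of_far hf hδ.le hs hs₁m farf hfs (by linarith)
    have hfs₁ : dist (f s₁) z ≤ 111 * δ := by linarith [dist_triangle_left (f s₁) z (f s)]
    have viaE : ∀ t ∈ Set.Icc 0 a, t₂ ≤ t → dist (f s₁) (e t) ≤ δ → Step z δ 300 (f s₁) (e t) →
        Chain z δ 300 5 (e t₁) (e t₂) := by
      intro t ht htt hd hstep
      have hdt := hdz' t ht (by linarith)
      have hdt' : dist (e t) z ≤ 112 * δ := by linarith [dist_triangle_left (e t) z (f s₁)]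
      refine ⟨_, hst, _, hstep₁, _, hstep, _, (Step.of_le he h2m.1 htt ht.2 fun r hr => ?_).symm, _,
        rf _, rfl⟩
      rw [hdz' r ⟨by linarith [hr.1, h2m.1], hr.2.trans ht.2⟩ (by linarith [hr.1])]
      exact ⟨by linarith [hr.1], by linarith [hr.2]⟩
    rcases max_choice 0 (s - 100 * δ) with h | h <;> rw [← hs₁] at h
    · exact viaE a ⟨he.1, le_rfl⟩ h2a (by rw [h, hef, dist_self]; exact hδ.le)
        (Or.inl (by rw [h, hef]))
    · have hlow : 89 * δ ≤ dist (f s₁) z := by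
        have h1 : dist (f s₁) (f s) = 100 * δ := by
          rw [hf.dist_eq hs₁m.1 hs₁s hs.2]; linarith
        linarith [dist_triangle_right (f s₁) (f s) z]
      rcases thinf s₁ hs₁m with ⟨t, ht, hd⟩ | ⟨t, ht, hd⟩
      · have hchord := Step.of_dist_le (R := 300) hX hd (by linarith) (by linarith : dist (f s₁) z + δ ≤ _)
        have hdt : 88 * δ ≤ dist (e t) z := by linarith [dist_triangle (f s₁) (e t) z]
        rcases le_total t t₀ with htt | htt
        -- Here `e t` is farther from `e a` than `e t₁`, although `f s₁` is `100 * δ` closer to `e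
        -- a` than `f s`, which is near `e t₁`.
        · exfalso
          have h1 := hf.dist_zero hs₁m.1 hs₁m.2
          have h2 := hf.dist_zero hs.1 hs.2
          have h3 := he.dist_eq ht.1 ht.2 le_rfl
          have h4 := he.dist_eq h1a.1 h1a.2 le_rfl
          rw [← hef] at h1 h2
          have h5 := dist_triangle_left (e a) (f s) (e t₁)
          have h6 := dist_triangle (e t) (f s₁) (e a)
          have h7 := hdz t ht htt
          rw [dist_comm (e t) (f s₁), dist_comm (f s₁) (e a)] at h6
          have h8 := dist_triangle (e a) (e t₁) (f s)
          rw [dist_comm (e a) (e t₁)] at h8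
          linarith
        · rw [hdz' t ht htt] at hdt
          exact viaE t ht (by linarith) hd hchord
      · have hchord := Step.of_dist_le (R := 300) hX hd (by linarith) (by linarith : dist (f s₁) z + δ ≤ _)
        have hgt : dist (g t) z ≤ 112 * δ := by linarith [dist_triangle_left (g t) z (f s₁)]
        exact ⟨_, hst, _, hstep₁, _, hchord, _, Step.of_far hg hδ.le ht hs' farg hgt
          (by linarith [hab hgt (near₂ hle')]), _, hst', rfl⟩
  -- The mirrored case: `e t₁` is near `g` and `e t₂` near `f`, so `f` is followed away from `e a`.
  · obtain ⟨s₁, hs₁⟩ : ∃ s₁, s₁ = min b (s' + 100 * δ) := ⟨_, rfl⟩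
    have hs₁m : s₁ ∈ Set.Icc 0 b :=
      ⟨hs₁ ▸ le_min hf.1 (by linarith [hs'.1]), hs₁ ▸ min_le_left _ _⟩
    have hs₁s : s' ≤ s₁ := hs₁ ▸ le_min hs'.2 (by linarith)
    have hs₁d : dist (f s') (f s₁) ≤ 100 * δ := by
      rw [hf.dist_eq hs'.1 hs₁s hs₁m.2]
      have : s₁ ≤ s' + 100 * δ := hs₁ ▸ min_le_right _ _
      linarith
    have hfs := near₂ hle'
    have hstep₁ : Step z δ 300 (f s₁) (f s') :=
      (Step.of_far hf hδ.le hs' hs₁m farf hfs (by linarith)).symm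
    have hfs₁ : dist (f s₁) z ≤ 111 * δ := by linarith [dist_triangle_left (f s₁) z (f s')]
    have viaG : ∀ t ∈ Set.Icc 0 c, dist (f s₁) (g t) ≤ δ → Step z δ 300 (f s₁) (g t) →
        Chain z δ 300 5 (e t₁) (e t₂) := by
      intro t ht hd hstep
      have hgt : dist (g t) z ≤ 112 * δ := by linarith [dist_triangle_left (g t) z (f s₁)]
      exact ⟨_, hst, _, (Step.of_far hg hδ.le ht hs farg hgt
        (by linarith [hab hgt (near₁ hle)])).symm, _, hstep.symm, _, hstep₁, _, hst', rfl⟩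
    rcases min_choice b (s' + 100 * δ) with h | h <;> rw [← hs₁] at h
    · exact viaG 0 hc0 (by rw [h, hfg, dist_self]; exact hδ.le) (Or.inl (by rw [h, hfg]))
    · have hlow : 89 * δ ≤ dist (f s₁) z := by
        have h1 : dist (f s') (f s₁) = 100 * δ := by
          rw [hf.dist_eq hs'.1 hs₁s hs₁m.2]; linarith
        rw [dist_comm] at h1
        linarith [dist_triangle_right (f s₁) (f s') z]
      rcases thinf s₁ hs₁m with ⟨t, ht, hd⟩ | ⟨t, ht, hd⟩
      · have hchord := Step.of_dist_le (R := 300) hX hd (by linarith) (by linarith : dist (f s₁) z + δ ≤ _)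
        have hdt : 88 * δ ≤ dist (e t) z := by linarith [dist_triangle (f s₁) (e t) z]
        have hdt' : dist (e t) z ≤ 112 * δ := by linarith [dist_triangle_left (e t) z (f s₁)]
        rcases le_total t t₀ with htt | htt
        · have h7 := hdz t ht htt
          refine ⟨_, (Step.of_le he ht.1 (by linarith : t ≤ t₁) h1a.2 fun r hr => ?_).symm, _,
            hchord.symm, _, hstep₁, _, hst', _, rf _, rfl⟩
          rw [hdz r ⟨ht.1.trans hr.1, hr.2.trans h1a.2⟩ (by linarith [hr.2])]
          exact ⟨by linarith [hr.2], by linarith [hr.1]⟩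
        · exfalso
          have h1 := hf.dist_zero hs₁m.1 hs₁m.2
          have h2 := hf.dist_zero hs'.1 hs'.2
          have h3 := he.dist_eq ht.1 ht.2 le_rfl
          have h4 := he.dist_eq h2m.1 h2m.2 le_rfl
          rw [← hef] at h1 h2
          have h6 := dist_triangle (f s₁) (e t) (e a)
          have h7 := hdz' t ht htt
          have h8 := dist_triangle (e t₂) (f s') (e a)
          rw [dist_comm (f s₁) (e a)] at h6
          rw [dist_comm (f s') (e a)] at h8
          linarith
      · exact viaG t ht hd (Step.of_dist_le hX hd (by linarith) (by linarith))
  · exact ⟨_, hst, _, Step.of_far hg hδ.le hs hs' farg (near₁ hle)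
      (by linarith [hab (near₁ hle) (near₂ hle')]), _, hst', _, rf _, _, rf _, rfl⟩

end Bypass

end TreeGraded

namespace TreeGraded

/-! ### Thin triangles and polygons -/

section Thin

variable {X : Type u} [MetricSpace X] {ι : Type v} {A : ι → Set X} {M : ℝ}

/-- The geodesic `g` visits each `A i` during a time of length at most `K`. -/
def BriefVisits (A : ι → Set X) (M K : ℝ) (g : ℝ → X) (T : ℝ) : Prop :=
  ∀ i, ∀ t ∈ Set.Icc 0 T, ∀ t' ∈ Set.Icc 0 T, (∃ y ∈ A i, dist (g t) y < M) →
    (∃ y ∈ A i, dist (g t') y < M) → t' - t ≤ K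

theorem BriefVisits.sub {K T s t : ℝ} {g : ℝ → X} (h : BriefVisits A M K g T) (hs : 0 ≤ s)
    (ht : t ≤ T) : BriefVisits A M K (fun r => g (s + r)) (t - s) := by
  intro i r hr r' hr' h1 h2
  have := h i (s + r) ⟨by linarith [hr.1], by linarith [hr.2]⟩ (s + r')
    ⟨by linarith [hr'.1], by linarith [hr'.2]⟩ h1 h2
  linarith

theorem BriefVisits.reverse {K T : ℝ} {g : ℝ → X} (h : BriefVisits A M K g T) :
    BriefVisits A M K (fun r => g (T - r)) T := by
  intro i r hr r' hr' h1 h2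
  have := h i (T - r') ⟨by linarith [hr'.2], by linarith [hr'.1]⟩ (T - r)
    ⟨by linarith [hr.2], by linarith [hr.1]⟩ h2 h1
  linarith

/-- A large maximal thickness provides its own scale: at a point where it is attained there is a
bypass of bounded combinatorial size, which brief visits exclude. -/
theorem IsAsymptoticallyTreeGraded.exists_thin (hX : IsGeodesicSpace X)
    (hA : IsAsymptoticallyTreeGraded A) (hM : HitConst A M) (K : ℝ) :
    ∃ δ : ℝ, 0 < δ ∧ ∀ (q : Fin 3 → ℝ → X) (ℓ : Fin 3 → ℝ), (∀ j, IsGeodesic (q j) (ℓ j)) →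
      (∀ j, q j (ℓ j) = q (j + 1) 0) → (∀ j, BriefVisits A M K (q j) (ℓ j)) →
      ∀ j, ∀ t ∈ Set.Icc 0 (ℓ j), (∃ s ∈ Set.Icc 0 (ℓ (j + 1)), dist (q j t) (q (j + 1) s) ≤ δ) ∨
        ∃ s ∈ Set.Icc 0 (ℓ (j + 2)), dist (q j t) (q (j + 2) s) ≤ δ := by
  obtain ⟨L, hL⟩ := hA.exists_not_chain hM K 300 5
  refine ⟨max L 1, by positivity, fun q ℓ hq hcl hbrief => ?_⟩
  set U : Fin 3 → Set X := fun j => q (j + 1) '' Set.Icc 0 (ℓ (j + 1)) ∪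
    q (j + 2) '' Set.Icc 0 (ℓ (j + 2)) with hU
  have hUc : ∀ j, IsCompact (U j) := fun j => (hq _).isCompact_image.union (hq _).isCompact_image
  have hUn : ∀ j, (U j).Nonempty := fun j => ⟨_, Or.inl ⟨0, ⟨le_rfl, (hq _).1⟩, rfl⟩⟩
  have attain : ∀ {δ : ℝ} (j : Fin 3) (x : X), infDist x (U j) ≤ δ →
      (∃ s ∈ Set.Icc 0 (ℓ (j + 1)), dist x (q (j + 1) s) ≤ δ) ∨
        ∃ s ∈ Set.Icc 0 (ℓ (j + 2)), dist x (q (j + 2) s) ≤ δ := by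
    intro δ j x hle
    obtain ⟨y, hy, heq⟩ := (hUc j).exists_infDist_eq_dist (hUn j) x
    rw [heq] at hle
    rcases hy with ⟨s, hs, rfl⟩ | ⟨s, hs, rfl⟩
    exacts [Or.inl ⟨s, hs, hle⟩, Or.inr ⟨s, hs, hle⟩]
  have hmax : ∀ j, ∃ t ∈ Set.Icc 0 (ℓ j), ∀ t' ∈ Set.Icc 0 (ℓ j),
      infDist (q j t') (U j) ≤ infDist (q j t) (U j) := by
    intro j
    obtain ⟨t, ht, h⟩ := isCompact_Icc.exists_isMaxOn (Set.nonempty_Icc.2 (hq j).1)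
      ((continuous_infDist_pt (U j)).comp_continuousOn (hq j).continuousOn)
    exact ⟨t, ht, isMaxOn_iff.1 h⟩
  choose t ht htmax using hmax
  -- The maximum runs over all three edges, because the bypass also uses that the second edge is
  -- `δ`-close to the others.
  obtain ⟨j, hj⟩ := Finite.exists_max fun j => infDist (q j (t j)) (U j)
  set δ := infDist (q j (t j)) (U j) with hδ
  have hall : ∀ k, ∀ r ∈ Set.Icc 0 (ℓ k), infDist (q k r) (U k) ≤ δ := fun k r hr =>
    (htmax k r hr).trans (hj k)
  have hδle : δ ≤ max L 1 := by
    by_contra! hlt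
    have hδ0 : 0 < δ := lt_of_lt_of_le one_pos ((le_max_right L 1).trans hlt.le)
    have hδL : L ≤ δ := (le_max_left L 1).trans hlt.le
    have hfar : ∀ y ∈ U j, δ ≤ dist y (q j (t j)) := fun y hy => by
      rw [dist_comm]; exact infDist_le_dist_of_mem hy
    have h2 : j + 1 + 1 = j + 2 := (show ∀ j : Fin 3, j + 1 + 1 = j + 2 by decide) j
    have h3 : j + 1 + 2 = j := (show ∀ j : Fin 3, j + 1 + 2 = j by decide) j
    obtain ⟨t₁, t₂, h10, h1δ, h2δ, h2a, h20, hchain⟩ := exists_chain_of_thick hX (hq j)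
      (hq (j + 1)) (hq (j + 2)) (hcl j) (by rw [hcl, h2]) (by rw [hcl, fin3_add_two_add_one]) hδ0
      (ht j) (fun r hr => hfar _ (Or.inl ⟨r, hr, rfl⟩)) (fun r hr => hfar _ (Or.inr ⟨r, hr, rfl⟩))
      (fun r hr => attain j _ (hall j r hr)) (fun r hr => by
        have := attain (j + 1) _ (hall (j + 1) r hr)
        rw [h2, h3] at this
        exact this.symm)
    refine hL δ (fun r => q j (t₁ + r)) (t₂ - t₁) (t j - t₁) hδL
      (((hq j).shift h10 (by linarith)).initial (by linarith) (by linarith)) (by linarith)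
      (by linarith) (by linarith) ((hbrief j).sub h10 h2a) ?_
    simpa using hchain
  exact fun k r hr => attain k _ ((hall k r hr).trans hδle)

/-- All almost projections of `x` and `y` are at distance at most `K`. -/
def AllProjClose (A : ι → Set X) (K : ℝ) (x y : X) : Prop :=
  ∀ i, ProjClose A i K x y

/-- The constants in the bounded projection property. -/
structure ProjConst (A : ι → Set X) (M₁ C : ℝ) : Prop where
  pos : 0 < M₁
  nonneg : 0 ≤ C
  projClose : ∀ (i : ι) (g : ℝ → X) (ℓ : ℝ), IsGeodesic g ℓ →
    (∀ t ∈ Set.Icc 0 ℓ, ∀ y ∈ A i, M₁ ≤ dist (g t) y) → ProjClose A i C (g 0) (g ℓ)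

theorem IsAsymptoticallyTreeGraded.exists_projConst (hX : IsGeodesicSpace X)
    (hA : IsAsymptoticallyTreeGraded A) (hM : HitConst A M) :
    ∃ M₁ C, M ≤ M₁ ∧ ProjConst A M₁ C := by
  obtain ⟨M₁, C, h1, h2, h⟩ := hA.exists_projClose hX hM
  exact ⟨max M M₁, C, le_max_left _ _, lt_max_of_lt_right h1, h2, fun i g ℓ hg hfar =>
    h i g ℓ hg fun t ht y hy => (le_max_right _ _).trans (hfar t ht y hy)⟩

variable {M₁ C : ℝ}

/-- The projection of the origin of a geodesic is close to the point where it enters the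
neighbourhood of `A i`. -/
theorem ProjConst.dist_first_hit_le (h : ProjConst A M₁ C) {i : ι} {g : ℝ → X} {ℓ a : ℝ}
    (hg : IsGeodesic g ℓ) (ha : a ∈ Set.Icc 0 ℓ)
    (hout : ∀ t ∈ Set.Ico 0 a, ∀ y ∈ A i, M₁ ≤ dist (g t) y)
    (hnear : ∃ y ∈ A i, dist (g a) y ≤ M₁ + 1) {p : X} (hp : IsProj A i (g 0) p) :
    dist p (g a) ≤ C + M₁ + 4 := by
  obtain ⟨y, hy, hya⟩ := hnear
  rcases le_total a 1 with h1 | h1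
  · have h2 := hp.2 y hy
    have h3 := hg.dist_zero ha.1 ha.2
    have h4 := dist_triangle (g 0) (g a) y
    have h5 := dist_triangle_left p (g a) (g 0)
    linarith [h.nonneg]
  -- One unit before entering, the geodesic is still outside on a closed interval, and its position
  -- is already near its projection.
  · obtain ⟨r, hr⟩ := exists_isProj ⟨y, hy⟩ (g (a - 1))
    have h2 := h.projClose i g (a - 1) (hg.initial (by linarith) (by linarith [ha.2]))
      (fun t ht => hout t ⟨ht.1, by linarith [ht.2]⟩) p r hp hr
    have h3 := hr.2 y hy
    have h4 := hg.dist_eq (s := a - 1) (t := a) (by linarith) (by linarith) ha.2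
    have h5 := dist_triangle (g (a - 1)) (g a) y
    have h6 := dist_triangle4 p r (g (a - 1)) (g a)
    rw [dist_comm r] at h6
    linarith

/-- First time at which a geodesic enters the neighbourhood of `A i`. -/
theorem exists_first_near (hM₁ : 0 < M₁) {i : ι} {g : ℝ → X} {ℓ t : ℝ} (hg : IsGeodesic g ℓ)
    (ht : t ∈ Set.Icc 0 ℓ) (hnear : ∃ y ∈ A i, dist (g t) y < M₁) :
    ∃ a ∈ Set.Icc 0 t, (∃ y ∈ A i, dist (g a) y ≤ M₁ + 1) ∧
      ∀ r ∈ Set.Ico 0 a, ∀ y ∈ A i, M₁ ≤ dist (g r) y := by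
  obtain ⟨a, ha, hmem, hfirst⟩ := hg.exists_first (S := cthickening M₁ (A i)) isClosed_cthickening
    le_rfl ht.2 (r := t) ⟨ht.1, le_rfl⟩
    (thickening_subset_cthickening _ _ (mem_thickening_iff.2 hnear))
  refine ⟨a, ha, ?_, fun r hr y hy => ?_⟩
  · obtain ⟨y, hy, hlt⟩ := mem_thickening_iff.1
      (cthickening_subset_thickening' (by linarith) (by linarith : M₁ < M₁ + 1) _ hmem)
    exact ⟨y, hy, hlt.le⟩
  · by_contra! hlt
    have := hfirst r ⟨hr.1, hr.2.le.trans ha.2⟩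
      (thickening_subset_cthickening _ _ (mem_thickening_iff.2 ⟨y, hy, hlt⟩))
    linarith [hr.2]

theorem exists_last_near (hM₁ : 0 < M₁) {i : ι} {g : ℝ → X} {ℓ t : ℝ} (hg : IsGeodesic g ℓ)
    (ht : t ∈ Set.Icc 0 ℓ) (hnear : ∃ y ∈ A i, dist (g t) y < M₁) :
    ∃ b ∈ Set.Icc t ℓ, (∃ y ∈ A i, dist (g b) y ≤ M₁ + 1) ∧
      ∀ r ∈ Set.Ioc b ℓ, ∀ y ∈ A i, M₁ ≤ dist (g r) y := by
  obtain ⟨a, ha, hn, hout⟩ := exists_first_near hM₁ hg.reverse (t := ℓ - t)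
    ⟨by linarith [ht.2], by linarith [ht.1]⟩ (by simpa using hnear)
  refine ⟨ℓ - a, ⟨by linarith [ha.2], by linarith [ha.1]⟩, hn, fun r hr => ?_⟩
  have := hout (ℓ - r) ⟨by linarith [hr.2], by linarith [hr.1]⟩
  simpa using this

theorem ProjConst.dist_last_hit_le (h : ProjConst A M₁ C) {i : ι} {g : ℝ → X} {ℓ b : ℝ}
    (hg : IsGeodesic g ℓ) (hb : b ∈ Set.Icc 0 ℓ)
    (hout : ∀ t ∈ Set.Ioc b ℓ, ∀ y ∈ A i, M₁ ≤ dist (g t) y)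
    (hnear : ∃ y ∈ A i, dist (g b) y ≤ M₁ + 1) {p : X} (hp : IsProj A i (g ℓ) p) :
    dist p (g b) ≤ C + M₁ + 4 := by
  have := h.dist_first_hit_le hg.reverse (a := ℓ - b) ⟨by linarith [hb.2], by linarith [hb.1]⟩
    (fun t ht => hout _ ⟨by linarith [ht.2], by linarith [ht.1]⟩) (by simpa using hnear)
    (by simpa using hp)
  simpa using this

/-- The first entry into the neighbourhood of `A i` is near the projection of one end and the last
exit near that of the other, so all visits happen between two nearby points. -/
theorem ProjConst.briefVisits (h : ProjConst A M₁ C) (hM : M ≤ M₁) {K : ℝ} {g : ℝ → X} {ℓ : ℝ}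
    (hg : IsGeodesic g ℓ) (hK : AllProjClose A K (g 0) (g ℓ)) :
    BriefVisits A M (K + 2 * (C + M₁ + 4)) g ℓ := by
  intro i t ht t' ht' hnt hnt'
  obtain ⟨y, hy, hlt⟩ := hnt
  obtain ⟨y', hy', hlt'⟩ := hnt'
  obtain ⟨a, ha, han, hao⟩ := exists_first_near h.pos hg ht ⟨y, hy, hlt.trans_le hM⟩
  obtain ⟨b, hb, hbn, hbo⟩ := exists_last_near h.pos hg ht' ⟨y', hy', hlt'.trans_le hM⟩
  obtain ⟨p, hp⟩ := exists_isProj ⟨y, hy⟩ (g 0)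
  obtain ⟨p', hp'⟩ := exists_isProj ⟨y, hy⟩ (g ℓ)
  have ha' : a ∈ Set.Icc 0 ℓ := ⟨ha.1, ha.2.trans ht.2⟩
  have hb' : b ∈ Set.Icc 0 ℓ := ⟨ht'.1.trans hb.1, hb.2⟩
  have h1 := h.dist_first_hit_le hg ha' hao han hp
  have h2 := h.dist_last_hit_le hg hb' hbo hbn hp'
  have h3 := hK i p p' hp hp'
  have h4 := dist_triangle4 (g a) p p' (g b)
  rw [dist_comm (g a) p, hg.2 a ha' b hb', abs_sub_comm] at h4
  have h5 := le_abs_self (b - a)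
  linarith [ha.2, hb.1]

/-- Triangles with vertices in `V` are thin. -/
def ThinOn (V : Set X) (δ : ℝ) : Prop :=
  ∀ (e f g : ℝ → X) (a b c : ℝ), IsGeodesic e a → IsGeodesic f b → IsGeodesic g c → e 0 = f 0 →
    f b = g 0 → g c = e a → e 0 ∈ V → e a ∈ V → f b ∈ V → ∀ t ∈ Set.Icc 0 a,
      (∃ s ∈ Set.Icc 0 b, dist (e t) (f s) ≤ δ) ∨ ∃ s ∈ Set.Icc 0 c, dist (e t) (g s) ≤ δ

theorem IsAsymptoticallyTreeGraded.exists_thinOn (hX : IsGeodesicSpace X)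
    (hA : IsAsymptoticallyTreeGraded A) (hM : HitConst A M) (h : ProjConst A M₁ C) (hMM : M ≤ M₁)
    (K : ℝ) : ∃ δ : ℝ, 0 < δ ∧ ∀ V : Set X,
      (∀ x ∈ V, ∀ y ∈ V, AllProjClose A K x y) → ThinOn V δ := by
  obtain ⟨δ, hδ, hthin⟩ := hA.exists_thin hX hM (K + 2 * (C + M₁ + 4))
  refine ⟨δ, hδ, fun V hV e f g a b c he hf hg hef hfg hge h0 ha hb t ht => ?_⟩
  have hbe := h.briefVisits hMM he (hV _ h0 _ ha)
  have hbf := (h.briefVisits hMM hf (hV _ (by rwa [← hef]) _ hb)).reverse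
  have hbg := (h.briefVisits hMM hg (hV _ (by rwa [← hfg]) _ (by rwa [hge]))).reverse
  have key := hthin ![e, fun r => g (c - r), fun r => f (b - r)] ![a, c, b]
    (by intro j; fin_cases j; exacts [he, hg.reverse, hf.reverse])
    (by
      intro j
      fin_cases j
      · change e a = g (c - 0); rw [sub_zero, hge]
      · change g (c - c) = f (b - 0); rw [sub_self, sub_zero, hfg]
      · change f (b - b) = e 0; rw [sub_self, hef])
    (by intro j; fin_cases j; exacts [hbe, hbg, hbf]) 0 t ht
  rcases key with ⟨s, hs, hle⟩ | ⟨s, hs, hle⟩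
  · exact Or.inr ⟨c - s, ⟨by linarith [hs.2, (show s ≤ c from hs.2)], by linarith [hs.1]⟩, hle⟩
  · exact Or.inl ⟨b - s, ⟨by linarith [hs.2, (show s ≤ b from hs.2)], by linarith [hs.1]⟩, hle⟩

/-- Polygons with vertices in `V` are thin. -/
theorem ThinOn.polygon (hX : IsGeodesicSpace X) {V : Set X} {δ : ℝ} (hV : ThinOn V δ) {x : ℕ → X}
    (hx : ∀ p, x p ∈ V) {q : ℕ → ℝ → X} {l : ℕ → ℝ} (hq : ∀ p, IsGeodesic (q p) (l p))
    (h0 : ∀ p, q p 0 = x p) (h1 : ∀ p, q p (l p) = x (p + 1)) (m : ℕ) :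
    ∀ (e : ℝ → X) (a : ℝ), IsGeodesic e a → e 0 = x 0 → e a = x m → ∀ t ∈ Set.Icc 0 a,
      dist (e t) (x 0) ≤ m * δ ∨ ∃ p < m, ∃ s ∈ Set.Icc 0 (l p), dist (e t) (q p s) ≤ m * δ := by
  induction m with
  | zero =>
    intro e a he he0 hea t ht
    left
    have ha : a = 0 := by rw [← he.dist_ends, he0, hea, dist_self]
    subst ha
    rw [le_antisymm ht.2 ht.1, he0, dist_self]
    simp
  | succ m ih =>
    intro e a he he0 hea t ht
    -- A diagonal cuts off the last edge; each triangle costs one `δ`.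
    obtain ⟨f, b, hf, hf0, hfb, -⟩ := hX (x 0) trivial (x m) trivial
    have hδ : 0 ≤ δ := by
      rcases hV e f (q m) a b (l m) he hf (hq m) (he0.trans hf0.symm) (hfb.trans (h0 m).symm)
        ((h1 m).trans hea.symm) (he0 ▸ hx 0) (hea ▸ hx _) (hfb ▸ hx _) t ht with
        ⟨s, hs, hle⟩ | ⟨s, hs, hle⟩ <;> exact dist_nonneg.trans hle
    push_cast
    rcases hV e f (q m) a b (l m) he hf (hq m) (he0.trans hf0.symm) (hfb.trans (h0 m).symm)
      ((h1 m).trans hea.symm) (he0 ▸ hx 0) (hea ▸ hx _) (hfb ▸ hx _) t ht with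
      ⟨s, hs, hle⟩ | ⟨s, hs, hle⟩
    · rcases ih f b hf hf0 hfb s hs with h | ⟨p, hp, r, hr, h⟩
      · left
        linarith [dist_triangle (e t) (f s) (x 0)]
      · exact Or.inr ⟨p, by omega, r, hr, by linarith [dist_triangle (e t) (f s) (q p r)]⟩
    · refine Or.inr ⟨m, by omega, s, hs, hle.trans ?_⟩
      nlinarith [mul_nonneg (Nat.cast_nonneg (α := ℝ) m) hδ]

end Thin

end TreeGraded

namespace TreeGraded

/-! ### Projections of a closed path of geodesics -/

section ClosedPath

variable {X : Type u} [MetricSpace X] {ι : Type v} {A : ι → Set X} {M₁ C : ℝ} {i : ι}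

/-- `x` is at distance at least `r` from `A i`. -/
def FarFrom (A : ι → Set X) (i : ι) (r : ℝ) (x : X) : Prop :=
  ∀ y ∈ A i, r ≤ dist x y

theorem exists_proj_forward (h : ProjConst A M₁ C) {q : ℕ → ℝ → X} {l : ℕ → ℝ}
    (hq : ∀ n, IsGeodesic (q n) (l n)) (hcl : ∀ n, q n (l n) = q (n + 1) 0) {p : X}
    (hp : IsProj A i (q 0 0) p) (n : ℕ)
    (hout : ∀ m < n, ∀ t ∈ Set.Icc 0 (l m), FarFrom A i M₁ (q m t)) :
    ∃ r, IsProj A i (q n 0) r ∧ dist p r ≤ n * C := by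
  induction n with
  | zero => exact ⟨p, hp, by simp⟩
  | succ n ih =>
    obtain ⟨r, hr, hle⟩ := ih fun m hm => hout m (by omega)
    obtain ⟨r', hr'⟩ := exists_isProj ⟨p, hp.1⟩ (q (n + 1) 0)
    refine ⟨r', hr', ?_⟩
    have := h.projClose i (q n) (l n) (hq n) (hout n (by omega)) r r' hr (by rwa [hcl])
    push_cast
    linarith [dist_triangle p r r']

theorem exists_proj_backward (h : ProjConst A M₁ C) {q : ℕ → ℝ → X} {l : ℕ → ℝ}
    (hq : ∀ n, IsGeodesic (q n) (l n)) (hcl : ∀ n, q n (l n) = q (n + 1) 0) {p : X} (d : ℕ) :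
    ∀ n, IsProj A i (q (n + d) 0) p →
      (∀ m, n ≤ m → m < n + d → ∀ t ∈ Set.Icc 0 (l m), FarFrom A i M₁ (q m t)) →
      ∃ r, IsProj A i (q n 0) r ∧ dist p r ≤ d * C := by
  induction d with
  | zero => exact fun n hp _ => ⟨p, hp, by simp⟩
  | succ d ih =>
    intro n hp hout
    obtain ⟨r, hr, hle⟩ := ih (n + 1) (by rwa [add_assoc, add_comm 1 d]) fun m hm hm' =>
      hout m (by omega) (by omega)
    obtain ⟨w, hw⟩ := exists_isProj ⟨p, hp.1⟩ (q n 0)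
    refine ⟨w, hw, ?_⟩
    have := h.projClose i (q n) (l n) (hq n) (hout n le_rfl (by omega)) w r hw (by rwa [hcl])
    push_cast
    linarith [dist_triangle p r w, dist_comm r w]

/-- A closed path of `k` long geodesics, nonadjacent ones being far from each other, with trimming
times `T` at the corners: for times `t > T (n + 1)`, the point at time `t` before the end of `q n` is
far from the one at time `t` after the beginning of `q (n + 1)`. -/
structure FatPath (X : Type u) [MetricSpace X] (k : ℕ) (θ C₃ : ℝ) where
  q : ℕ → ℝ → X
  l : ℕ → ℝ
  T : ℕ → ℝ
  geo : ∀ n, IsGeodesic (q n) (l n)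
  closes : ∀ n, q n (l n) = q (n + 1) 0
  cyclic : q k 0 = q 0 0
  long : ∀ n, 8 * θ ≤ l n
  near : ∀ n n', n < n' → n' < k → ∀ s ∈ Set.Icc 0 (l n), ∀ t ∈ Set.Icc 0 (l n'),
    dist (q n s) (q n' t) < θ → (n = 0 ∧ s < 2 * θ) ∨ (n' = n + 1 ∧ l n - s < 2 * θ)
  T_nonneg : ∀ n, 0 ≤ T n
  T_lt : ∀ n, T n < 2 * θ
  le_T : ∀ n t, 0 ≤ t → t ≤ 4 * θ → dist (q n (l n - t)) (q (n + 1) t) ≤ C₃ → t ≤ T (n + 1)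

/-- The trimmed corners of a fat path whose origin is far from `A i` project to `A i` close to the
projection of the origin. -/
theorem FatPath.dist_proj_le {k : ℕ} {θ B : ℝ} (D : FatPath X k θ (2 * B)) (h : ProjConst A M₁ C)
    (hB : B = 2 * (k * C + (C + M₁ + 4))) (hBθ : B < θ) (hfar : FarFrom A i (2 * θ + M₁ + 2) (D.q 0 0))
    {n : ℕ} (hn : n < k) {t : ℝ} (ht : t = D.T n ∨ t = D.l n - D.T (n + 1)) {p r : X}
    (hp : IsProj A i (D.q 0 0) p) (hr : IsProj A i (D.q n t) r) :
    dist p r ≤ 3 * B + (k + 1) * C + M₁ + 2 := by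
  have hC := h.nonneg
  have hM₁ := h.pos
  have hθ : 0 < θ := by
    have : 0 ≤ B := by rw [hB]; positivity
    linarith
  have hk0 : (0 : ℝ) ≤ k := Nat.cast_nonneg k
  have hB0 : 0 ≤ B := by rw [hB]; positivity
  have ht' : t ∈ Set.Icc 0 (D.l n) := by
    rcases ht with rfl | rfl
    · exact ⟨D.T_nonneg n, by linarith [D.T_lt n, D.long n]⟩
    · exact ⟨by linarith [D.T_lt (n + 1), D.long n], by linarith [D.T_nonneg (n + 1)]⟩
  have hcast : ∀ {a : ℕ}, a ≤ k → (a : ℝ) * C ≤ k * C := fun ha =>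
    mul_le_mul_of_nonneg_right (Nat.cast_le.2 ha) hC
  have before : (∀ m < n, ∀ s ∈ Set.Icc 0 (D.l m), FarFrom A i M₁ (D.q m s)) →
      (∀ s ∈ Set.Icc 0 t, FarFrom A i M₁ (D.q n s)) → dist p r ≤ 3 * B + (k + 1) * C + M₁ + 2 := by
    intro h1 h2
    obtain ⟨w, hw, hle⟩ := exists_proj_forward h D.geo D.closes hp n h1
    have := h.projClose i (D.q n) t ((D.geo n).initial ht'.1 ht'.2) h2 w r hw hr
    linarith [dist_triangle p w r, hcast hn.le]
  have hpk : IsProj A i (D.q k 0) p := by rwa [D.cyclic]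
  -- The path is closed, so the origin can also be reached by going forward to index `k`.
  have back : ∀ a < k, (∀ m, a < m → m < k → ∀ s ∈ Set.Icc 0 (D.l m), FarFrom A i M₁ (D.q m s)) →
      ∃ w, IsProj A i (D.q a (D.l a)) w ∧ dist p w ≤ k * C := by
    intro a hak h1
    obtain ⟨w, hw, hle⟩ := exists_proj_backward h D.geo D.closes (p := p) (k - (a + 1)) (a + 1)
      (by rwa [Nat.add_sub_cancel' hak]) fun m hm hm' => h1 m (by omega) (by omega)
    exact ⟨w, by rwa [D.closes], hle.trans (hcast (by omega))⟩
  have after : (∀ m, n < m → m < k → ∀ s ∈ Set.Icc 0 (D.l m), FarFrom A i M₁ (D.q m s)) →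
      (∀ s ∈ Set.Icc t (D.l n), FarFrom A i M₁ (D.q n s)) →
        dist p r ≤ 3 * B + (k + 1) * C + M₁ + 2 := by
    intro h1 h2
    obtain ⟨w, hw, hle⟩ := back n hn h1
    have := h.projClose i (fun s => D.q n (t + s)) (D.l n - t) ((D.geo n).shift ht'.1 ht'.2)
      (fun s hs => h2 _ ⟨by linarith [hs.1], by linarith [hs.2]⟩) r w (by simpa using hr)
      (by simpa using hw)
    linarith [dist_triangle p w r, dist_comm r w]
  classical
  set S : Finset ℕ := (Finset.range k).filter fun m => ∃ s ∈ Set.Icc 0 (D.l m), ∃ y ∈ A i,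
    dist (D.q m s) y < M₁ with hS
  have hSmem : ∀ {m : ℕ}, m ∈ S ↔ m < k ∧ ∃ s ∈ Set.Icc 0 (D.l m), ∃ y ∈ A i,
      dist (D.q m s) y < M₁ := by
    intro m
    rw [hS, Finset.mem_filter, Finset.mem_range]
  have hSout : ∀ {m : ℕ}, m < k → m ∉ S → ∀ s ∈ Set.Icc 0 (D.l m), FarFrom A i M₁ (D.q m s) := by
    intro m hm hmS s hs y hy
    by_contra! hlt
    exact hmS (hSmem.2 ⟨hm, s, hs, y, hy, hlt⟩)
  rcases S.eq_empty_or_nonempty with hSe | hSn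
  · have hnone : ∀ m < k, ∀ s ∈ Set.Icc 0 (D.l m), FarFrom A i M₁ (D.q m s) := fun m hm =>
      hSout hm (by rw [hSe]; exact Finset.notMem_empty _)
    exact before (fun m hm => hnone m (by omega)) fun s hs =>
      hnone n hn s ⟨hs.1, hs.2.trans ht'.2⟩
  obtain ⟨n₁, hn₁, hmin⟩ := S.exists_min_image id hSn
  obtain ⟨n₂, hn₂, hmax⟩ := S.exists_max_image id hSn
  obtain ⟨hn₁k, s₁, hs₁, hnear₁⟩ := hSmem.1 hn₁
  obtain ⟨hn₂k, s₂, hs₂, hnear₂⟩ := hSmem.1 hn₂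
  have hn₁₂ : n₁ ≤ n₂ := hmin n₂ hn₂
  have hout₁ : ∀ m < n₁, ∀ s ∈ Set.Icc 0 (D.l m), FarFrom A i M₁ (D.q m s) := fun m hm =>
    hSout (by omega) fun hmS => absurd (hmin m hmS) (not_le.2 hm)
  have hout₂ : ∀ m, n₂ < m → m < k → ∀ s ∈ Set.Icc 0 (D.l m), FarFrom A i M₁ (D.q m s) :=
    fun m hm hmk => hSout hmk fun hmS => absurd (hmax m hmS) (not_le.2 hm)
  obtain ⟨b, hb, hbn, hbo⟩ := exists_first_near hM₁ (D.geo n₁) hs₁ hnear₁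
  obtain ⟨a, ha, han, hao⟩ := exists_last_near hM₁ (D.geo n₂) hs₂ hnear₂
  have hb' : b ∈ Set.Icc 0 (D.l n₁) := ⟨hb.1, hb.2.trans hs₁.2⟩
  have ha' : a ∈ Set.Icc 0 (D.l n₂) := ⟨hs₂.1.trans ha.1, ha.2⟩
  -- The first entry into the neighbourhood of `A i` seen from the origin and, below, the last exit
  -- are both near `p`, hence within `B < θ` of each other: by fatness they are on one edge or at a
  -- common corner.
  have hpb : dist p (D.q n₁ b) ≤ B / 2 := by
    obtain ⟨w, hw, hle⟩ := exists_proj_forward h D.geo D.closes hp n₁ hout₁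
    have := h.dist_first_hit_le (D.geo n₁) hb' hbo hbn hw
    linarith [dist_triangle p w (D.q n₁ b), hcast hn₁k.le]
  have hpa : dist p (D.q n₂ a) ≤ B / 2 := by
    obtain ⟨w, hw, hle⟩ := back n₂ hn₂k hout₂
    have := h.dist_last_hit_le (D.geo n₂) ha' hao han hw
    linarith [dist_triangle p w (D.q n₂ a)]
  have hba : dist (D.q n₁ b) (D.q n₂ a) ≤ B := by
    linarith [dist_triangle_left (D.q n₁ b) (D.q n₂ a) p]
  have close : ∀ {x : X}, dist p x ≤ B / 2 → (∃ y ∈ A i, dist x y ≤ M₁ + 1) →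
      dist (D.q n t) x ≤ B → dist p r ≤ 3 * B + (k + 1) * C + M₁ + 2 := by
    rintro x hpx ⟨y, hy, hxy⟩ hle
    have h1 := hr.2 y hy
    have h2 := dist_triangle (D.q n t) x y
    have h3 := dist_triangle4 p x (D.q n t) r
    rw [dist_comm x] at h3
    have : 0 ≤ (k + 1) * C := by positivity
    linarith
  rcases lt_or_ge n n₁ with hnn₁ | hnn₁
  · exact before (fun m hm => hout₁ m (by omega)) fun s hs =>
      hout₁ n hnn₁ s ⟨hs.1, hs.2.trans ht'.2⟩
  rcases lt_or_ge n₂ n with hnn₂ | hnn₂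
  · exact after (fun m hm => hout₂ m (by omega)) fun s hs =>
      hout₂ n hnn₂ hn s ⟨ht'.1.trans hs.1, hs.2⟩
  have atFirst : n = n₁ → t < b → dist p r ≤ 3 * B + (k + 1) * C + M₁ + 2 := by
    rintro rfl htb
    exact before hout₁ fun s hs => hbo s ⟨hs.1, by linarith [hs.2]⟩
  have atLast : n = n₂ → a < t → dist p r ≤ 3 * B + (k + 1) * C + M₁ + 2 := by
    rintro rfl hat
    exact after hout₂ fun s hs => hao s ⟨by linarith [hs.1], hs.2⟩
  rcases hn₁₂.eq_or_lt with heq | hlt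
  · have hnn : n = n₁ := by omega
    have hnn' : n = n₂ := by omega
    rcases lt_or_ge t b with htb | htb
    · exact atFirst hnn htb
    rcases lt_or_ge a t with hat | hat
    · exact atLast hnn' hat
    subst hnn
    subst hnn'
    refine close hpb hbn ?_
    rw [(D.geo n).dist_eq hb'.1 (htb.trans hat) ha'.2] at hba
    rw [dist_comm, (D.geo n).dist_eq hb'.1 htb ht'.2]
    linarith
  rcases D.near n₁ n₂ hlt hn₂k b hb' a ha' (hba.trans_lt hBθ) with ⟨rfl, hb2⟩ | ⟨rfl, hb2⟩
  -- The entry would be within `2 * θ` of the origin, which is too far from `A i`.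
  · exfalso
    obtain ⟨y, hy, hby⟩ := hbn
    have h1 := hfar y hy
    have h2 := (D.geo 0).dist_zero hb'.1 hb'.2
    linarith [dist_triangle (D.q 0 0) (D.q 0 b) y]
  set t₀ := D.l n₁ - b with ht₀
  have ht₀0 : 0 ≤ t₀ := by linarith [hb'.2]
  have hcorner₁ : dist (D.q n₁ b) (D.q (n₁ + 1) 0) = t₀ := by
    rw [← D.closes, (D.geo n₁).dist_eq hb'.1 hb'.2 le_rfl]
  have hcorner₂ := (D.geo (n₁ + 1)).dist_zero ha'.1 ha'.2
  have hat₀ : |a - t₀| ≤ B := by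
    rw [abs_le]
    constructor
    · linarith [dist_triangle_right (D.q n₁ b) (D.q (n₁ + 1) 0) (D.q (n₁ + 1) a)]
    · linarith [dist_triangle_left (D.q (n₁ + 1) 0) (D.q (n₁ + 1) a) (D.q n₁ b)]
  -- Entry and exit have almost equal distances from the corner, so the points at time `t₀` on both
  -- edges are within `2 * B`. The maximality of the trimming time bounds `t₀`: the entry is in the
  -- trimmed part and the exit at most `B` beyond it.
  have ht₀T : t₀ ≤ D.T (n₁ + 1) := by
    refine D.le_T n₁ t₀ ht₀0 (by linarith) ?_
    rw [show D.l n₁ - t₀ = b by rw [ht₀]; ring]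
    have h1 := (D.geo (n₁ + 1)).2 a ha' t₀ ⟨ht₀0, by linarith [D.long (n₁ + 1)]⟩
    have h2 := dist_triangle (D.q n₁ b) (D.q (n₁ + 1) a) (D.q (n₁ + 1) t₀)
    linarith
  have hn_cases : n = n₁ ∨ n = n₁ + 1 := by omega
  have hTlt := D.T_lt
  rw [abs_le] at hat₀
  rcases hn_cases with rfl | rfl
  · rcases ht with rfl | rfl
    · exact atFirst rfl (by linarith [hTlt n, D.long n])
    · rcases lt_or_ge (D.l n - D.T (n + 1)) b with htb | htb
      · exact atFirst rfl htb
      · refine close hpb hbn ?_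
        rw [show D.l n - D.T (n + 1) = b by linarith, dist_self]
        exact hB0
  · rcases lt_or_ge a t with hat | hat
    · exact atLast rfl hat
    rcases ht with rfl | rfl
    · refine close hpa han ?_
      rw [(D.geo _).dist_eq ht'.1 hat ha'.2]
      linarith [hat₀.2]
    · exfalso
      linarith [hTlt (n₁ + 1 + 1), D.long (n₁ + 1), hat₀.2]

end ClosedPath

end TreeGraded

namespace TreeGraded

/-! ### Fat polygons are close to a piece -/

section FatPolygon

variable {X : Type u} [MetricSpace X] {ι : Type v} {A : ι → Set X} {k : ℕ} {P : GeodesicPolygon X k}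
  {θ : ℝ}

theorem zmod_add_one_ne_self (hk : 2 ≤ k) (j : ZMod k) : j + 1 ≠ j := by
  have : Fact (1 < k) := ⟨hk⟩
  simp

namespace GeodesicPolygon

theorem edge_mem_side {j : ZMod k} {t : ℝ} (ht : t ∈ Set.Icc 0 (P.len j)) :
    P.edge j t ∈ P.side j := ⟨t, ht, rfl⟩

theorem dist_edge_vertex {j : ZMod k} {t : ℝ} (ht : t ∈ Set.Icc 0 (P.len j)) :
    dist (P.edge j t) (P.vertex j) = t := by
  rw [dist_comm]
  exact (P.isGeodesic j).dist_zero ht.1 ht.2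

theorem dist_edge_vertex_succ {j : ZMod k} {t : ℝ} (ht : t ∈ Set.Icc 0 (P.len j)) :
    dist (P.edge j t) (P.vertex (j + 1)) = P.len j - t := by
  rw [vertex, ← P.closes, (P.isGeodesic j).dist_eq ht.1 ht.2 le_rfl]

/-- Points of different edges of a fat polygon that are close to each other are close to a common
vertex. -/
theorem IsFat.near_edges (hP : P.IsFat θ 2 8) {i j : ZMod k} (hij : i ≠ j) {t : ℝ}
    (ht : t ∈ Set.Icc 0 (P.len j)) {w : X} (hw : w ∈ P.side i) (hd : dist (P.edge j t) w < θ) :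
    (i = j - 1 ∧ t < 2 * θ) ∨ (i = j + 1 ∧ P.len j - t < 2 * θ) := by
  have hθ : 0 < θ := dist_nonneg.trans_lt hd
  have hmem : P.edge j t ∈ thickening (2 * θ) {P.vertex j, P.vertex (j + 1)} := by
    by_contra hcon
    exact absurd (hP.fat_edge j _ ⟨edge_mem_side ht, hcon⟩ w (Set.mem_biUnion hij hw)) (not_le.2 hd)
  obtain ⟨v, hv, hlt⟩ := mem_thickening_iff.1 hmem
  -- Otherwise the vertex `a` would be within `3 * θ < 8 * θ` of an edge not adjacent to it.
  have opp : ∀ a : ZMod k, dist (P.edge j t) (P.vertex a) < 2 * θ → i = a ∨ i = a - 1 := by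
    intro a ha
    by_contra! hcon
    have h1 := hP.fat_vertex a w (Set.mem_biUnion hcon hw)
    linarith [dist_triangle_left (P.vertex a) w (P.edge j t)]
  rcases hv with rfl | rfl
  · left
    refine ⟨(opp _ hlt).resolve_left hij, ?_⟩
    rwa [dist_edge_vertex ht] at hlt
  · right
    refine ⟨(opp _ hlt).resolve_right (by simpa using hij), ?_⟩
    rwa [dist_edge_vertex_succ ht] at hlt

/-- For `k ≥ 3` the end of edge `j` lies on an edge that is not adjacent to vertex `j`. For bigons
the vertex condition is void and short edges are possible. -/
theorem IsFat.le_len (hP : P.IsFat θ 2 8) (hk : 3 ≤ k) (j : ZMod k) : 8 * θ ≤ P.len j := by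
  have h2 : ((2 : ℕ) : ZMod k) ≠ 0 := by
    rw [Ne, ZMod.natCast_eq_zero_iff]
    exact fun h => absurd (Nat.le_of_dvd two_pos h) (by omega)
  have hj : j + 1 ∈ {i : ZMod k | i ≠ j ∧ i ≠ j - 1} := by
    refine ⟨zmod_add_one_ne_self (by omega) j, fun h => h2 ?_⟩
    push_cast
    linear_combination h
  have := hP.fat_vertex j (P.vertex (j + 1)) (Set.mem_biUnion hj
    ⟨0, ⟨le_rfl, (P.isGeodesic _).1⟩, rfl⟩)
  rwa [vertex, dist_edge_vertex_succ ⟨le_rfl, (P.isGeodesic j).1⟩, sub_zero] at this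

/-- A bigon with a short edge is contained in a ball. -/
theorem dist_vertex_lt_of_bigon (P : GeodesicPolygon X 2) {j : ZMod 2} {r : ℝ} (hj : P.len j < r) :
    ∀ x ∈ P.carrier, dist x (P.vertex 0) < r := by
  have hlen : ∀ i, P.len i = dist (P.vertex 0) (P.vertex 1) := by
    intro i
    have h := dist_edge_vertex_succ (P := P) (j := i) ⟨le_rfl, (P.isGeodesic i).1⟩
    rw [sub_zero] at h
    rw [← h]
    fin_cases i
    · rfl
    · exact dist_comm _ _
  intro x hx
  obtain ⟨i, t, ht, rfl⟩ := Set.mem_iUnion.1 hx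
  have hle : P.len i < r := by rwa [hlen, ← hlen j]
  have h1 := dist_edge_vertex ht
  have h2 := dist_edge_vertex_succ ht
  fin_cases i
  · exact h1.trans_lt (ht.2.trans_lt hle)
  · exact h2.trans_lt (by linarith [ht.1])

/-- The trimming times of a polygon: `T j` is the last time `t` at which the points at distance
`t` from the `j`-th vertex, on the two edges adjacent to it, are at distance at most `c`. -/
structure IsTrimming (P : GeodesicPolygon X k) (θ c : ℝ) (T : ZMod k → ℝ) : Prop where
  nonneg : ∀ j, 0 ≤ T j
  lt : ∀ j, T j < 2 * θ
  dist_le : ∀ j, dist (P.edge j (P.len j - T (j + 1))) (P.edge (j + 1) (T (j + 1))) ≤ c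
  le : ∀ j t, 0 ≤ t → t ≤ 4 * θ →
    dist (P.edge j (P.len j - t)) (P.edge (j + 1) t) ≤ c → t ≤ T (j + 1)

theorem IsFat.exists_isTrimming (hP : P.IsFat θ 2 8) (hk : 2 ≤ k) (hlong : ∀ j, 8 * θ ≤ P.len j)
    {c : ℝ} (hc : 0 ≤ c) (hcθ : c < θ) : ∃ T, P.IsTrimming θ c T := by
  have hθ : 0 < θ := hc.trans_lt hcθ
  have key : ∀ j, ∃ τ ∈ Set.Icc 0 (4 * θ), dist (P.edge j (P.len j - τ)) (P.edge (j + 1) τ) ≤ c ∧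
      ∀ t, 0 ≤ t → t ≤ 4 * θ → dist (P.edge j (P.len j - t)) (P.edge (j + 1) t) ≤ c → t ≤ τ := by
    intro j
    have hf : ContinuousOn (fun t => dist (P.edge j (P.len j - t)) (P.edge (j + 1) t))
        (Set.Icc 0 (4 * θ)) := by
      refine continuousOn_dist ?_ ?_
      · exact ((P.isGeodesic j).reverse.continuousOn).mono
          (Set.Icc_subset_Icc_right (by linarith [hlong j]))
      · exact ((P.isGeodesic (j + 1)).continuousOn).mono
          (Set.Icc_subset_Icc_right (by linarith [hlong (j + 1)]))
    have hS := (hf.preimage_isClosed_of_isClosed isClosed_Icc (isClosed_Iic (a := c)))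
    have hSc := isCompact_Icc.of_isClosed_subset hS Set.inter_subset_left
    obtain ⟨τ, hτ, hmax⟩ := hSc.exists_isGreatest ⟨0, ⟨le_rfl, by linarith⟩, by
      simp only [Set.mem_preimage, Set.mem_Iic, sub_zero, P.closes, dist_self, hc]⟩
    exact ⟨τ, hτ.1, hτ.2, fun t h0 h1 h2 => hmax ⟨⟨h0, h1⟩, h2⟩⟩
  choose τ hτ hle hmax using key
  -- Points closer than `θ` on adjacent edges are within `2 * θ` of a common vertex, so the maximum
  -- over `[0, 4 * θ]` stays well inside the interval.
  have hτlt : ∀ j, τ j < 2 * θ := by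
    intro j
    have h0 := (hτ j).1
    have h4 := (hτ j).2
    rcases hP.near_edges (zmod_add_one_ne_self hk j)
      (⟨by linarith [hlong j], by linarith⟩ : P.len j - τ j ∈ Set.Icc 0 (P.len j))
      (edge_mem_side ⟨h0, by linarith [hlong (j + 1)]⟩) ((hle j).trans_lt hcθ) with ⟨-, h⟩ | ⟨-, h⟩
    · linarith [hlong j]
    · linarith
  exact ⟨fun j => τ (j - 1), fun j => (hτ _).1, fun j => hτlt _, fun j => by simpa using hle j,
    fun j t h0 h1 h2 => by simpa using hmax j t h0 h1 h2⟩

/-- The endpoints of the trimmed edges. -/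
def corners (P : GeodesicPolygon X k) (T : ZMod k → ℝ) : Set X :=
  {x | ∃ j, x = P.edge j (T j) ∨ x = P.edge j (P.len j - T (j + 1))}

/-- A geodesic joining consecutive corners is close to the edge in between. -/
theorem IsTrimming.exists_near_side {c δ : ℝ} {T : ZMod k → ℝ} (hT : P.IsTrimming θ c T)
    (hlong : ∀ j, 8 * θ ≤ P.len j) (hX : IsGeodesicSpace X) (hV : ThinOn (P.corners T) δ)
    (j : ZMod k) {f : ℝ → X} {a : ℝ} (hf : IsGeodesic f a) (hf0 : f 0 = P.edge j (T j))
    (hfa : f a = P.edge (j + 1) (T (j + 1))) {s : ℝ} (hs : s ∈ Set.Icc 0 a) :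
    ∃ w ∈ P.side j, dist (f s) w ≤ δ + c := by
  have h1 := hT.lt j
  have h2 := hT.lt (j + 1)
  have h3 := hT.nonneg j
  have h4 := hT.nonneg (j + 1)
  have hl := hlong j
  have hc : 0 ≤ c := dist_nonneg.trans (hT.dist_le j)
  have he := ((P.isGeodesic j).shift h3 (by linarith)).initial
    (s := P.len j - T (j + 1) - T j) (by linarith) (by linarith)
  obtain ⟨g, b, hg, hg0, hgb, -⟩ := hX (P.edge j (P.len j - T (j + 1))) trivial
    (P.edge (j + 1) (T (j + 1))) trivial
  rcases hV f _ g a _ b hf he hg (by simp [hf0]) (by simp [hg0]) (by rw [hgb, hfa])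
    (by rw [hf0]; exact ⟨j, Or.inl rfl⟩) (by rw [hfa]; exact ⟨j + 1, Or.inl rfl⟩)
    ⟨j, Or.inr (by simp)⟩ s hs with ⟨r, hr, hle⟩ | ⟨r, hr, hle⟩
  · exact ⟨P.edge j (T j + r), edge_mem_side ⟨by linarith [hr.1], by linarith [hr.2]⟩, by linarith⟩
  · refine ⟨P.edge j (P.len j - T (j + 1)), edge_mem_side ⟨by linarith, by linarith⟩, ?_⟩
    have h5 := hg.dist_zero hr.1 hr.2
    have h6 := hg.dist_ends
    rw [hg0, hgb] at h6
    rw [hg0] at h5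
    have h7 := dist_triangle_right (f s) (P.edge j (P.len j - T (j + 1))) (g r)
    linarith [hT.dist_le j, hr.2]

/-- The corners of a long fat polygon do not span thin triangles. -/
theorem IsFat.not_thinOn (hP : P.IsFat θ 2 8) (hk : 2 ≤ k) {c δ : ℝ} {T : ZMod k → ℝ}
    (hT : P.IsTrimming θ c T) (hlong : ∀ j, 8 * θ ≤ P.len j) (hX : IsGeodesicSpace X) (hδ : 0 ≤ δ)
    (hθ : (k + 1) * δ + c < θ) : ¬ ThinOn (P.corners T) δ := by
  intro hV
  obtain ⟨o, ho⟩ : ∃ o : ZMod k, o = 0 := ⟨0, rfl⟩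
  have hc : 0 ≤ c := dist_nonneg.trans (hT.dist_le 0)
  have hθ0 : 0 < θ := by
    have : 0 ≤ (k + 1) * δ := by positivity
    linarith
  -- The midpoint of an edge is at least `4 * θ` from its ends, hence `θ` from all other edges.
  -- Thinness brings it within `(k + 1) * δ + c` of one: one triangle, `k - 1` for the polygon of
  -- the other corners, one more back to an edge.
  have far : ∀ j : ZMod k, j ≠ o → ∀ w ∈ P.side j, θ ≤ dist (P.edge o (P.len o / 2)) w := by
    intro j hj w hw
    have hl := hlong o
    by_contra! hlt
    rcases hP.near_edges hj ⟨by linarith, by linarith⟩ hw hlt with ⟨-, h⟩ | ⟨-, h⟩ <;> linarith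
  choose q l hq h0 h1 _ using fun p : ℕ => hX (P.edge (p + 1) (T (p + 1))) trivial
    (P.edge (p + 1 + 1) (T (p + 1 + 1))) trivial
  obtain ⟨f, b, hf, hf0, hfb, -⟩ := hX (P.edge o (T o)) trivial (P.edge (o + 1) (T (o + 1))) trivial
  obtain ⟨g, a, hg, hg0, hga, -⟩ := hX (P.edge (o + 1) (T (o + 1))) trivial
    (P.edge o (P.len o - T (o + 1))) trivial
  have hl := hlong o
  have t1 := hT.lt o
  have t2 := hT.lt (o + 1)
  have t3 := hT.nonneg o
  have t4 := hT.nonneg (o + 1)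
  have h10 : o + 1 ≠ o := zmod_add_one_ne_self hk o
  have hmem1 : P.edge (o + 1) (T (o + 1)) ∈ P.side (o + 1) :=
    edge_mem_side ⟨t4, by linarith [hlong (o + 1)]⟩
  have he := ((P.isGeodesic o).shift t3 (by linarith)).initial
    (s := P.len o - T (o + 1) - T o) (by linarith) (by linarith)
  have hk1 : ((k - 1 : ℕ) : ℝ) = k - 1 := by rw [Nat.cast_sub (by omega), Nat.cast_one]
  have hkδ : 2 * δ ≤ k * δ := mul_le_mul_of_nonneg_right (by exact_mod_cast hk) hδ
  rcases hV _ f g _ b a he hf hg (by simp [hf0]) (by rw [hfb, hg0]) (by simp [hga])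
    ⟨o, Or.inl (by simp)⟩ ⟨o, Or.inr (by simp)⟩ ⟨o + 1, Or.inl hfb⟩ (P.len o / 2 - T o)
    ⟨by linarith, by linarith⟩ with ⟨s, hs, hle⟩ | ⟨s, hs, hle⟩
  · rw [add_sub_cancel] at hle
    have hpoly := hV.polygon hX (x := fun p : ℕ => P.edge (p + 1) (T (p + 1)))
      (fun p => ⟨_, Or.inl rfl⟩) hq h0 (fun p => by rw [h1]; push_cast; rfl) (k - 1) _ b
      hf.reverse (by simp [hfb, ho]) (by
        have : ((k - 1 : ℕ) : ZMod k) + 1 = 0 := by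
          rw [← Nat.cast_succ, Nat.succ_eq_add_one, Nat.sub_add_cancel (by omega), ZMod.natCast_self]
        simp [this, hf0, ho]) (b - s) ⟨by linarith [hs.2], by linarith [hs.1]⟩
    rw [sub_sub_cancel, hk1] at hpoly
    rcases hpoly with h | ⟨p, hp, r, hr, h⟩
    · have h2 := far _ h10 _ hmem1
      simp only [Nat.cast_zero, ← ho] at h
      linarith [dist_triangle (P.edge o (P.len o / 2)) (f s) (P.edge (o + 1) (T (o + 1)))]
    · obtain ⟨w, hw, hqw⟩ := hT.exists_near_side hlong hX hV _ (hq p) (h0 p) (h1 p) hr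
      have hp0 : (p + 1 : ZMod k) ≠ o := by
        rw [ho, ← Nat.cast_succ, Ne, ZMod.natCast_eq_zero_iff]
        exact fun h => absurd (Nat.le_of_dvd (Nat.succ_pos p) h) (by omega)
      have h2 := far _ hp0 _ hw
      linarith [dist_triangle4 (P.edge o (P.len o / 2)) (f s) (q p r) w]
  · rw [add_sub_cancel] at hle
    have h2 := far _ h10 _ hmem1
    have h5 := hg.dist_zero hs.1 hs.2
    have h6 := hg.dist_ends
    rw [hg0, hga, dist_comm] at h6
    rw [hg0] at h5
    have h7 := dist_triangle_right (P.edge o (P.len o / 2)) (P.edge (o + 1) (T (o + 1))) (g s)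
    linarith [hT.dist_le o, hs.2]

/-- The closed path that runs through a fat polygon, starting from the vertex `m`. -/
def IsFat.fatPath (hP : P.IsFat θ 2 8) {c : ℝ} {T : ZMod k → ℝ}
    (hT : P.IsTrimming θ c T) (hlong : ∀ j, 8 * θ ≤ P.len j) (m : ZMod k) : FatPath X k θ c where
  q n := P.edge (m + n)
  l n := P.len (m + n)
  T n := T (m + n)
  geo n := P.isGeodesic _
  closes n := by rw [P.closes]; push_cast; rw [add_assoc]
  cyclic := by simp
  long n := hlong _
  near n n' hn hn' s hs t ht hd := by
    -- For `n < n' < k`, adjacency modulo `k` means `n' = n + 1`, or the wrap-around `n = 0`, `n' =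
    -- k - 1`.
    have cast_ne : ∀ d : ℕ, 0 < d → d < k → (d : ZMod k) ≠ 0 := fun d hd hdk h =>
      absurd (Nat.le_of_dvd hd ((ZMod.natCast_eq_zero_iff _ _).1 h)) (by omega)
    have hsub : ((n' - n : ℕ) : ZMod k) = n' - n := by rw [Nat.cast_sub hn.le]
    have hne : m + (n' : ZMod k) ≠ m + n := fun h =>
      cast_ne (n' - n) (by omega) (by omega) (by rw [hsub]; linear_combination h)
    rcases hP.near_edges hne hs (edge_mem_side ht) hd with ⟨h, hlt⟩ | ⟨h, hlt⟩
    · refine Or.inl ⟨?_, hlt⟩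
      by_contra hn0
      refine cast_ne (n' - n + 1) (by omega) (by omega) ?_
      push_cast
      rw [hsub]
      linear_combination h
    · refine Or.inr ⟨?_, hlt⟩
      by_contra hn0
      refine cast_ne (n' - n - 1) (by omega) (by omega) ?_
      rw [Nat.cast_sub (by omega), hsub]
      push_cast
      linear_combination h
  T_nonneg n := hT.nonneg _
  T_lt n := hT.lt _
  le_T n t h0 h1 h2 := by
    push_cast at h2 ⊢
    rw [← add_assoc] at h2 ⊢
    exact hT.le _ t h0 h1 h2

/-- The corners of a long fat polygon with a vertex far from `A i` have close projections. -/
theorem IsFat.projClose_corners (hP : P.IsFat θ 2 8) (hk : 2 ≤ k) {M₁ C B : ℝ} {T : ZMod k → ℝ}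
    (hT : P.IsTrimming θ (2 * B) T) (hlong : ∀ j, 8 * θ ≤ P.len j) (h : ProjConst A M₁ C)
    (hB : B = 2 * (k * C + (C + M₁ + 4))) (hBθ : B < θ) {i : ι} {m : ZMod k}
    (hfar : FarFrom A i (2 * θ + M₁ + 2) (P.vertex m)) {x y : X} (hx : x ∈ P.corners T)
    (hy : y ∈ P.corners T) : ProjClose A i (2 * (3 * B + (k + 1) * C + M₁ + 2)) x y := by
  have : NeZero k := ⟨by omega⟩
  have h0 : (hP.fatPath hT hlong m).q 0 0 = P.vertex m := by simp [fatPath, vertex]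
  have key : ∀ x ∈ P.corners T,
      ProjClose A i (3 * B + (k + 1) * C + M₁ + 2) (P.vertex m) x := by
    rintro x ⟨j, hj⟩ p r hp hr
    have hjm : m + ((j - m).val : ZMod k) = j := by simp
    have hjm' : m + (((j - m).val + 1 : ℕ) : ZMod k) = j + 1 := by
      push_cast
      rw [← add_assoc, hjm]
    have hle := fun t ht => (hP.fatPath hT hlong m).dist_proj_le h hB hBθ (by rwa [h0])
      (n := (j - m).val) (ZMod.val_lt _) (t := t) ht (p := p) (r := r) (by rwa [h0])
    simp only [fatPath, hjm, hjm'] at hle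
    rcases hj with rfl | rfl
    · exact hle _ (Or.inl rfl) hr
    · exact hle _ (Or.inr rfl) hr
  rw [two_mul]
  exact (key x hx).symm.trans (key y hy)

end GeodesicPolygon

/-- The order of constants matters: the projection bounds and then `δ` depend only on `X`, `A` and
`k`, and the fatness scale is chosen last to beat them. -/
theorem IsAsymptoticallyTreeGraded.alpha3 (hX : IsGeodesicSpace X)
    (hA : IsAsymptoticallyTreeGraded A) : Alpha3 A := by
  intro k hk
  obtain ⟨M, hM⟩ := hA.alpha2.exists_hitConst
  obtain ⟨M₁, C, hMM, hc⟩ := hA.exists_projConst hX hM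
  obtain ⟨χ₀, hχ₀, hnear⟩ := hA.exists_near_point
  obtain ⟨B, hB⟩ : ∃ B, B = 2 * (k * C + (C + M₁ + 4)) := ⟨_, rfl⟩
  obtain ⟨δ, hδ, hthin⟩ := hA.exists_thinOn hX hM hc hMM (2 * (3 * B + (k + 1) * C + M₁ + 2))
  have hM₁ := hc.pos
  have hB0 : 0 ≤ B := by
    have := hc.nonneg
    rw [hB]
    positivity
  obtain ⟨θ, hθ⟩ : ∃ θ, θ = (k + 1) * δ + 2 * B + 1 := ⟨_, rfl⟩
  have hkδ : 0 ≤ (k + 1) * δ := by positivity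
  set r := 2 * θ + M₁ + 2 with hr
  have hMr : HitConst A r := ⟨by linarith, fun q ℓ hq i h0 h1 => by
    obtain ⟨t, ht, y, hy, hlt⟩ := hM.2 q ℓ hq i h0 h1
    exact ⟨t, ht, y, hy, by linarith⟩⟩
  refine ⟨θ, by linarith, 8, le_rfl, 5 * r + (8 * θ + χ₀), by linarith, fun P hP => ?_⟩
  by_cases hlong : ∀ j, 8 * θ ≤ P.len j
  · by_contra! hcon
    -- If all vertices were within `r` of one `A i`, quasiconvexity would keep all edges within `5 *
    -- r`.
    have hfar : ∀ i, ∃ m, FarFrom A i r (P.vertex m) := by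
      intro i
      by_contra! hall
      simp only [FarFrom, not_forall, not_le, exists_prop] at hall
      refine hcon i fun x hx => ?_
      obtain ⟨j, t, ht, rfl⟩ := Set.mem_iUnion.1 hx
      obtain ⟨y, hy, hlt⟩ := hMr.quasiconvex (P.isGeodesic j) (hall j)
        (by rw [P.closes]; exact hall (j + 1)) ht
      exact mem_thickening_iff.2 ⟨y, hy, by linarith⟩
    obtain ⟨T, hT⟩ := hP.exists_isTrimming hk hlong (c := 2 * B) (by linarith) (by linarith)
    refine hP.not_thinOn hk hT hlong hX hδ.le (by linarith) (hthin _ fun x hx y hy i => ?_)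
    obtain ⟨m, hm⟩ := hfar i
    exact hP.projClose_corners hk hT hlong hc hB (by linarith) hm hx hy
  · push Not at hlong
    obtain ⟨j, hj⟩ := hlong
    -- Only a bigon can have a short edge; it lies in a small ball, and every point is near the
    -- family.
    obtain rfl : k = 2 := by
      by_contra hk2
      exact absurd (hP.le_len (by omega) j) (not_le.2 hj)
    obtain ⟨i, y, hy, hlt⟩ := hnear (P.vertex 0)
    refine ⟨i, fun x hx => mem_thickening_iff.2 ⟨y, hy, ?_⟩⟩
    linarith [dist_triangle x (P.vertex 0) y, P.dist_vertex_lt_of_bigon hj x hx]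

end FatPolygon

end TreeGraded

theorem mainTheorem2 {X : Type*} [MetricSpace X] {ι : Type*}
    (hX : TreeGraded.IsGeodesicSpace X) (A : ι → Set X) :
    TreeGraded.IsAsymptoticallyTreeGraded A ↔
      TreeGraded.Alpha1 A ∧ TreeGraded.Alpha2 A ∧ TreeGraded.Alpha3 A :=
  ⟨fun h => ⟨h.alpha1, h.alpha2, h.alpha3 hX⟩,
    fun h => TreeGraded.isAsymptoticallyTreeGraded_of_alpha hX h.1 h.2.1 h.2.2⟩
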